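/- Let $\mathcal{C}$ be a category. The loops $\mathcal{L}(\mathcal{C})$ are the endomorphisms of $\mathcal{C}$ modulo the equivalence relation generated by identifying a composite $A_1\xrightarrow{f_1}A_2\to\cdots\to A_k\xrightarrow{f_k}A_1$ with its cyclic permutations, and $\mathcal{M}(X)$ denotes the free commutative monoid (finite multisets) on a set $X$. Define $F_{\mathsf{Tr}}(\mathcal{C})$ as follows. * Objects are finite lists $(n,A)$, $A:\{1,\dots,n\}\to \mathrm{Ob}\,\mathcal{C}$. There are morphisms $(n,A)\to(m,B)$ only if $n=m$; these are the triples $(S,\pi,\lambda)$ with $S\in\mathcal{M}(\mathcal{L}(\mathcal{C}))$, $\pi\in S(n)$ and $\lambda_i:A_i\to B_{\pi(i)}$ for $1\le i\le n$. * Composition is $(T,\sigma,\mu)\circ(S,\pi,\lambda)=(S\uplus T,\ \sigma\circ\pi,\ i\mapsto\mu_{\pi(i)}\circ\lambda_i)$; the tensor product of objects is concatenation, with unit the empty list, that of morphisms is $(S,\pi,\lambda)\otimes(T,\sigma,\mu)=(S\uplus T,\ \pi\otimes\sigma,\ [\lambda,\mu])$, and the symmetry exchanges two blocks with identity labels. *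 For $(S,\pi,\lambda):(n,A)\otimes(m,U)\to(n,B)\otimes(m,U)$ the trace is $\mathsf{Tr}(S,\pi,\lambda)=(S\uplus T,\ p_\pi,\ \mu)$. Here, for $i\le n$, $p_\pi(i)=\pi^{k+1}(i)$ where $k\ge 0$ is least with $\pi^{k+1}(i)\le n$, and $\mu_i=\lambda_{\pi^k(i)}\circ\cdots\circ\lambda_{\pi(i)}\circ\lambda_i$; and $T$ is the multiset that contains, for each cycle $j,\pi(j),\dots,\pi^{l}(j)$, $\pi^{l+1}(j)=j$, of $\pi$ all of whose elements are $>n$, the loop $[\lambda_{\pi^l(j)}\circ\cdots\circ\lambda_j]$. Then these operations are well defined (in particular each $k$ exists and $p_\pi\in S(n)$) and make $F_{\mathsf{Tr}}(\mathcal{C})$ a traced strict symmetric monoidal category, and it is the free one on $\mathcal{C}$: with $\eta:\mathcal{C}\to F_{\mathsf{Tr}}(\mathcal{C})$ the inclusion as lists of length one, for every traced strict symmetric monoidal category $\mathcal{D}$ and functor $F:\mathcal{C}\to\mathcal{D}$ there is a unique functor $G:F_{\mathsf{Tr}}(\mathcal{C})\to\mathcal{D}$ that strictly preserves the tensor product,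 unit, symmetry and trace and satisfies $G\circ\eta=F$. Moreover: 1. If $S$ is the multiset of the classes of endomorphisms $s_1,\dots,s_r$ of $\mathcal{C}$, $s_q:X_q\to X_q$, then every morphism $(S,\pi,\lambda):(n,A)\to(n,B)$ is $$\Big(\prod_{q=1}^{r}\mathsf{Tr}^{X_q}_{\mathrm I,\mathrm I}(\eta(s_q))\Big)\bullet\Big(\pi^{-1}\circ\bigotimes_{i=1}^n\eta(\lambda_i)\Big),$$ where $\bullet$ is multiplication by a scalar and $\pi^{-1}:\bigotimes_i\eta(B_{\pi(i)})\to\bigotimes_i\eta(B_i)$ is the loop-free morphism with permutation $\pi$ and identity labels, which is a composite of tensor products of identities and symmetries. 2. The monoid of scalars $F_{\mathsf{Tr}}(\mathcal{C})(\mathrm I,\mathrm I)$ is $\mathcal{M}(\mathcal{L}(\mathcal{C}))$, via $(S,\pi,\lambda)\mapsto S$. 3. For the category $\mathbf 1$ with one object and one morphism, $F_{\mathsf{Tr}}(\mathbf 1)\cong\big(\coprod_{n\in\mathbb N}S(n)\big)\times(\mathbb N,+,0)$ as categories, where the groups $S(n)$ and the monoid $\mathbb{N}$ are regarded as one-object categories;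 a pair $(\pi,k)$ corresponds to the permutation $\pi$ with $k$ copies of the identity loop. -/

import Mathlib

open CategoryTheory MonoidalCategory

universe v v₁ v₂ u u₁ u₂

/-! ### Strict monoidal categories, traces, strict functors -/

/-- A monoidal category is strict when the tensor product is associative and unital on the nose and
the structural isomorphisms are the identities (transported along the equalities of objects). -/
class IsStrictMonoidal (D : Type u) [Category.{v} D] [MonoidalCategory D] : Prop where
  assoc_obj (X Y Z : D) : (X ⊗ Y) ⊗ Z = X ⊗ (Y ⊗ Z)
  unit_tensor_obj (X : D) : 𝟙_ D ⊗ X = X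
  tensor_unit_obj (X : D) : X ⊗ 𝟙_ D = X
  associator_hom (X Y Z : D) : (α_ X Y Z).hom = eqToHom (assoc_obj X Y Z)
  leftUnitor_hom (X : D) : (λ_ X).hom = eqToHom (unit_tensor_obj X)
  rightUnitor_hom (X : D) : (ρ_ X).hom = eqToHom (tensor_unit_obj X)

/-- A trace on a symmetric monoidal category. In a strict monoidal category, the associators and
unitors in the axioms are identities. -/
class TracedCategory (D : Type u) [Category.{v} D] [MonoidalCategory D] [SymmetricCategory D] where
  trace {A B : D} (U : D) (f : A ⊗ U ⟶ B ⊗ U) : A ⟶ B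
  input_naturality {A A' B U : D} (f : A ⊗ U ⟶ B ⊗ U) (g : A' ⟶ A) :
    g ≫ trace U f = trace U ((g ▷ U) ≫ f)
  output_naturality {A B B' U : D} (f : A ⊗ U ⟶ B ⊗ U) (g : B ⟶ B') :
    trace U f ≫ g = trace U (f ≫ (g ▷ U))
  feedback_dinaturality {A B U U' : D} (f : A ⊗ U ⟶ B ⊗ U') (g : U' ⟶ U) :
    trace U (f ≫ (B ◁ g)) = trace U' ((A ◁ g) ≫ f)
  vanishing_unit {A B : D} (f : A ⊗ 𝟙_ D ⟶ B ⊗ 𝟙_ D) :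
    trace (𝟙_ D) f = (ρ_ A).inv ≫ f ≫ (ρ_ B).hom
  vanishing_tensor {A B U V : D} (g : A ⊗ (U ⊗ V) ⟶ B ⊗ (U ⊗ V)) :
    trace (U ⊗ V) g = trace U (trace V ((α_ A U V).hom ≫ g ≫ (α_ B U V).inv))
  superposing {A B U W Z : D} (f : A ⊗ U ⟶ B ⊗ U) (g : W ⟶ Z) :
    g ⊗ₘ trace U f = trace U ((α_ W A U).hom ≫ (g ⊗ₘ f) ≫ (α_ Z B U).inv)
  yanking (U : D) : trace U (β_ U U).hom = 𝟙 U

/-- A functor between traced symmetric monoidal categories that preserves the tensor product, the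
unit, the symmetry and the trace on the nose. -/
structure IsStrictTracedFunctor {D : Type u₁} [Category.{v₁} D] [MonoidalCategory D]
    [SymmetricCategory D] [TracedCategory D] {E : Type u₂} [Category.{v₂} E] [MonoidalCategory E]
    [SymmetricCategory E] [TracedCategory E] (G : D ⥤ E) : Prop where
  obj_unit : G.obj (𝟙_ D) = 𝟙_ E
  obj_tensor (X Y : D) : G.obj (X ⊗ Y) = G.obj X ⊗ G.obj Y
  map_tensor {X Y X' Y' : D} (f : X ⟶ Y) (g : X' ⟶ Y') :
    G.map (f ⊗ₘ g) =
      eqToHom (obj_tensor X X') ≫ (G.map f ⊗ₘ G.map g) ≫ eqToHom (obj_tensor Y Y').symm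
  map_braiding (X Y : D) :
    G.map (β_ X Y).hom =
      eqToHom (obj_tensor X Y) ≫ (β_ (G.obj X) (G.obj Y)).hom ≫ eqToHom (obj_tensor Y X).symm
  map_trace {X Y : D} (U : D) (f : X ⊗ U ⟶ Y ⊗ U) :
    G.map (TracedCategory.trace U f) =
      TracedCategory.trace (G.obj U)
        (eqToHom (obj_tensor X U).symm ≫ G.map f ≫ eqToHom (obj_tensor Y U))

/-! ### Loops -/

/-- One rotation of a cyclic composite. -/
inductive CyclicRotation (C : Type u) [Category.{v} C] :
    (Σ X : C, X ⟶ X) → (Σ X : C, X ⟶ X) → Prop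
  | rotate {X Y : C} (f : X ⟶ Y) (g : Y ⟶ X) : CyclicRotation C ⟨X, f ≫ g⟩ ⟨Y, g ≫ f⟩

/-- The loops of a category: its endomorphisms modulo the equivalence relation generated by
cyclic permutation of composites. -/
def CatLoop (C : Type u) [Category.{v} C] : Type (max u v) := Quot (CyclicRotation C)

/-- The loop represented by an endomorphism. -/
def CatLoop.mk {C : Type u} [Category.{v} C] {X : C} (s : X ⟶ X) : CatLoop C :=
  Quot.mk (CyclicRotation C) ⟨X, s⟩

/-! ### The category of lists, multisets of loops and labelled permutations -/

/-- Finite lists of objects of `C`, as pairs `(n, A)` with `A : [n] → Ob C`. -/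
structure FreeTraced (C : Type u) where
  len : ℕ
  obj : Fin len → C

namespace FreeTraced

variable {C : Type u}

/-- Concatenation of lists. -/
def append (A B : FreeTraced C) : FreeTraced C :=
  ⟨A.len + B.len, fun x => Sum.elim A.obj B.obj (finSumFinEquiv.symm x)⟩

/-- The empty list. -/
def empty : FreeTraced C := ⟨0, Fin.elim0⟩

theorem obj_ext {A B : FreeTraced C} (h : A.len = B.len)
    (h' : ∀ i, A.obj i = B.obj (Fin.cast h i)) : A = B := by
  obtain ⟨n, A⟩ := A
  obtain ⟨m, B⟩ := B
  obtain rfl : n = m := h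
  congr 1
  funext i
  exact h' i

/-! Positions in a concatenation, and the values of the operations there. -/

def inL (A B : FreeTraced C) (i : Fin A.len) : Fin (append A B).len := Fin.castAdd B.len i
def inR (A B : FreeTraced C) (i : Fin B.len) : Fin (append A B).len := Fin.natAdd A.len i

theorem append_cases {A B : FreeTraced C} {P : Fin (append A B).len → Prop}
    (hl : ∀ i, P (inL A B i)) (hr : ∀ i, P (inR A B i)) : ∀ x, P x :=
  Fin.addCases hl hr

theorem symm_inL (A B : FreeTraced C) (i) : finSumFinEquiv.symm (inL A B i) = Sum.inl i :=
  finSumFinEquiv_symm_apply_castAdd i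
theorem symm_inR (A B : FreeTraced C) (i) : finSumFinEquiv.symm (inR A B i) = Sum.inr i :=
  finSumFinEquiv_symm_apply_natAdd i

theorem obj_inL (A B : FreeTraced C) (i) : (append A B).obj (inL A B i) = A.obj i := by
  simp only [append, symm_inL, Sum.elim_inl]
theorem obj_inR (A B : FreeTraced C) (i) : (append A B).obj (inR A B i) = B.obj i := by
  simp only [append, symm_inR, Sum.elim_inr]


theorem elim_swap (A B : FreeTraced C) (y : Fin A.len ⊕ Fin B.len) :
    Sum.elim A.obj B.obj y = Sum.elim B.obj A.obj (Equiv.sumComm _ _ y) := by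
  cases y <;> rfl

theorem append_assoc (A B D : FreeTraced C) :
    append (append A B) D = append A (append B D) := by
  refine obj_ext (Nat.add_assoc _ _ _) fun i => ?_
  induction i using append_cases with
  | hl i =>
    induction i using append_cases with
    | hl i =>
      have : Fin.cast (Nat.add_assoc _ _ _) (inL (append A B) D (inL A B i))
        = inL A (append B D) i := rfl
      rw [obj_inL, obj_inL]
      exact (obj_inL A (append B D) i).symm.trans (congrArg _ this.symm)
    | hr i =>
      have : Fin.cast (Nat.add_assoc _ _ _) (inL (append A B) D (inR A B i))
        = inR A (append B D) (inL B D i) := rfl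
      rw [obj_inL, obj_inR]
      exact (((obj_inR A (append B D) _).trans (obj_inL B D i)).symm).trans
        (congrArg _ this.symm)
  | hr i =>
    have : Fin.cast (Nat.add_assoc _ _ _) (inR (append A B) D i)
      = inR A (append B D) (inR B D i) := Fin.ext (Nat.add_assoc _ _ _)
    rw [obj_inR]
    exact (((obj_inR A (append B D) _).trans (obj_inR B D i)).symm).trans (congrArg _ this.symm)

theorem empty_append (A : FreeTraced C) : append empty A = A := by
  refine obj_ext (Nat.zero_add _) fun i => ?_
  induction i using append_cases with
  | hl i => exact i.elim0
  | hr i => rw [obj_inR]; exact congrArg _ (Fin.ext (Nat.zero_add _).symm)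

theorem append_empty (A : FreeTraced C) : append A empty = A := by
  refine obj_ext (Nat.add_zero _) fun i => ?_
  induction i using append_cases with
  | hl i => rw [obj_inL]; rfl
  | hr i => exact i.elim0

/-- A morphism `(S, π, λ)`: a multiset of loops, a permutation, and a labelling
`λ i : A i ⟶ B (π i)`. A bijection from `Fin n` to `Fin m` exists only if `n = m`, so there are
morphisms only between lists of the same length. -/
@[ext]
structure Hom [Category.{v} C] (A B : FreeTraced C) : Type (max u v) where
  loops : Multiset (CatLoop C)
  perm : Fin A.len ≃ Fin B.len
  arrow (i : Fin A.len) : A.obj i ⟶ B.obj (perm i)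

variable [Category.{v} C]

/-- Composition: `(T, σ, μ) ∘ (S, π, λ) = (S ⊎ T, σ ∘ π, i ↦ μ (π i) ∘ λ i)`. -/
instance : Category.{max u v} (FreeTraced C) where
  Hom := Hom
  id A := ⟨0, Equiv.refl _, fun i => 𝟙 (A.obj i)⟩
  comp f g := ⟨f.loops + g.loops, f.perm.trans g.perm, fun i => f.arrow i ≫ g.arrow (f.perm i)⟩
  id_comp f := Hom.ext (by simp) rfl (heq_of_eq (funext fun i => Category.id_comp (f.arrow i)))
  comp_id f := Hom.ext (by simp) rfl (heq_of_eq (funext fun i => Category.comp_id (f.arrow i)))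
  assoc f g h := Hom.ext (add_assoc _ _ _) rfl
    (heq_of_eq (funext fun i => Category.assoc (f.arrow i) _ _))

@[simp] theorem id_loops (A : FreeTraced C) : Hom.loops (𝟙 A) = 0 := rfl
@[simp] theorem id_perm (A : FreeTraced C) : Hom.perm (𝟙 A) = Equiv.refl _ := rfl
@[simp] theorem id_arrow (A : FreeTraced C) (i) : Hom.arrow (𝟙 A) i = 𝟙 (A.obj i) := rfl
@[simp] theorem comp_loops {A B D : FreeTraced C} (f : A ⟶ B) (g : B ⟶ D) :
    Hom.loops (f ≫ g) = Hom.loops f + Hom.loops g := rfl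
@[simp] theorem comp_perm {A B D : FreeTraced C} (f : A ⟶ B) (g : B ⟶ D) :
    Hom.perm (f ≫ g) = (Hom.perm f).trans (Hom.perm g) := rfl
@[simp] theorem comp_arrow {A B D : FreeTraced C} (f : A ⟶ B) (g : B ⟶ D) (i) :
    Hom.arrow (f ≫ g) i = Hom.arrow f i ≫ Hom.arrow g (Hom.perm f i) := rfl

theorem hom_ext {A B : FreeTraced C} {f g : A ⟶ B} (h₁ : Hom.loops f = Hom.loops g)
    (h₂ : ∀ i, Hom.perm f i = Hom.perm g i)
    (h₃ : ∀ i, HEq (Hom.arrow f i) (Hom.arrow g i)) : f = g := by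
  obtain ⟨S, π, l⟩ := f
  obtain ⟨S', π', l'⟩ := g
  obtain rfl : S = S' := h₁
  obtain rfl : π = π' := Equiv.ext h₂
  congr 1
  funext i
  exact eq_of_heq (h₃ i)

theorem arrow_congr {A B : FreeTraced C} (f : A ⟶ B) {i j : Fin A.len} (h : i = j) :
    HEq (Hom.arrow f i) (Hom.arrow f j) := by
  subst h; rfl

theorem comp_heq {X Y Z X' Y' Z' : C} {f : X ⟶ Y} {g : Y ⟶ Z} {f' : X' ⟶ Y'} {g' : Y' ⟶ Z'}
    (hX : X = X') (hY : Y = Y') (hZ : Z = Z') (hf : HEq f f') (hg : HEq g g') :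
    HEq (f ≫ g) (f' ≫ g') := by
  subst hX hY hZ; obtain rfl := eq_of_heq hf; obtain rfl := eq_of_heq hg; rfl

theorem comp_eqToHom_heq' {X Y Z : C} (f : X ⟶ Y) (h : Y = Z) : HEq (f ≫ eqToHom h) f := by
  subst h; simp

theorem eqToHom_comp_heq' {X Y Z : C} (h : X = Y) (f : Y ⟶ Z) : HEq (eqToHom h ≫ f) f := by
  subst h; simp

@[simp] theorem eqToHom_loops {A B : FreeTraced C} (h : A = B) : Hom.loops (eqToHom h) = 0 := by
  subst h; rfl
theorem eqToHom_perm {A B : FreeTraced C} (h : A = B) (i) :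
    Hom.perm (eqToHom h) i = Fin.cast (by rw [h]) i := by
  subst h; rfl
theorem obj_cast {A B : FreeTraced C} (h : A = B) (i) :
    B.obj (Hom.perm (eqToHom h) i) = A.obj i := by
  subst h; rfl
@[simp] theorem eqToHom_arrow {A B : FreeTraced C} (h : A = B) (i) :
    Hom.arrow (eqToHom h) i = eqToHom (obj_cast h i).symm := by
  subst h; rfl

/-- The labelling `[λ, μ]` of the disjoint union of two permutations. -/
def sumArrow {A B A' B' : FreeTraced C} (f : A ⟶ B) (g : A' ⟶ B') :
    ∀ x : Fin A.len ⊕ Fin A'.len,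
      Sum.elim A.obj A'.obj x ⟶ Sum.elim B.obj B'.obj (Sum.map (Hom.perm f) (Hom.perm g) x)
  | Sum.inl i => Hom.arrow f i
  | Sum.inr i => Hom.arrow g i

/-- Tensor product: `(S, π, λ) ⊗ (T, σ, μ) = (S ⊎ T, π ⊗ σ, [λ, μ])`. -/
def tensor {A B A' B' : FreeTraced C} (f : A ⟶ B) (g : A' ⟶ B') : append A A' ⟶ append B B' :=
  ⟨Hom.loops f + Hom.loops g,
    finSumFinEquiv.symm.trans ((Equiv.sumCongr (Hom.perm f) (Hom.perm g)).trans finSumFinEquiv),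
    fun x => sumArrow f g (finSumFinEquiv.symm x) ≫
      eqToHom (congrArg (Sum.elim B.obj B'.obj) (Equiv.symm_apply_apply _ _).symm)⟩

/-- The symmetry: the permutation exchanging two blocks, labelled by identities. -/
def swap (A B : FreeTraced C) : append A B ⟶ append B A :=
  ⟨0, finSumFinEquiv.symm.trans ((Equiv.sumComm _ _).trans finSumFinEquiv),
    fun x => eqToHom ((elim_swap A B _).trans
      (congrArg (Sum.elim B.obj A.obj) (Equiv.symm_apply_apply _ _).symm))⟩

theorem tensor_perm_inL {A B A' B' : FreeTraced C} (f : A ⟶ B) (g : A' ⟶ B') (i) :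
    Hom.perm (tensor f g) (inL A A' i) = inL B B' (Hom.perm f i) := by
  change finSumFinEquiv (Equiv.sumCongr _ _ (finSumFinEquiv.symm (inL A A' i))) = _
  rw [symm_inL]; rfl
theorem tensor_perm_inR {A B A' B' : FreeTraced C} (f : A ⟶ B) (g : A' ⟶ B') (i) :
    Hom.perm (tensor f g) (inR A A' i) = inR B B' (Hom.perm g i) := by
  change finSumFinEquiv (Equiv.sumCongr _ _ (finSumFinEquiv.symm (inR A A' i))) = _
  rw [symm_inR]; rfl
theorem sumArrow_congr {A B A' B' : FreeTraced C} (f : A ⟶ B) (g : A' ⟶ B') {x y}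
    (h : x = y) : HEq (sumArrow f g x) (sumArrow f g y) := by
  subst h; rfl
theorem tensor_arrow_inL {A B A' B' : FreeTraced C} (f : A ⟶ B) (g : A' ⟶ B') (i) :
    HEq (Hom.arrow (tensor f g) (inL A A' i)) (Hom.arrow f i) :=
  (comp_eqToHom_heq' _ _).trans (sumArrow_congr f g (symm_inL A A' i))
theorem tensor_arrow_inR {A B A' B' : FreeTraced C} (f : A ⟶ B) (g : A' ⟶ B') (i) :
    HEq (Hom.arrow (tensor f g) (inR A A' i)) (Hom.arrow g i) :=
  (comp_eqToHom_heq' _ _).trans (sumArrow_congr f g (symm_inR A A' i))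
theorem swap_perm_inL (A B : FreeTraced C) (i) :
    Hom.perm (swap A B) (inL A B i) = inR B A i := by
  change finSumFinEquiv (Equiv.sumComm _ _ (finSumFinEquiv.symm (inL A B i))) = _
  rw [symm_inL]; rfl
theorem swap_perm_inR (A B : FreeTraced C) (i) :
    Hom.perm (swap A B) (inR A B i) = inL B A i := by
  change finSumFinEquiv (Equiv.sumComm _ _ (finSumFinEquiv.symm (inR A B i))) = _
  rw [symm_inR]; rfl
@[simp] theorem swap_loops (A B : FreeTraced C) : Hom.loops (swap A B) = 0 := rfl
@[simp] theorem tensor_loops {A B A' B' : FreeTraced C} (f : A ⟶ B) (g : A' ⟶ B') :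
    Hom.loops (tensor f g) = Hom.loops f + Hom.loops g := rfl

/-- Morphisms without loops all of whose labels are identities. -/
structure IsRelabel {A B : FreeTraced C} (f : A ⟶ B) : Prop where
  loops : Hom.loops f = 0
  obj (i) : A.obj i = B.obj (Hom.perm f i)
  arrow (i) : Hom.arrow f i = eqToHom (obj i)

theorem IsRelabel.heq {A B : FreeTraced C} {f : A ⟶ B} (h : IsRelabel f) (i) :
    HEq (Hom.arrow f i) (𝟙 (A.obj i)) := by
  rw [h.arrow i, ← Category.id_comp (eqToHom _)]
  exact comp_eqToHom_heq' _ _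

theorem isRelabel_of_heq {A B : FreeTraced C} {f : A ⟶ B} (h : Hom.loops f = 0)
    (ho : ∀ i, A.obj i = B.obj (Hom.perm f i))
    (ha : ∀ i, HEq (Hom.arrow f i) (𝟙 (A.obj i))) : IsRelabel f :=
  ⟨h, ho, fun i => eq_of_heq ((ha i).trans (by
    rw [← Category.id_comp (eqToHom _)]; exact (comp_eqToHom_heq' _ _).symm))⟩

theorem IsRelabel.ext {A B : FreeTraced C} {f g : A ⟶ B} (hf : IsRelabel f) (hg : IsRelabel g)
    (h : ∀ i, Hom.perm f i = Hom.perm g i) : f = g :=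
  hom_ext (hf.loops.trans hg.loops.symm) h fun i => (hf.heq i).trans (hg.heq i).symm

theorem IsRelabel.comp {A B D : FreeTraced C} {f : A ⟶ B} {g : B ⟶ D} (hf : IsRelabel f)
    (hg : IsRelabel g) : IsRelabel (f ≫ g) :=
  ⟨by simp [hf.loops, hg.loops], fun i => (hf.obj i).trans (hg.obj _), fun i => by
    rw [comp_arrow, hf.arrow, hg.arrow]; exact eqToHom_trans _ _⟩

theorem IsRelabel.tensor {A B A' B' : FreeTraced C} {f : A ⟶ B} {g : A' ⟶ B'}
    (hf : IsRelabel f) (hg : IsRelabel g) : IsRelabel (tensor f g) := by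
  refine isRelabel_of_heq (by simp [hf.loops, hg.loops]) (fun i => ?_) fun i => ?_
  · induction i using append_cases with
    | hl i => rw [tensor_perm_inL, obj_inL, obj_inL]; exact hf.obj i
    | hr i => rw [tensor_perm_inR, obj_inR, obj_inR]; exact hg.obj i
  · induction i using append_cases with
    | hl i =>
      exact ((tensor_arrow_inL f g i).trans (hf.heq i)).trans
        (congr_arg_heq (fun X : C => 𝟙 X) (obj_inL A A' i).symm)
    | hr i =>
      exact ((tensor_arrow_inR f g i).trans (hg.heq i)).trans
        (congr_arg_heq (fun X : C => 𝟙 X) (obj_inR A A' i).symm)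

theorem isRelabel_eqToHom {A B : FreeTraced C} (h : A = B) : IsRelabel (eqToHom h) :=
  ⟨eqToHom_loops h, fun i => (obj_cast h i).symm, eqToHom_arrow h⟩

theorem isRelabel_id (A : FreeTraced C) : IsRelabel (𝟙 A) := isRelabel_eqToHom rfl

theorem isRelabel_swap (A B : FreeTraced C) : IsRelabel (swap A B) :=
  ⟨rfl, fun i => (elim_swap A B _).trans
    (congrArg (Sum.elim B.obj A.obj) (Equiv.symm_apply_apply _ _).symm), fun _ => rfl⟩

theorem assoc_perm_LL (A B D : FreeTraced C) (i) :
    Hom.perm (eqToHom (append_assoc A B D)) (inL (append A B) D (inL A B i)) =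
      inL A (append B D) i := by
  rw [eqToHom_perm]; rfl
theorem assoc_perm_LR (A B D : FreeTraced C) (i) :
    Hom.perm (eqToHom (append_assoc A B D)) (inL (append A B) D (inR A B i)) =
      inR A (append B D) (inL B D i) := by
  rw [eqToHom_perm]; rfl
theorem assoc_perm_R (A B D : FreeTraced C) (i) :
    Hom.perm (eqToHom (append_assoc A B D)) (inR (append A B) D i) =
      inR A (append B D) (inR B D i) := by
  rw [eqToHom_perm]; exact Fin.ext (Nat.add_assoc _ _ _)
theorem assoc_symm_perm_L (A B D : FreeTraced C) (i) :
    Hom.perm (eqToHom (append_assoc A B D).symm) (inL A (append B D) i) =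
      inL (append A B) D (inL A B i) := by
  rw [eqToHom_perm]; rfl
theorem assoc_symm_perm_RL (A B D : FreeTraced C) (i) :
    Hom.perm (eqToHom (append_assoc A B D).symm) (inR A (append B D) (inL B D i)) =
      inL (append A B) D (inR A B i) := by
  rw [eqToHom_perm]; rfl
theorem assoc_symm_perm_RR (A B D : FreeTraced C) (i) :
    Hom.perm (eqToHom (append_assoc A B D).symm) (inR A (append B D) (inR B D i)) =
      inR (append A B) D i := by
  rw [eqToHom_perm]; exact Fin.ext (Nat.add_assoc _ _ _).symm
theorem empty_perm_R (A : FreeTraced C) (i) :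
    Hom.perm (eqToHom (empty_append A)) (inR empty A i) = i := by
  rw [eqToHom_perm]; exact Fin.ext (Nat.zero_add _)
theorem empty_perm_L (A : FreeTraced C) (i) :
    Hom.perm (eqToHom (append_empty A)) (inL A empty i) = i := by
  rw [eqToHom_perm]; rfl

theorem tensor_id (A B : FreeTraced C) : tensor (𝟙 A) (𝟙 B) = 𝟙 (append A B) := by
  refine ((isRelabel_id A).tensor (isRelabel_id B)).ext (isRelabel_id _) fun i => ?_
  induction i using append_cases with
  | hl i => rw [tensor_perm_inL]; rfl
  | hr i => rw [tensor_perm_inR]; rfl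

theorem tensor_comp {A B D A' B' D' : FreeTraced C} (f : A ⟶ B) (f' : A' ⟶ B') (g : B ⟶ D)
    (g' : B' ⟶ D') : tensor f f' ≫ tensor g g' = tensor (f ≫ g) (f' ≫ g') := by
  refine hom_ext (by simp [add_add_add_comm]) (fun i => ?_) fun i => ?_
  · rw [comp_perm, Equiv.trans_apply]
    induction i using append_cases with
    | hl i => rw [tensor_perm_inL, tensor_perm_inL, tensor_perm_inL]; rfl
    | hr i => rw [tensor_perm_inR, tensor_perm_inR, tensor_perm_inR]; rfl
  · rw [comp_arrow]
    induction i using append_cases with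
    | hl i =>
      refine HEq.trans ?_ (tensor_arrow_inL (f ≫ g) (f' ≫ g') i).symm
      refine comp_heq (obj_inL _ _ _) ?_ ?_ (tensor_arrow_inL f f' i)
        ((arrow_congr _ (tensor_perm_inL f f' i)).trans (tensor_arrow_inL g g' _))
      · rw [tensor_perm_inL, obj_inL]
      · rw [tensor_perm_inL, tensor_perm_inL, obj_inL]; rfl
    | hr i =>
      refine HEq.trans ?_ (tensor_arrow_inR (f ≫ g) (f' ≫ g') i).symm
      refine comp_heq (obj_inR _ _ _) ?_ ?_ (tensor_arrow_inR f f' i)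
        ((arrow_congr _ (tensor_perm_inR f f' i)).trans (tensor_arrow_inR g g' _))
      · rw [tensor_perm_inR, obj_inR]
      · rw [tensor_perm_inR, tensor_perm_inR, obj_inR]; rfl

theorem tensor_eqToHom {A B A' B' : FreeTraced C} (h : A = B) (h' : A' = B') :
    tensor (eqToHom h) (eqToHom h') = eqToHom (by rw [h, h']) := by
  subst h h'; simp [tensor_id]

/-- Naturality of a square whose vertical maps are relabellings, checked position by position. -/
theorem square {A B A' B' : FreeTraced C} {f : A ⟶ B} {g : A' ⟶ B'} {k : A ⟶ A'} {l : B ⟶ B'}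
    (hk : IsRelabel k) (hl : IsRelabel l) (h₁ : Hom.loops f = Hom.loops g)
    (h₂ : ∀ i, Hom.perm l (Hom.perm f i) = Hom.perm g (Hom.perm k i))
    (h₃ : ∀ i, HEq (Hom.arrow f i) (Hom.arrow g (Hom.perm k i))) : f ≫ l = k ≫ g := by
  refine hom_ext (by simp [hk.loops, hl.loops, h₁]) h₂ fun i => ?_
  rw [comp_arrow, comp_arrow, hk.arrow, hl.arrow]
  exact ((comp_eqToHom_heq' _ _).trans (h₃ i)).trans (eqToHom_comp_heq' _ _).symm

theorem tensor_assoc_naturality {A B A' B' A'' B'' : FreeTraced C} (f : A ⟶ B) (g : A' ⟶ B')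
    (h : A'' ⟶ B'') :
    tensor (tensor f g) h ≫ eqToHom (append_assoc _ _ _) =
      eqToHom (append_assoc _ _ _) ≫ tensor f (tensor g h) := by
  refine square (isRelabel_eqToHom _) (isRelabel_eqToHom _) (by simp [add_assoc])
    (fun i => ?_) fun i => ?_
  · induction i using append_cases with
    | hl i =>
      induction i using append_cases with
      | hl i => rw [assoc_perm_LL, tensor_perm_inL, tensor_perm_inL, tensor_perm_inL,
          assoc_perm_LL]
      | hr i => rw [assoc_perm_LR, tensor_perm_inL, tensor_perm_inR, tensor_perm_inR,
          tensor_perm_inL, assoc_perm_LR]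
    | hr i => rw [assoc_perm_R, tensor_perm_inR, tensor_perm_inR, tensor_perm_inR, assoc_perm_R]
  · induction i using append_cases with
    | hl i =>
      induction i using append_cases with
      | hl i =>
        exact ((tensor_arrow_inL _ _ _).trans (tensor_arrow_inL _ _ _)).trans
          ((arrow_congr _ (assoc_perm_LL _ _ _ i)).trans (tensor_arrow_inL _ _ _)).symm
      | hr i =>
        exact ((tensor_arrow_inL _ _ _).trans (tensor_arrow_inR _ _ _)).trans
          ((arrow_congr _ (assoc_perm_LR _ _ _ i)).trans
            ((tensor_arrow_inR _ _ _).trans (tensor_arrow_inL _ _ _))).symm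
    | hr i =>
      exact (tensor_arrow_inR _ _ _).trans ((arrow_congr _ (assoc_perm_R _ _ _ i)).trans
        ((tensor_arrow_inR _ _ _).trans (tensor_arrow_inR _ _ _))).symm

theorem empty_tensor {A B : FreeTraced C} (f : A ⟶ B) :
    tensor (𝟙 empty) f ≫ eqToHom (empty_append B) = eqToHom (empty_append A) ≫ f := by
  refine square (isRelabel_eqToHom _) (isRelabel_eqToHom _) (by simp) (fun i => ?_) fun i => ?_
  · induction i using append_cases with
    | hl i => exact i.elim0
    | hr i => rw [tensor_perm_inR, empty_perm_R, empty_perm_R]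
  · induction i using append_cases with
    | hl i => exact i.elim0
    | hr i => exact (tensor_arrow_inR _ _ _).trans (arrow_congr _ (empty_perm_R _ i)).symm

theorem tensor_empty {A B : FreeTraced C} (f : A ⟶ B) :
    tensor f (𝟙 empty) ≫ eqToHom (append_empty B) = eqToHom (append_empty A) ≫ f := by
  refine square (isRelabel_eqToHom _) (isRelabel_eqToHom _) (by simp) (fun i => ?_) fun i => ?_
  · induction i using append_cases with
    | hl i => rw [tensor_perm_inL, empty_perm_L, empty_perm_L]
    | hr i => exact i.elim0
  · induction i using append_cases with
    | hl i => exact (tensor_arrow_inL _ _ _).trans (arrow_congr _ (empty_perm_L _ i)).symm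
    | hr i => exact i.elim0

theorem append_pentagon (W X Y Z : FreeTraced C) :
    tensor (eqToHom (append_assoc W X Y)) (𝟙 Z) ≫ eqToHom (append_assoc W (append X Y) Z) ≫
        tensor (𝟙 W) (eqToHom (append_assoc X Y Z)) =
      eqToHom (append_assoc (append W X) Y Z) ≫ eqToHom (append_assoc W X (append Y Z)) := by
  rw [← eqToHom_refl W rfl, ← eqToHom_refl Z rfl, tensor_eqToHom, tensor_eqToHom, eqToHom_trans,
    eqToHom_trans, eqToHom_trans]

theorem append_triangle (X Y : FreeTraced C) :
    eqToHom (append_assoc X empty Y) ≫ tensor (𝟙 X) (eqToHom (empty_append Y)) =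
      tensor (eqToHom (append_empty X)) (𝟙 Y) := by
  rw [← eqToHom_refl X rfl, ← eqToHom_refl Y rfl, tensor_eqToHom, tensor_eqToHom, eqToHom_trans]

instance : MonoidalCategoryStruct (FreeTraced C) where
  tensorObj := append
  tensorUnit := empty
  tensorHom := tensor
  whiskerLeft A _ _ f := tensor (𝟙 A) f
  whiskerRight f A := tensor f (𝟙 A)
  associator A B D := eqToIso (append_assoc A B D)
  leftUnitor A := eqToIso (empty_append A)
  rightUnitor A := eqToIso (append_empty A)

/-- Concatenation makes the category a monoidal category; the structural isomorphisms are
identities up to the equalities of lists. -/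
instance : MonoidalCategory (FreeTraced C) :=
  .ofTensorHom
    (id_tensorHom_id := tensor_id)
    (id_tensorHom := fun _ _ _ _ => rfl)
    (tensorHom_id := fun _ _ => rfl)
    (tensorHom_comp_tensorHom := tensor_comp)
    (associator_naturality := tensor_assoc_naturality)
    (leftUnitor_naturality := empty_tensor)
    (rightUnitor_naturality := tensor_empty)
    (pentagon := append_pentagon)
    (triangle := append_triangle)

theorem swap_swap (A B : FreeTraced C) : swap A B ≫ swap B A = 𝟙 (append A B) := by
  refine ((isRelabel_swap A B).comp (isRelabel_swap B A)).ext (isRelabel_id _) fun i => ?_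
  rw [comp_perm, Equiv.trans_apply]
  induction i using append_cases with
  | hl i => rw [swap_perm_inL, swap_perm_inR]; rfl
  | hr i => rw [swap_perm_inR, swap_perm_inL]; rfl

theorem swap_naturality {A B A' B' : FreeTraced C} (f : A ⟶ B) (g : A' ⟶ B') :
    tensor f g ≫ swap B B' = swap A A' ≫ tensor g f := by
  refine square (isRelabel_swap _ _) (isRelabel_swap _ _) (by simp [add_comm]) (fun i => ?_)
    fun i => ?_
  · induction i using append_cases with
    | hl i => rw [swap_perm_inL, tensor_perm_inL, tensor_perm_inR, swap_perm_inL]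
    | hr i => rw [swap_perm_inR, tensor_perm_inL, tensor_perm_inR, swap_perm_inR]
  · induction i using append_cases with
    | hl i =>
      exact (tensor_arrow_inL _ _ _).trans
        ((arrow_congr _ (swap_perm_inL _ _ i)).trans (tensor_arrow_inR _ _ _)).symm
    | hr i =>
      exact (tensor_arrow_inR _ _ _).trans
        ((arrow_congr _ (swap_perm_inR _ _ i)).trans (tensor_arrow_inL _ _ _)).symm

theorem swap_hexagon (X Y Z : FreeTraced C) :
    eqToHom (append_assoc X Y Z) ≫ swap X (append Y Z) ≫ eqToHom (append_assoc Y Z X) =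
      tensor (swap X Y) (𝟙 Z) ≫ eqToHom (append_assoc Y X Z) ≫ tensor (𝟙 Y) (swap X Z) := by
  refine IsRelabel.ext (.comp (isRelabel_eqToHom _) (.comp (isRelabel_swap _ _)
    (isRelabel_eqToHom _))) (.comp (.tensor (isRelabel_swap _ _) (isRelabel_id _))
    (.comp (isRelabel_eqToHom _) (.tensor (isRelabel_id _) (isRelabel_swap _ _)))) fun i => ?_
  simp only [comp_perm, Equiv.trans_apply]
  induction i using append_cases with
  | hl i =>
    induction i using append_cases with
    | hl i => rw [assoc_perm_LL, swap_perm_inL, assoc_perm_R, tensor_perm_inL, swap_perm_inL,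
        assoc_perm_LR, tensor_perm_inR, swap_perm_inL]
    | hr i => rw [assoc_perm_LR, swap_perm_inR, assoc_perm_LL, tensor_perm_inL, swap_perm_inR,
        assoc_perm_LL, tensor_perm_inL]; rfl
  | hr i => rw [assoc_perm_R, swap_perm_inR, assoc_perm_LR, tensor_perm_inR, id_perm,
      Equiv.refl_apply, assoc_perm_R, tensor_perm_inR, swap_perm_inR]

theorem swap_hexagon' (X Y Z : FreeTraced C) :
    eqToHom (append_assoc X Y Z).symm ≫ swap (append X Y) Z ≫
        eqToHom (append_assoc Z X Y).symm =
      tensor (𝟙 X) (swap Y Z) ≫ eqToHom (append_assoc X Z Y).symm ≫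
        tensor (swap X Z) (𝟙 Y) := by
  refine IsRelabel.ext (.comp (isRelabel_eqToHom _) (.comp (isRelabel_swap _ _)
    (isRelabel_eqToHom _))) (.comp (.tensor (isRelabel_id _) (isRelabel_swap _ _))
    (.comp (isRelabel_eqToHom _) (.tensor (isRelabel_swap _ _) (isRelabel_id _)))) fun i => ?_
  simp only [comp_perm, Equiv.trans_apply]
  induction i using append_cases with
  | hl i => rw [assoc_symm_perm_L, swap_perm_inL, assoc_symm_perm_RL, tensor_perm_inL,
      id_perm, Equiv.refl_apply, assoc_symm_perm_L, tensor_perm_inL, swap_perm_inL]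
  | hr i =>
    induction i using append_cases with
    | hl i => rw [assoc_symm_perm_RL, swap_perm_inL, assoc_symm_perm_RR, tensor_perm_inR,
        swap_perm_inL, assoc_symm_perm_RR, tensor_perm_inR]; rfl
    | hr i => rw [assoc_symm_perm_RR, swap_perm_inR, assoc_symm_perm_L, tensor_perm_inR,
        swap_perm_inR, assoc_symm_perm_RL, tensor_perm_inL, swap_perm_inR]

/-- The symmetry exchanges two blocks. -/
instance : SymmetricCategory (FreeTraced C) where
  braiding A B := ⟨swap A B, swap B A, swap_swap A B, swap_swap B A⟩
  braiding_naturality_right X _ _ f := swap_naturality (𝟙 X) f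
  braiding_naturality_left f Z := swap_naturality f (𝟙 Z)
  hexagon_forward := swap_hexagon
  hexagon_reverse := swap_hexagon'
  symmetry := swap_swap

instance : IsStrictMonoidal (FreeTraced C) where
  assoc_obj := append_assoc
  unit_tensor_obj := empty_append
  tensor_unit_obj := append_empty
  associator_hom _ _ _ := rfl
  leftUnitor_hom _ := rfl
  rightUnitor_hom _ := rfl

/-- The morphism `(S, π, λ)`. -/
abbrev homMk {A B : FreeTraced C} (S : Multiset (CatLoop C)) (π : Fin A.len ≃ Fin B.len)
    (lab : ∀ i, A.obj i ⟶ B.obj (π i)) : A ⟶ B :=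
  Hom.mk S π lab

/-- The list `B (π 1), …, B (π n)`. -/
abbrev reindex {n : ℕ} (B : FreeTraced C) (π : Fin n ≃ Fin B.len) : FreeTraced C :=
  ⟨n, fun i => B.obj (π i)⟩

/-- The morphism `B (π 1) ⊗ ⋯ ⊗ B (π n) ⟶ B 1 ⊗ ⋯ ⊗ B n` that sends position `i` to position
`π i` and is labelled by identities. -/
def permute {n : ℕ} (B : FreeTraced C) (π : Fin n ≃ Fin B.len) : reindex B π ⟶ B :=
  homMk 0 π fun i => 𝟙 (B.obj (π i))

/-- The inclusion of `C` as lists of length one. -/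
def of (C : Type u) [Category.{v} C] : C ⥤ FreeTraced C where
  obj X := ⟨1, fun _ => X⟩
  map f := ⟨0, Equiv.refl _, fun _ => f⟩
  map_id _ := rfl
  map_comp f g := hom_ext (by simp) (fun _ => rfl) fun _ => HEq.rfl

/-! ### Paths and loops of a permutation with feedback

The nodes `γ` are fed back: a path runs `x, π x, π² x, …` as long as it stays in `γ`. -/

/-- `Run π lab x l y g`: there is `k ≥ 0` with `π^(k+1) x = y`, the intermediate nodes
`π x, …, π^k x` are the feedback nodes listed in `l`, and `g` is the composite
`lab (π^k x) ∘ ⋯ ∘ lab (π x) ∘ lab x` of the labels along the path. -/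
inductive Run {α β γ : Type} {A : α → C} {B : β → C} {U : γ → C} (π : α ⊕ γ ≃ β ⊕ γ)
    (lab : ∀ x, Sum.elim A U x ⟶ Sum.elim B U (π x)) (x : α ⊕ γ) :
    List γ → ∀ y : β ⊕ γ, (Sum.elim A U x ⟶ Sum.elim B U y) → Prop
  | single : Run π lab x [] (π x) (lab x)
  | step {l : List γ} {c : γ} {g : Sum.elim A U x ⟶ U c} (h : Run π lab x l (Sum.inr c) g) :
      Run π lab x (l ++ [c]) (π (Sum.inr c)) (g ≫ lab (Sum.inr c))

/-- The permutation of a morphism `A ⊗ U ⟶ B ⊗ U`, with visible and feedback nodes separated. -/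
def splitPerm {A B U : FreeTraced C} (f : A ⊗ U ⟶ B ⊗ U) :
    Fin A.len ⊕ Fin U.len ≃ Fin B.len ⊕ Fin U.len :=
  finSumFinEquiv.trans ((Hom.perm f).trans finSumFinEquiv.symm)

/-- The labels of a morphism `A ⊗ U ⟶ B ⊗ U`, with visible and feedback nodes separated. -/
def splitArrow {A B U : FreeTraced C} (f : A ⊗ U ⟶ B ⊗ U) (x : Fin A.len ⊕ Fin U.len) :
    Sum.elim A.obj U.obj x ⟶ Sum.elim B.obj U.obj (splitPerm f x) :=
  eqToHom (congrArg (Sum.elim A.obj U.obj) (Equiv.symm_apply_apply finSumFinEquiv x).symm) ≫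
    Hom.arrow f (finSumFinEquiv x)

/-- `c` lies on a cycle that stays among the feedback nodes and is the least node of that cycle;
`s` is the composite of the labels once around the cycle, starting from `c`. -/
def IsLoopAt {A B U : FreeTraced C} (f : A ⊗ U ⟶ B ⊗ U) (c : Fin U.len)
    (s : U.obj c ⟶ U.obj c) : Prop :=
  ∃ l, Run (splitPerm f) (splitArrow f) (Sum.inr c) l (Sum.inr c) s ∧ ∀ d ∈ l, c < d

open Classical in
/-- The multiset of the loops of `C` obtained by composing the labels around the cycles that stay
among the feedback nodes, one loop for each cycle. -/
noncomputable def feedbackLoops {A B U : FreeTraced C} (f : A ⊗ U ⟶ B ⊗ U) :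
    Multiset (CatLoop C) :=
  ∑ c : Fin U.len, if h : ∃ s, IsLoopAt f c s then {CatLoop.mk h.choose} else 0

/-- `g = (S ⊎ T, p, μ)` is the trace of `f = (S, π, λ)`: `T` collects the loops among the feedback
nodes, `p i` is the end of the path of `π` from the input `i` through the feedback nodes to an
output, and `μ i` is the composite of the labels along that path. -/
structure IsTraceOf {A B U : FreeTraced C} (f : A ⊗ U ⟶ B ⊗ U) (g : A ⟶ B) : Prop where
  loops : Hom.loops g = Hom.loops f + feedbackLoops f
  path (i : Fin A.len) : ∃ l, Run (splitPerm f) (splitArrow f) (Sum.inl i) l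
    (Sum.inl (Hom.perm g i)) (Hom.arrow g i)

end FreeTraced

/-! ### Closed forms in traced symmetric monoidal categories -/

section ClosedForm

variable {D : Type u} [Category.{v} D] [MonoidalCategory D]

/-- The tensor product `X 0 ⊗ (X 1 ⊗ ⋯)` of a finite list of objects. -/
def tensorFamily : (n : ℕ) → (Fin n → D) → D
  | 0, _ => 𝟙_ D
  | n + 1, X => X 0 ⊗ tensorFamily n fun i => X i.succ

/-- The tensor product of a finite list of morphisms. -/
def tensorFamilyMap : (n : ℕ) → {X Y : Fin n → D} → (∀ i, X i ⟶ Y i) →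
    (tensorFamily n X ⟶ tensorFamily n Y)
  | 0, _, _, _ => 𝟙 _
  | n + 1, _, _, f => f 0 ⊗ₘ tensorFamilyMap n fun i => f i.succ

/-- The multiple `s • f` of a morphism by a scalar `s`. -/
def scalarMul {X Y : D} (s : End (𝟙_ D)) (f : X ⟶ Y) : X ⟶ Y :=
  (λ_ X).inv ≫ ((s : 𝟙_ D ⟶ 𝟙_ D) ▷ X) ≫ (λ_ X).hom ≫ f

variable [SymmetricCategory D]

/-- The morphisms built from identities, structural isomorphisms and symmetries by composition and
tensor product. -/
inductive IsSymmetryComposite : ∀ {X Y : D}, (X ⟶ Y) → Prop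
  | id (X : D) : IsSymmetryComposite (𝟙 X)
  | associator (X Y Z : D) : IsSymmetryComposite (α_ X Y Z).hom
  | associator_inv (X Y Z : D) : IsSymmetryComposite (α_ X Y Z).inv
  | leftUnitor (X : D) : IsSymmetryComposite (λ_ X).hom
  | leftUnitor_inv (X : D) : IsSymmetryComposite (λ_ X).inv
  | rightUnitor (X : D) : IsSymmetryComposite (ρ_ X).hom
  | rightUnitor_inv (X : D) : IsSymmetryComposite (ρ_ X).inv
  | braiding (X Y : D) : IsSymmetryComposite (β_ X Y).hom
  | comp {X Y Z : D} {f : X ⟶ Y} {g : Y ⟶ Z} (hf : IsSymmetryComposite f)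
      (hg : IsSymmetryComposite g) : IsSymmetryComposite (f ≫ g)
  | tensor {X Y X' Y' : D} {f : X ⟶ Y} {g : X' ⟶ Y'} (hf : IsSymmetryComposite f)
      (hg : IsSymmetryComposite g) : IsSymmetryComposite (f ⊗ₘ g)

/-- The scalar obtained by tracing out an endomorphism completely. -/
def traceOut [TracedCategory D] {X : D} (s : X ⟶ X) : End (𝟙_ D) :=
  TracedCategory.trace (A := 𝟙_ D) (B := 𝟙_ D) X ((λ_ X).hom ≫ s ≫ (λ_ X).inv)

end ClosedForm

/-! ### The free case of one generator -/

/-- The coproduct over `n` of the symmetric groups `S(n)`, as categories with one object. -/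
abbrev SymmetricGroups : Type := Σ n : ℕ, SingleObj (Equiv.Perm (Fin n))

/-- The permutation underlying a morphism. -/
def SymmetricGroups.perm : {X Y : SymmetricGroups} → (X ⟶ Y) → (Fin X.1 ≃ Fin Y.1)
  | _, _, Sigma.SigmaHom.mk π => π

theorem SymmetricGroups.perm_comp : ∀ {X Y Z : SymmetricGroups} (f : X ⟶ Y) (g : Y ⟶ Z),
    SymmetricGroups.perm (f ≫ g) = (SymmetricGroups.perm f).trans (SymmetricGroups.perm g)
  | _, _, _, Sigma.SigmaHom.mk _, Sigma.SigmaHom.mk _ => rfl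

/-- The functor that sends `n` to the list of `n` copies of the generator and the pair `(π, k)` to
the permutation `π` together with `k` copies of the identity loop. -/
def freeTracedOfOne :
    SymmetricGroups × SingleObj (Multiplicative ℕ) ⥤ FreeTraced (Discrete PUnit.{1}) where
  obj X := ⟨X.1.1, fun _ => ⟨PUnit.unit⟩⟩
  map f := FreeTraced.Hom.mk
    (Multiset.replicate (Multiplicative.toAdd f.2) (CatLoop.mk (𝟙 (Discrete.mk PUnit.unit))))
    (SymmetricGroups.perm f.1) fun _ => 𝟙 _
  map_id X := by
    obtain ⟨⟨n, x⟩, y⟩ := X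
    exact FreeTraced.hom_ext rfl (fun _ => rfl) fun _ => HEq.rfl
  map_comp f g := by
    refine FreeTraced.hom_ext ?_ (fun i => ?_) fun _ => ?_
    · exact (congrArg (Multiset.replicate · _) (Nat.add_comm _ _)).trans
        (Multiset.replicate_add _ _ _)
    · exact congrArg (· i) (SymmetricGroups.perm_comp f.1 g.1)
    · exact heq_of_eq (Subsingleton.elim _ _)

/-!
The trace is computed by following paths. A path that starts at an input never visits a feedback
node twice, so it reaches an output (`Run.exists_output`), and different inputs reach different
outputs (`Run.input_unique`). This gives existence and uniqueness of the trace. The multiset of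
loops selects the least node of each cycle, but any other ranking of the nodes gives the same loops
(`sum_loopAt_eq`), since a cyclic permutation of a composite does not change its loop. With this
freedom, naturality and dinaturality are one statement about sliding labels along paths
(`traceHom_slide`). Superposing and vanishing compare the paths and cycles of two systems, one of
which contains the other (`Simulation`), and yanking is read off the definition. For the trace along
`U ⊗ V`, a path of the whole system is cut at its visits to `U` into paths through `V`, and a cycle
either stays in `V` or is a cycle of the partial trace (`IsTraceOf.vanishing`).

For freeness, a morphism between two lists is put into a normal form: a multiset of loops together
with a matching of the lists, built by matching the head of the first list with an entry of the
second one and recursing. A normal form has an interpretation (`NormalForm.eval`) in every traced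
symmetric monoidal category that receives a functor from `C`: loops become scalars and matchings
become composites of labels and symmetries. Composition, tensor product and symmetry of normal forms
are computed on the lists, and the interpretation respects them. In the free traced category the
interpretation is a bijection (`normalForm_bijective`). So interpreting normal forms in `D` defines
the extension of a functor `F : C ⥤ D` (`extension`), and it is the only candidate, because a
strict traced functor commutes with interpretations (`IsStrictTracedFunctor.eq_extension`).

The extension preserves the trace: by vanishing it suffices to trace out one generator, and there
the trace of a normal form is given by one and the same formula in both categories
(`NormalForm.eval_traceHead`). If the generator is matched with itself, superposing produces a
scalar; otherwise naturality reduces to yanking.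

The closed form of a morphism compares loops, permutation and labels directly; a permutation with
identity labels is built from symmetries because its matching consists of insertions only
(`IsRelabel.isSymmetryComposite`). For one generator, there is only one loop, so a morphism is a
permutation with a number of loops.
-/

/-! ### Runs of a permutation with feedback -/

namespace FreeTraced
variable {C : Type u} [Category.{v} C]

section Runs
variable {α β γ : Type} {A : α → C} {B : β → C} {U : γ → C} {π : α ⊕ γ ≃ β ⊕ γ}
  {lab : ∀ x, Sum.elim A U x ⟶ Sum.elim B U (π x)} {x : α ⊕ γ}

theorem Run.congr {π' : α ⊕ γ ≃ β ⊕ γ} {lab' : ∀ x, Sum.elim A U x ⟶ Sum.elim B U (π' x)}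
    (h : π = π') (h' : ∀ x, HEq (lab x) (lab' x)) {l y} {g : Sum.elim A U x ⟶ Sum.elim B U y} :
    Run π lab x l y g ↔ Run π' lab' x l y g := by
  subst h
  obtain rfl : lab = lab' := funext fun x => eq_of_heq (h' x)
  rfl

/-- A run is determined by its starting point and its length. -/
theorem Run.eq_of_length_eq {l y} {g : Sum.elim A U x ⟶ Sum.elim B U y} (h : Run π lab x l y g)
    {l' y'} {g' : Sum.elim A U x ⟶ Sum.elim B U y'} (h' : Run π lab x l' y' g')
    (hl : l.length = l'.length) :
    l = l' ∧ (⟨y, g⟩ : Σ y, Sum.elim A U x ⟶ Sum.elim B U y) = ⟨y', g'⟩ := by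
  induction h generalizing l' y' with
  | single =>
    cases h' with
    | single => exact ⟨rfl, rfl⟩
    | step h' => simp at hl
  | step h ih =>
    cases h' with
    | single => simp at hl
    | step h' =>
      obtain ⟨rfl, e⟩ := ih h' (by simpa using hl)
      cases e
      exact ⟨rfl, rfl⟩

/-- Every proper initial segment of a run is a run that ends in a feedback node. -/
theorem Run.exists_prefix {l y} {g : Sum.elim A U x ⟶ Sum.elim B U y} (h : Run π lab x l y g)
    {k : ℕ} (hk : k < l.length) :
    ∃ (l₁ : List γ) (c : γ) (l₂ : List γ) (g' : Sum.elim A U x ⟶ U c),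
      l = l₁ ++ c :: l₂ ∧ l₁.length = k ∧ Run π lab x l₁ (Sum.inr c) g' := by
  induction h with
  | single => simp at hk
  | @step l c g h ih =>
    rw [List.length_append, List.length_singleton] at hk
    rcases Nat.lt_succ_iff_lt_or_eq.1 hk with hk | rfl
    · obtain ⟨l₁, c', l₂, g', rfl, h₁, h₂⟩ := ih hk
      exact ⟨l₁, c', l₂ ++ [c], g', by simp, h₁, h₂⟩
    · exact ⟨l, c, [], g, rfl, rfl, h⟩

/-- A run that ends in a feedback node can be continued by a run from that node. -/
theorem Run.append {l c} {g : Sum.elim A U x ⟶ U c} (h : Run π lab x l (Sum.inr c) g) {l' y}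
    {g' : Sum.elim A U (Sum.inr c) ⟶ Sum.elim B U y} (h' : Run π lab (Sum.inr c) l' y g') :
    Run π lab x (l ++ c :: l') y (g ≫ g') := by
  induction h' with
  | single => exact h.step
  | @step l' d g' h' ih =>
    have := ih.step
    rw [List.append_assoc, List.cons_append] at this
    exact (congrArg (Run π lab x _ _)
      (Category.assoc g (g' : Sum.elim A U (Sum.inr c) ⟶ U d) (lab (Sum.inr d)))).mp this

/-- A run through a feedback node `c` splits at `c`. -/
theorem Run.split {l₁ c l₂ y} {g : Sum.elim A U x ⟶ Sum.elim B U y}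
    (h : Run π lab x (l₁ ++ c :: l₂) y g) :
    ∃ (g₁ : Sum.elim A U x ⟶ U c) (g₂ : U c ⟶ Sum.elim B U y), g = g₁ ≫ g₂ ∧
      Run π lab x l₁ (Sum.inr c) g₁ ∧ Run π lab (Sum.inr c) l₂ y g₂ := by
  generalize hl : l₁ ++ c :: l₂ = l at h
  induction h generalizing l₂ with
  | single => simp at hl
  | @step l d g h ih =>
    rcases List.eq_nil_or_concat l₂ with rfl | ⟨l₂, d', rfl⟩
    · obtain ⟨rfl, e⟩ := List.append_inj' hl rfl
      cases e
      exact ⟨g, _, rfl, h, .single⟩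
    · rw [List.concat_eq_append, ← List.cons_append, ← List.append_assoc] at hl
      obtain ⟨rfl, e⟩ := List.append_inj' hl rfl
      cases e
      obtain ⟨g₁, g₂, rfl, h₁, h₂⟩ := ih rfl
      refine ⟨g₁, g₂ ≫ lab (Sum.inr _), Category.assoc _ _ _, h₁, ?_⟩
      rw [List.concat_eq_append]
      exact h₂.step

/-- The run that ends in an output is unique. -/
theorem Run.unique {l j} {g : Sum.elim A U x ⟶ B j} (h : Run π lab x l (Sum.inl j) g)
    {l' j'} {g' : Sum.elim A U x ⟶ B j'} (h' : Run π lab x l' (Sum.inl j') g') :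
    l = l' ∧ (⟨j, g⟩ : Σ j, Sum.elim A U x ⟶ B j) = ⟨j', g'⟩ := by
  have key : ∀ {l j} {g : Sum.elim A U x ⟶ B j} (_ : Run π lab x l (Sum.inl j) g)
    {l' j'} {g' : Sum.elim A U x ⟶ B j'} (_ : Run π lab x l' (Sum.inl j') g'),
    ¬ l.length < l'.length := by
    intro l j g h l' j' g' h' hlt
    obtain ⟨l₁, c, l₂, g₁, rfl, h₁, h₂⟩ := h'.exists_prefix hlt
    cases (h.eq_of_length_eq h₂ h₁.symm).2
  obtain ⟨rfl, e⟩ := h.eq_of_length_eq h' (by have := key h h'; have := key h' h; omega)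
  cases e
  exact ⟨rfl, rfl⟩

/-- The run that ends at the first return to a set of feedback nodes is unique. -/
theorem Run.unique_of_first {P : γ → Prop} {l c} {g : Sum.elim A U x ⟶ U c}
    (h : Run π lab x l (Sum.inr c) g) (hc : P c) (hl : ∀ d ∈ l, ¬ P d)
    {l' c'} {g' : Sum.elim A U x ⟶ U c'} (h' : Run π lab x l' (Sum.inr c') g') (hc' : P c')
    (hl' : ∀ d ∈ l', ¬ P d) :
    l = l' ∧ (⟨c, g⟩ : Σ c, Sum.elim A U x ⟶ U c) = ⟨c', g'⟩ := by
  have key : ∀ {l c} {g : Sum.elim A U x ⟶ U c} (_ : Run π lab x l (Sum.inr c) g) (_ : P c)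
    {l' c'} {g' : Sum.elim A U x ⟶ U c'} (_ : Run π lab x l' (Sum.inr c') g')
    (_ : ∀ d ∈ l', ¬ P d), ¬ l.length < l'.length := by
    intro l c g h hc l' c' g' h' hl' hlt
    obtain ⟨l₁, d, l₂, g₁, rfl, h₁, h₂⟩ := h'.exists_prefix hlt
    have := (h.eq_of_length_eq h₂ h₁.symm).2
    cases this
    exact hl' c (by simp) hc
  obtain ⟨rfl, e⟩ := h.eq_of_length_eq h'
    (by have := key h hc h' hl'; have := key h' hc' h hl; omega)
  cases e
  exact ⟨rfl, rfl⟩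

/-- The permutation maps the nodes of a run, except the end, to the nodes after the start. -/
theorem Run.map_eq {l y} {g : Sum.elim A U x ⟶ Sum.elim B U y} (h : Run π lab x l y g) :
    (x :: l.map Sum.inr).map π = l.map Sum.inr ++ [y] := by
  induction h with
  | single => rfl
  | @step l c g h ih =>
    have e : (x :: (l ++ [c]).map Sum.inr) = (x :: l.map Sum.inr) ++ [Sum.inr c] := by simp
    rw [e, List.map_append, ih]
    simp

/-- A run that does not return to its starting point never visits a node twice, since the
permutation is injective. -/
theorem Run.nodup {l y} {g : Sum.elim A U x ⟶ Sum.elim B U y} (h : Run π lab x l y g)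
    (hx : ∀ c ∈ l, x ≠ Sum.inr c) : (x :: l.map Sum.inr).Nodup := by
  induction h with
  | single => simp
  | @step l c g h ih =>
    have := (List.nodup_map_iff π.injective).2 (ih fun d hd => hx d (by simp [hd]))
    rw [h.map_eq] at this
    refine List.nodup_cons.2 ⟨fun hm => ?_, List.Nodup.map Sum.inr_injective ?_⟩
    · obtain ⟨d, hd, e⟩ := List.mem_map.1 hm
      exact hx d hd e.symm
    refine List.Nodup.of_map (Sum.inr : γ → β ⊕ γ) ?_
    simpa using this

/-- Every path from an input reaches an output: there are only finitely many feedback nodes, and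
none of them is visited twice. -/
theorem Run.exists_output [Finite γ] (i : α) :
    ∃ (l : List γ) (j : β) (g : A i ⟶ B j), Run π lab (Sum.inl i) l (Sum.inl j) g := by
  classical
  have := Fintype.ofFinite γ
  by_contra hno
  have key : ∀ k : ℕ, ∃ (l : List γ) (y : β ⊕ γ) (g : A i ⟶ Sum.elim B U y),
      l.length = k ∧ Run π lab (Sum.inl i) l y g := by
    intro k
    induction k with
    | zero => exact ⟨[], _, _, rfl, .single⟩
    | succ k ih =>
      obtain ⟨l, y, g, hl, h⟩ := ih
      cases y with
      | inl j => exact absurd ⟨l, j, g, h⟩ hno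
      | inr c => exact ⟨_, _, _, by simp [hl], h.step⟩
  -- Without an output there are runs of every length, against the pigeonhole principle.
  obtain ⟨l, y, g, hl, h⟩ := key (Fintype.card γ + 1)
  have := ((List.nodup_cons.1 (h.nodup (by simp))).2.of_map _).length_le_card
  omega

/-- Runs from different inputs have different ends, since the permutation is injective. -/
theorem Run.input_unique {i i' : α} {l y} {g : Sum.elim A U (Sum.inl i) ⟶ Sum.elim B U y}
    (h : Run π lab (Sum.inl i) l y g) {l' y'} {g' : Sum.elim A U (Sum.inl i') ⟶ Sum.elim B U y'}
    (h' : Run π lab (Sum.inl i') l' y' g') (e : y = y') : i = i' := by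
  induction h generalizing l' y' with
  | single =>
    cases h' with
    | single => simpa using e
    | step h' => simp at e
  | step h ih =>
    cases h' with
    | single => simp at e
    | step h' => exact ih h' (by simpa using e)

end Runs

/-! ### The trace of a morphism -/

theorem exists_isTraceOf {A B U : FreeTraced C} (f : A ⊗ U ⟶ B ⊗ U) :
    ∃ g : A ⟶ B, IsTraceOf f g := by
  choose l p a h using fun i => Run.exists_output (π := splitPerm f) (lab := splitArrow f) i
  have hinj : Function.Injective p := fun i j e =>
    (h i).input_unique (h j) (congrArg Sum.inl e)
  -- Both sides gain the same number `U.len` of positions, so the two lists have the same length.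
  have hcard : Fintype.card (Fin A.len) = Fintype.card (Fin B.len) := by
    have := Fintype.card_congr (splitPerm f)
    simpa using this
  let e : Fin A.len ≃ Fin B.len :=
    Equiv.ofBijective p ((Fintype.bijective_iff_injective_and_card p).2 ⟨hinj, hcard⟩)
  exact ⟨⟨Hom.loops f + feedbackLoops f, e, a⟩, rfl, fun i => ⟨l i, h i⟩⟩

theorem IsTraceOf.unique {A B U : FreeTraced C} {f : A ⊗ U ⟶ B ⊗ U} {g g' : A ⟶ B}
    (h : IsTraceOf f g) (h' : IsTraceOf f g') : g = g' := by
  have key (i) : (⟨Hom.perm g i, Hom.arrow g i⟩ : Σ j, A.obj i ⟶ B.obj j) =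
      ⟨Hom.perm g' i, Hom.arrow g' i⟩ := by
    obtain ⟨l, hl⟩ := h.path i
    obtain ⟨l', hl'⟩ := h'.path i
    exact (Run.unique hl hl').2
  refine hom_ext (h.loops.trans h'.loops.symm) (fun i => congrArg Sigma.fst (key i)) fun i => ?_
  have := key i
  rw [Sigma.mk.injEq] at this
  exact this.2

/-- The trace, computed by following paths and collecting loops. -/
noncomputable def traceHom {A B : FreeTraced C} (U : FreeTraced C) (f : A ⊗ U ⟶ B ⊗ U) : A ⟶ B :=
  (exists_isTraceOf f).choose

theorem isTraceOf_traceHom {A B U : FreeTraced C} (f : A ⊗ U ⟶ B ⊗ U) :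
    IsTraceOf f (traceHom U f) := (exists_isTraceOf f).choose_spec

theorem traceHom_eq_iff {A B U : FreeTraced C} {f : A ⊗ U ⟶ B ⊗ U} {g : A ⟶ B} :
    traceHom U f = g ↔ IsTraceOf f g :=
  ⟨fun h => h ▸ isTraceOf_traceHom f, fun h => (isTraceOf_traceHom f).unique h⟩

end FreeTraced

/-! ### Independence of the loops from the nodes that represent the cycles -/

namespace FreeTraced
variable {C : Type u} [Category.{v} C]

theorem loopMk_comp_comm {X Y : C} (f : X ⟶ Y) (g : Y ⟶ X) :
    CatLoop.mk (f ≫ g) = CatLoop.mk (g ≫ f) := Quot.sound (.rotate f g)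

section Loops
variable {α β γ : Type} {A : α → C} {B : β → C} {U : γ → C} {π : α ⊕ γ ≃ β ⊕ γ}
  {lab : ∀ x, Sum.elim A U x ⟶ Sum.elim B U (π x)} {r r' : γ → ℕ}

variable (π lab) in
/-- `c` is the node of least rank on a cycle of feedback nodes, and `s` is the composite around that
cycle. For the rank `Fin.val` this is `IsLoopAt`; other ranks select other nodes of the cycles. -/
def IsRankedLoop (r : γ → ℕ) (c : γ) (s : U c ⟶ U c) : Prop :=
  ∃ l, Run π lab (Sum.inr c) l (Sum.inr c) s ∧ ∀ d ∈ l, r c < r d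

theorem IsRankedLoop.unique {c s s'} (h : IsRankedLoop π lab r c s)
    (h' : IsRankedLoop π lab r c s') : s = s' := by
  obtain ⟨l, h, hl⟩ := h
  obtain ⟨l', h', hl'⟩ := h'
  have := (h.unique_of_first (P := (r · ≤ r c)) le_rfl (fun d hd => not_le.2 (hl d hd)) h' le_rfl
    fun d hd => not_le.2 (hl' d hd)).2
  simpa using this

open Classical in
variable (π lab) in
/-- The loop collected at the node `c`, if `c` has least rank on a cycle of feedback nodes. -/
noncomputable def loopAt (r : γ → ℕ) (c : γ) : Multiset (CatLoop C) :=
  if h : ∃ s, IsRankedLoop π lab r c s then {CatLoop.mk h.choose} else 0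

theorem IsRankedLoop.loopAt {c s} (h : IsRankedLoop π lab r c s) :
    loopAt π lab r c = {CatLoop.mk s} := by
  have : ∃ s, IsRankedLoop π lab r c s := ⟨s, h⟩
  rw [FreeTraced.loopAt, dif_pos this, this.choose_spec.unique h]

theorem loopAt_of_not {c} (h : ∀ s, ¬ IsRankedLoop π lab r c s) : loopAt π lab r c = 0 :=
  dif_neg fun ⟨s, hs⟩ => h s hs

theorem feedbackLoops_eq_sum {A B U : FreeTraced C} (f : A ⊗ U ⟶ B ⊗ U) :
    feedbackLoops f = ∑ c, loopAt (splitPerm f) (splitArrow f) Fin.val c := rfl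

/-- Two systems with feedback have the same loop at a node if their cycles correspond. -/
theorem loopAt_congr {α' β' γ' : Type} {A' : α' → C} {B' : β' → C} {U' : γ' → C}
    {π' : α' ⊕ γ' ≃ β' ⊕ γ'} {lab' : ∀ x, Sum.elim A' U' x ⟶ Sum.elim B' U' (π' x)}
    {r' : γ' → ℕ} {c : γ} {c' : γ'}
    (h : ∀ s, IsRankedLoop π lab r c s →
      ∃ s', IsRankedLoop π' lab' r' c' s' ∧ CatLoop.mk s' = CatLoop.mk s)
    (h' : ∀ s', IsRankedLoop π' lab' r' c' s' → ∃ s, IsRankedLoop π lab r c s) :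
    loopAt π lab r c = loopAt π' lab' r' c' := by
  by_cases hs : ∃ s, IsRankedLoop π lab r c s
  · obtain ⟨s, hs⟩ := hs
    obtain ⟨s', hs', e⟩ := h s hs
    rw [hs.loopAt, hs'.loopAt, e]
  · rw [loopAt_of_not fun s hs' => hs ⟨s, hs'⟩, loopAt_of_not fun s' hs' => hs (h' s' hs')]

variable (π lab) in
/-- A run leads from `c` to `d`. -/
def Linked (c d : γ) : Prop := ∃ l g, Run π lab (Sum.inr c) l (Sum.inr d) g

theorem Linked.trans {c d e : γ} (h : Linked π lab c d) (h' : Linked π lab d e) :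
    Linked π lab c e := by
  obtain ⟨l, g, h⟩ := h
  obtain ⟨l', g', h'⟩ := h'
  exact ⟨_, _, h.append h'⟩

/-- A run that starts on a cycle stays on it. -/
theorem Run.mem_cycle {c l s} (h : Run π lab (Sum.inr c) l (Sum.inr c) s) {l' y g}
    (h' : Run π lab (Sum.inr c) l' y g) : y ∈ (Sum.inr c :: l.map Sum.inr : List (β ⊕ γ)) := by
  have key : ∀ d, (Sum.inr d : β ⊕ γ) ∈ (Sum.inr c :: l.map Sum.inr : List (β ⊕ γ)) →
      π (Sum.inr d) ∈ (Sum.inr c :: l.map Sum.inr : List (β ⊕ γ)) := by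
    intro d hd
    have : π (Sum.inr d) ∈ (Sum.inr c :: l.map Sum.inr).map π :=
      List.mem_map_of_mem (by simpa using hd)
    rw [h.map_eq] at this
    simpa [or_comm] using this
  induction h' with
  | single => exact key c (by simp)
  | step h' ih => exact key _ ih

theorem Run.linked_symm {c d l s} (h : Run π lab (Sum.inr c) l (Sum.inr c) s)
    (h' : Linked π lab c d) : Linked π lab d c := by
  obtain ⟨l', g, h'⟩ := h'
  rcases List.mem_cons.1 (h.mem_cycle h') with e | e
  · cases e; exact ⟨_, _, h⟩
  · have e : d ∈ l := by simpa using e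
    obtain ⟨l₁, l₂, rfl⟩ := List.append_of_mem e
    obtain ⟨g₁, g₂, rfl, h₁, h₂⟩ := h.split
    exact ⟨_, _, h₂⟩

/-- The node of a ranked loop has the least rank among all nodes reachable from it, because these
are the nodes of its cycle. -/
theorem IsRankedLoop.le {c d s} (h : IsRankedLoop π lab r c s) (h' : Linked π lab c d) :
    r c ≤ r d := by
  obtain ⟨l, h, hl⟩ := h
  obtain ⟨l', g, h'⟩ := h'
  rcases List.mem_cons.1 (h.mem_cycle h') with e | e
  · cases e; exact le_rfl
  · exact (hl d (by simpa using e)).le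

/-- Every cycle has a node of least rank, and the loop does not depend on where it is started. -/
theorem IsRankedLoop.exists_linked {c s} (h : IsRankedLoop π lab r c s)
    (hr' : Function.Injective r') : ∃ d s', Linked π lab c d ∧ IsRankedLoop π lab r' d s' ∧
      CatLoop.mk s' = CatLoop.mk s := by
  classical
  obtain ⟨l, h, hl⟩ := h
  have hc : c ∉ l := fun hc => (hl c hc).false
  have hnd : (c :: l).Nodup := by
    have := h.nodup fun d hd e => hc (by cases e; exact hd)
    rw [← List.map_cons (f := Sum.inr)] at this
    exact this.of_map _
  obtain ⟨d, hd, hmin⟩ : ∃ d ∈ c :: l, ∀ e ∈ c :: l, r' d ≤ r' e := by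
    obtain ⟨d, hd, h⟩ := (c :: l).toFinset.exists_min_image r' ⟨c, by simp⟩
    exact ⟨d, by simpa using hd, fun e he => h e (by simpa using he)⟩
  rcases List.mem_cons.1 hd with rfl | hd
  · exact ⟨d, s, ⟨l, s, h⟩, ⟨l, h, fun e he => lt_of_le_of_ne (hmin e (by simp [he]))
      fun e' => hc (hr' e' ▸ he)⟩, rfl⟩
  · obtain ⟨l₁, l₂, rfl⟩ := List.append_of_mem hd
    obtain ⟨g₁, g₂, rfl, h₁, h₂⟩ := h.split
    refine ⟨d, g₂ ≫ g₁, ⟨_, _, h₁⟩, ⟨_, h₂.append h₁, fun e he => ?_⟩, loopMk_comp_comm _ _⟩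
    refine lt_of_le_of_ne (hmin e ?_) fun e' => ?_
    · simp only [List.mem_append, List.mem_cons] at he ⊢; tauto
    · obtain rfl := hr' e'
      rw [List.nodup_cons, List.nodup_append, List.nodup_cons] at hnd
      simp only [List.mem_append, List.mem_cons] at he hnd
      rcases he with he | rfl | he
      · exact hnd.2.2.1.1 he
      · exact hnd.1 (by simp)
      · exact hnd.2.2.2 d he d (by simp) rfl

/-- The multiset of loops does not depend on the ranking that selects one node on each cycle. -/
theorem sum_loopAt_eq [Fintype γ] (hr : Function.Injective r) (hr' : Function.Injective r') :
    ∑ c, loopAt π lab r c = ∑ c, loopAt π lab r' c := by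
  classical
  have key (r : γ → ℕ) : ∑ c, loopAt π lab r c =
      ∑ c with ∃ s, IsRankedLoop π lab r c s, loopAt π lab r c := by
    refine (Finset.sum_filter_of_ne fun c _ hc => ?_).symm
    by_contra h
    exact hc (loopAt_of_not fun s hs => h ⟨s, hs⟩)
  rw [key r, key r']
  have hex (c) (hc : c ∈ Finset.univ.filter fun c => ∃ s, IsRankedLoop π lab r c s) :
      ∃ d s', Linked π lab c d ∧ IsRankedLoop π lab r' d s' ∧
        loopAt π lab r c = {CatLoop.mk s'} := by
    obtain ⟨s, hs⟩ := (Finset.mem_filter.1 hc).2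
    obtain ⟨d, s', h₁, h₂, h₃⟩ := hs.exists_linked hr'
    exact ⟨d, s', h₁, h₂, by rw [hs.loopAt, h₃]⟩
  -- Each cycle has one node of least `r`-rank and one of least `r'`-rank; `φ` matches the two.
  choose φ s' h₁ h₂ h₃ using hex
  refine Finset.sum_bij φ (fun c hc => Finset.mem_filter.2 ⟨Finset.mem_univ _, _, h₂ c hc⟩)
    (fun c hc d hd e => ?_) (fun d hd => ?_) fun c hc => by rw [h₃ c hc, (h₂ c hc).loopAt]
  · obtain ⟨s, hs⟩ := (Finset.mem_filter.1 hc).2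
    obtain ⟨t, ht⟩ := (Finset.mem_filter.1 hd).2
    obtain ⟨l, hl, -⟩ := id hs
    have h : Linked π lab d c := (h₁ d hd).trans (e ▸ hl.linked_symm (h₁ c hc))
    obtain ⟨l, hl, -⟩ := id ht
    exact hr (le_antisymm (hs.le (hl.linked_symm h)) (ht.le h))
  · obtain ⟨s, hs⟩ := (Finset.mem_filter.1 hd).2
    obtain ⟨c, t, h, ht, -⟩ := hs.exists_linked hr
    have hc : c ∈ Finset.univ.filter fun c => ∃ s, IsRankedLoop π lab r c s :=
      Finset.mem_filter.2 ⟨Finset.mem_univ _, t, ht⟩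
    obtain ⟨l, hl, -⟩ := id hs
    have h' := h.trans (h₁ c hc)
    exact ⟨c, hc, hr' (le_antisymm ((h₂ c hc).le (hl.linked_symm h')) (hs.le h'))⟩

end Loops
end FreeTraced

/-! ### Naturality and sliding -/

namespace FreeTraced
variable {C : Type u} [Category.{v} C]

/-- The permutation of a morphism between binary concatenations, with the blocks separated. If the
second blocks agree, this is `splitPerm`. -/
def blockPerm {A B U V : FreeTraced C} (f : A ⊗ U ⟶ B ⊗ V) :
    Fin A.len ⊕ Fin U.len ≃ Fin B.len ⊕ Fin V.len :=
  finSumFinEquiv.trans ((Hom.perm f).trans finSumFinEquiv.symm)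

/-- The labels of a morphism between binary concatenations, with the blocks separated. If the
second blocks agree, this is `splitArrow`. -/
def blockArrow {A B U V : FreeTraced C} (f : A ⊗ U ⟶ B ⊗ V) (x : Fin A.len ⊕ Fin U.len) :
    Sum.elim A.obj U.obj x ⟶ Sum.elim B.obj V.obj (blockPerm f x) :=
  eqToHom (congrArg (Sum.elim A.obj U.obj) (Equiv.symm_apply_apply finSumFinEquiv x).symm) ≫
    Hom.arrow f (finSumFinEquiv x)

theorem blockArrow_heq {A B U V : FreeTraced C} (f : A ⊗ U ⟶ B ⊗ V) (x) :
    HEq (blockArrow f x) (Hom.arrow f (finSumFinEquiv x)) :=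
  eqToHom_comp_heq' _ _

theorem blockPerm_comp {A B D U V W : FreeTraced C} (f : A ⊗ U ⟶ B ⊗ V) (g : B ⊗ V ⟶ D ⊗ W) :
    blockPerm (f ≫ g) = (blockPerm f).trans (blockPerm g) := by
  ext x : 1
  exact congrArg (fun i => finSumFinEquiv.symm (Hom.perm g i))
    (Equiv.apply_symm_apply finSumFinEquiv _).symm

theorem blockArrow_comp {A B D U V W : FreeTraced C} (f : A ⊗ U ⟶ B ⊗ V) (g : B ⊗ V ⟶ D ⊗ W)
    (x) : HEq (blockArrow (f ≫ g) x) (blockArrow f x ≫ blockArrow g (blockPerm f x)) := by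
  refine (blockArrow_heq _ _).trans (comp_heq ?_ rfl ?_ (blockArrow_heq f x).symm ?_)
  · exact congrArg (Sum.elim A.obj U.obj) (Equiv.symm_apply_apply finSumFinEquiv x)
  · exact congrArg (Sum.elim D.obj W.obj)
      (congrArg (fun i => blockPerm (f ≫ g) i) rfl |>.trans (congrArg (· x) (blockPerm_comp f g)))
  · exact ((blockArrow_heq g _).trans
      (arrow_congr g (Equiv.apply_symm_apply finSumFinEquiv _))).symm

theorem blockPerm_tensor {A B U V : FreeTraced C} (a : A ⟶ B) (g : U ⟶ V) :
    blockPerm (a ⊗ₘ g) = Equiv.sumCongr (Hom.perm a) (Hom.perm g) := by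
  ext x : 1
  change finSumFinEquiv.symm (finSumFinEquiv (Equiv.sumCongr _ _
    (finSumFinEquiv.symm (finSumFinEquiv x)))) = _
  rw [Equiv.symm_apply_apply, Equiv.symm_apply_apply]

theorem blockArrow_tensor {A B U V : FreeTraced C} (a : A ⟶ B) (g : U ⟶ V) (x) :
    HEq (blockArrow (a ⊗ₘ g) x) (sumArrow a g x) := by
  refine (blockArrow_heq _ _).trans ((comp_eqToHom_heq' _ _).trans ?_)
  exact sumArrow_congr a g (Equiv.symm_apply_apply finSumFinEquiv x)

theorem blockArrow_congr {A B U V : FreeTraced C} (f : A ⊗ U ⟶ B ⊗ V) {x y} (h : x = y) :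
    HEq (blockArrow f x) (blockArrow f y) := by subst h; rfl

section Slide
variable {A A' B B' U U' : FreeTraced C} (a : A' ⟶ A) (g : U' ⟶ U) (f : A ⊗ U ⟶ B ⊗ U')
  (b : B ⟶ B')

theorem run_pre_iff {x l y h} :
    Run (splitPerm ((a ⊗ₘ g) ≫ f)) (splitArrow ((a ⊗ₘ g) ≫ f)) x l y h ↔
      Run ((Equiv.sumCongr (Hom.perm a) (Hom.perm g)).trans (blockPerm f))
        (fun x => sumArrow a g x ≫ blockArrow f (Sum.map (Hom.perm a) (Hom.perm g) x)) x l y h := by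
  have hp : splitPerm ((a ⊗ₘ g) ≫ f) =
      (Equiv.sumCongr (Hom.perm a) (Hom.perm g)).trans (blockPerm f) := by
    rw [← blockPerm_tensor]; exact blockPerm_comp _ _
  have e (x) : blockPerm (a ⊗ₘ g) x = Sum.map (Hom.perm a) (Hom.perm g) x := by
    rw [blockPerm_tensor]; rfl
  refine Run.congr hp fun x => (blockArrow_comp (a ⊗ₘ g) f x).trans ?_
  exact comp_heq rfl (congrArg _ (e x)) (congrArg _ (congrArg _ (e x)))
    (blockArrow_tensor a g x) (blockArrow_congr f (e x))

theorem run_post_iff {x l y h} :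
    Run (splitPerm (f ≫ (b ⊗ₘ g))) (splitArrow (f ≫ (b ⊗ₘ g))) x l y h ↔
      Run ((blockPerm f).trans (Equiv.sumCongr (Hom.perm b) (Hom.perm g)))
        (fun x => blockArrow f x ≫ sumArrow b g (blockPerm f x)) x l y h := by
  have hp : splitPerm (f ≫ (b ⊗ₘ g)) =
      (blockPerm f).trans (Equiv.sumCongr (Hom.perm b) (Hom.perm g)) := by
    rw [← blockPerm_tensor]; exact blockPerm_comp _ _
  have e (x) : blockPerm (b ⊗ₘ g) x = Sum.map (Hom.perm b) (Hom.perm g) x := by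
    rw [blockPerm_tensor]; rfl
  refine Run.congr hp fun x => (blockArrow_comp f (b ⊗ₘ g) x).trans ?_
  exact comp_heq rfl rfl (congrArg _ (e _)) HEq.rfl (blockArrow_tensor b g _)

/-- A run of `(a ⊗ g) ≫ f` is a run of `f ≫ (b ⊗ g)`, shifted by one label. -/
theorem run_slide {x l y h}
    (H : Run (splitPerm ((a ⊗ₘ g) ≫ f)) (splitArrow ((a ⊗ₘ g) ≫ f)) x l y h) :
    ∃ k, h = sumArrow a g x ≫ k ∧
      Run (splitPerm (f ≫ (b ⊗ₘ g))) (splitArrow (f ≫ (b ⊗ₘ g)))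
        (Sum.map (Hom.perm a) (Hom.perm g) x) (l.map (Hom.perm g))
        (Sum.map (Hom.perm b) (Hom.perm g) y) (k ≫ sumArrow b g y) := by
  simp only [run_pre_iff, run_post_iff] at H ⊢
  induction H with
  | single => exact ⟨_, rfl, .single⟩
  | @step l c h H ih =>
    obtain ⟨k, rfl, ih⟩ := ih
    refine ⟨(k ≫ sumArrow b g (Sum.inr c)) ≫ blockArrow f (Sum.inr (Hom.perm g c)), ?_, ?_⟩
    · exact (Category.assoc (sumArrow a g _) k
        (sumArrow a g (Sum.inr c) ≫ blockArrow f (Sum.inr (Hom.perm g c)))).trans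
        (congrArg (sumArrow a g _ ≫ ·) (Category.assoc k (sumArrow b g (Sum.inr c)) _).symm)
    · rw [List.map_append]
      exact (congrArg (Run _ _ _ _ _) (Category.assoc (k ≫ sumArrow b g (Sum.inr c))
        (blockArrow f (Sum.inr (Hom.perm g c))) (sumArrow b g _))).mpr ih.step

/-- The converse of `run_slide`. -/
theorem exists_run_slide {x l' y' h'}
    (H : Run (splitPerm (f ≫ (b ⊗ₘ g))) (splitArrow (f ≫ (b ⊗ₘ g)))
      (Sum.map (Hom.perm a) (Hom.perm g) x) l' y' h') :
    ∃ l y h, l' = l.map (Hom.perm g) ∧ y' = Sum.map (Hom.perm b) (Hom.perm g) y ∧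
      Run (splitPerm ((a ⊗ₘ g) ≫ f)) (splitArrow ((a ⊗ₘ g) ≫ f)) x l y h := by
  simp only [run_pre_iff, run_post_iff] at H ⊢
  induction H with
  | single => exact ⟨[], _, _, rfl, rfl, .single⟩
  | @step l' c' h' H ih =>
    obtain ⟨l, y, h, rfl, e, ih⟩ := ih
    cases y with
    | inl j => cases e
    | inr c =>
      cases e
      exact ⟨l ++ [c], _, _, by simp, rfl, ih.step⟩

/-- Sliding `g` around the feedback rotates each cycle of labels by one step, so the loops do not
change. The cycles correspond under the permutation of `g`, which moves the node of least rank. -/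
theorem feedbackLoops_slide :
    feedbackLoops ((a ⊗ₘ g) ≫ f) = feedbackLoops (f ≫ (b ⊗ₘ g)) := by
  rw [feedbackLoops_eq_sum, feedbackLoops_eq_sum,
    sum_loopAt_eq (r' := fun c => ((Hom.perm g).symm c : ℕ)) Fin.val_injective
      (Fin.val_injective.comp (Hom.perm g).symm.injective),
    ← (Hom.perm g).sum_comp]
  refine Finset.sum_congr rfl fun c _ => loopAt_congr ?_ ?_
  · rintro s ⟨l, H, hl⟩
    obtain ⟨k, rfl, H'⟩ := run_slide a g f b H
    refine ⟨k ≫ Hom.arrow g c, ⟨l.map (Hom.perm g), H', fun d hd => ?_⟩,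
      loopMk_comp_comm k (Hom.arrow g c)⟩
    obtain ⟨d, hd', rfl⟩ := List.mem_map.1 hd
    simpa using hl d hd'
  · rintro s ⟨l', H, hl⟩
    obtain ⟨l, y, h, rfl, e, H⟩ := exists_run_slide a g f b (x := Sum.inr c) H
    cases y with
    | inl j => cases e
    | inr d =>
      obtain rfl : c = d := by simpa using e
      exact ⟨h, l, H, fun d hd => by simpa using hl _ (List.mem_map_of_mem hd)⟩

/-- Naturality in the input and the output and sliding along the feedback, all at once. -/
theorem traceHom_slide :
    a ≫ traceHom U (f ≫ (b ⊗ₘ g)) = traceHom U' ((a ⊗ₘ g) ≫ f) ≫ b := by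
  have h₁ := isTraceOf_traceHom (f ≫ (b ⊗ₘ g))
  have h₂ := isTraceOf_traceHom ((a ⊗ₘ g) ≫ f)
  have key (i) : (⟨Hom.perm (a ≫ traceHom U (f ≫ (b ⊗ₘ g))) i,
      Hom.arrow (a ≫ traceHom U (f ≫ (b ⊗ₘ g))) i⟩ : Σ j, A'.obj i ⟶ B'.obj j) =
      ⟨Hom.perm (traceHom U' ((a ⊗ₘ g) ≫ f) ≫ b) i,
        Hom.arrow (traceHom U' ((a ⊗ₘ g) ≫ f) ≫ b) i⟩ := by
    obtain ⟨l₁, H₁⟩ := h₁.path (Hom.perm a i)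
    obtain ⟨l₂, H₂⟩ := h₂.path i
    obtain ⟨k, hk, H₂⟩ := run_slide a g f b H₂
    rw [comp_arrow, comp_arrow, hk]
    have := (H₁.unique H₂).2
    exact (congrArg (fun m : Σ j, A.obj (Hom.perm a i) ⟶ B'.obj j =>
      (⟨m.1, Hom.arrow a i ≫ m.2⟩ : Σ j, A'.obj i ⟶ B'.obj j)) this).trans
        (Sigma.ext rfl (heq_of_eq (Category.assoc (Hom.arrow a i) k _).symm))
  refine hom_ext ?_ (fun i => congrArg Sigma.fst (key i))
    fun i => (Sigma.mk.injEq _ _ _ _ ▸ key i).2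
  simp only [comp_loops, h₁.loops, h₂.loops, ← feedbackLoops_slide a g f b]
  change _ + (_ + (_ + _) + _) = (_ + _) + _ + _ + _
  abel

end Slide
end FreeTraced

/-! ### Simulations between systems with feedback -/

namespace FreeTraced
variable {C : Type u} [Category.{v} C]

/-- The positions of a concatenation are those of the two blocks. -/
def position {A B : FreeTraced C} : Fin A.len ⊕ Fin B.len ≃ Fin (A ⊗ B).len := finSumFinEquiv

/-- A morphism of `C` together with its source and target. Labels at corresponding positions of
different lists live in types that are only propositionally equal; as segments they can be
compared by an equality. -/
abbrev Segment (C : Type u) [Category.{v} C] : Type (max u v) := Σ X Y : C, X ⟶ Y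

/-- The label of a morphism at a position, with its source and target. -/
def segment {A B : FreeTraced C} (f : A ⟶ B) (i : Fin A.len) : Segment C :=
  ⟨A.obj i, B.obj (Hom.perm f i), Hom.arrow f i⟩

theorem segment_eq {X Y X' Y' : C} {f : X ⟶ Y} {f' : X' ⟶ Y'} (hX : X = X') (hY : Y = Y')
    (h : HEq f f') : (⟨X, Y, f⟩ : Segment C) = ⟨X', Y', f'⟩ := by
  subst hX hY; rw [eq_of_heq h]

theorem segment_tensor_inL {A B A' B' : FreeTraced C} (f : A ⟶ B) (g : A' ⟶ B') (i) :
    segment (f ⊗ₘ g) (inL A A' i) = segment f i :=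
  segment_eq (obj_inL _ _ _)
    ((congrArg (append B B').obj (tensor_perm_inL f g i)).trans (obj_inL _ _ _))
    (tensor_arrow_inL f g i)

theorem segment_tensor_inR {A B A' B' : FreeTraced C} (f : A ⟶ B) (g : A' ⟶ B') (i) :
    segment (f ⊗ₘ g) (inR A A' i) = segment g i :=
  segment_eq (obj_inR _ _ _)
    ((congrArg (append B B').obj (tensor_perm_inR f g i)).trans (obj_inR _ _ _))
    (tensor_arrow_inR f g i)

theorem segment_pre {A B D : FreeTraced C} {r : A ⟶ B} (hr : IsRelabel r) (f : B ⟶ D) (i) :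
    segment (r ≫ f) i = segment f (Hom.perm r i) := by
  refine segment_eq (hr.obj i) rfl ?_
  rw [comp_arrow, hr.arrow]
  exact eqToHom_comp_heq' _ _

theorem segment_post {A B D : FreeTraced C} {r : B ⟶ D} (hr : IsRelabel r) (f : A ⟶ B) (i) :
    segment (f ≫ r) i = segment f i := by
  refine segment_eq rfl (hr.obj _).symm ?_
  rw [comp_arrow, hr.arrow]
  exact comp_eqToHom_heq' _ _

theorem segment_relabel {A B : FreeTraced C} {r : A ⟶ B} (hr : IsRelabel r) (i) :
    segment r i = ⟨A.obj i, A.obj i, 𝟙 _⟩ :=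
  segment_eq rfl (hr.obj i).symm (hr.heq i)

theorem segment_splitArrow {A B U : FreeTraced C} (f : A ⊗ U ⟶ B ⊗ U) (x) :
    (⟨_, _, splitArrow f x⟩ : Segment C) = segment f (position x) :=
  segment_eq (congrArg (Sum.elim A.obj U.obj) (Equiv.symm_apply_apply finSumFinEquiv x).symm) rfl
    (eqToHom_comp_heq' _ _)

theorem loopMk_segment {X Y : C} {s : X ⟶ X} {t : Y ⟶ Y}
    (h : (⟨X, X, s⟩ : Segment C) = ⟨Y, Y, t⟩) : CatLoop.mk s = CatLoop.mk t := by
  cases h; rfl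

/-- The runs of a morphism, with the composite as a segment of `C`. -/
def SegmentRun {A B U : FreeTraced C} (f : A ⊗ U ⟶ B ⊗ U) (x : Fin A.len ⊕ Fin U.len)
    (l : List (Fin U.len)) (y : Fin B.len ⊕ Fin U.len) (m : Segment C) : Prop :=
  ∃ g, Run (splitPerm f) (splitArrow f) x l y g ∧ m = ⟨_, _, g⟩

section
variable {A B U : FreeTraced C} {f : A ⊗ U ⟶ B ⊗ U} {x : Fin A.len ⊕ Fin U.len}
  {l : List (Fin U.len)} {y : Fin B.len ⊕ Fin U.len}

theorem splitPerm_eq_iff {x y} : splitPerm f x = y ↔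
    Hom.perm f (position x) = position y :=
  Equiv.symm_apply_eq finSumFinEquiv

theorem Run.segmentRun {g} (h : Run (splitPerm f) (splitArrow f) x l y g) :
    SegmentRun f x l y ⟨_, _, g⟩ := ⟨g, h, rfl⟩

theorem SegmentRun.single (h : Hom.perm f (position x) = position y) :
    SegmentRun f x [] y (segment f (position x)) := by
  obtain rfl := splitPerm_eq_iff.2 h
  exact ⟨_, .single, (segment_splitArrow f x).symm⟩

theorem SegmentRun.append {c : Fin U.len} {X Y Z : C} {p : X ⟶ Y} {q : Y ⟶ Z} {l'}
    (h : SegmentRun f x l (Sum.inr c) ⟨X, Y, p⟩) (h' : SegmentRun f (Sum.inr c) l' y ⟨Y, Z, q⟩) :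
    SegmentRun f x (l ++ c :: l') y ⟨X, Z, p ≫ q⟩ := by
  obtain ⟨p', h, e⟩ := h
  obtain ⟨q', h', e'⟩ := h'
  cases e
  cases e'
  exact ⟨_, h.append h', rfl⟩

theorem SegmentRun.concat {c : Fin U.len} {X Y Z : C} {p : X ⟶ Y} {q : Y ⟶ Z}
    (h : SegmentRun f x l (Sum.inr c) ⟨X, Y, p⟩)
    (hy : Hom.perm f (inR A U c) = position y) (hq : segment f (inR A U c) = ⟨Y, Z, q⟩) :
    SegmentRun f x (l ++ [c]) y ⟨X, Z, p ≫ q⟩ :=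
  h.append (hq ▸ SegmentRun.single (x := Sum.inr c) hy)

theorem SegmentRun.run {i : Fin A.len} {j : Fin B.len} {g : A.obj i ⟶ B.obj j}
    (h : SegmentRun f (Sum.inl i) l (Sum.inl j) ⟨_, _, g⟩) :
    Run (splitPerm f) (splitArrow f) (Sum.inl i) l (Sum.inl j) g := by
  obtain ⟨g', h, e⟩ := h
  cases e
  exact h

theorem exists_isRankedLoop_iff {c : Fin U.len} :
    (∃ s, IsRankedLoop (splitPerm f) (splitArrow f) Fin.val c s) ↔
      ∃ l m, SegmentRun f (Sum.inr c) l (Sum.inr c) m ∧ ∀ d ∈ l, c < d :=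
  ⟨fun ⟨_, l, h, hl⟩ => ⟨l, _, h.segmentRun, hl⟩, fun ⟨l, _, ⟨g, h, _⟩, hl⟩ => ⟨g, l, h, hl⟩⟩

/-- Two morphisms have the same loop at a node if their cycles correspond. -/
theorem loopAt_eq_of_segmentRun {A' B' U' : FreeTraced C} {f' : A' ⊗ U' ⟶ B' ⊗ U'}
    {c : Fin U.len} {c' : Fin U'.len}
    (h : ∀ l m, SegmentRun f (Sum.inr c) l (Sum.inr c) m → (∀ d ∈ l, c < d) →
      ∃ l', SegmentRun f' (Sum.inr c') l' (Sum.inr c') m ∧ ∀ d ∈ l', c' < d)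
    (h' : ∀ l' m, SegmentRun f' (Sum.inr c') l' (Sum.inr c') m → (∀ d ∈ l', c' < d) →
      ∃ l m', SegmentRun f (Sum.inr c) l (Sum.inr c) m' ∧ ∀ d ∈ l, c < d) :
    loopAt (splitPerm f) (splitArrow f) Fin.val c =
      loopAt (splitPerm f') (splitArrow f') Fin.val c' := by
  refine loopAt_congr ?_ ?_
  · rintro s ⟨l, H, hl⟩
    obtain ⟨l', ⟨s', H', e⟩, hl'⟩ := h l _ H.segmentRun hl
    exact ⟨s', ⟨l', H', hl'⟩, (loopMk_segment e).symm⟩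
  · rintro s ⟨l, H, hl⟩
    exact exists_isRankedLoop_iff.2 (h' l _ H.segmentRun hl)

theorem isTraceOf_of_segmentRun {g : A ⟶ B} (h : Hom.loops g = Hom.loops f + feedbackLoops f)
    (h' : ∀ i, ∃ l, SegmentRun f (Sum.inl i) l (Sum.inl (Hom.perm g i)) (segment g i)) :
    IsTraceOf f g :=
  ⟨h, fun i => ⟨_, (h' i).choose_spec.run⟩⟩

theorem IsTraceOf.segmentRun {g : A ⟶ B} (h : IsTraceOf f g) (i) :
    ∃ l, SegmentRun f (Sum.inl i) l (Sum.inl (Hom.perm g i)) (segment g i) :=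
  ⟨_, (h.path i).choose_spec.segmentRun⟩

end

section Simulation
variable {A B U A' B' U' : FreeTraced C} {f : A ⊗ U ⟶ B ⊗ U} {f' : A' ⊗ U' ⟶ B' ⊗ U'}

/-- An embedding of the nodes of `f` into the nodes of `f'` that respects permutations, labels and
feedback. -/
structure Simulation (f : A ⊗ U ⟶ B ⊗ U) (f' : A' ⊗ U' ⟶ B' ⊗ U') where
  node : Fin U.len → Fin U'.len
  source : Fin A.len ⊕ Fin U.len → Fin A'.len ⊕ Fin U'.len
  target : Fin B.len ⊕ Fin U.len → Fin B'.len ⊕ Fin U'.len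
  source_inr (c) : source (Sum.inr c) = Sum.inr (node c)
  target_inr (c) : target (Sum.inr c) = Sum.inr (node c)
  target_injective : Function.Injective target
  perm (x y) (h : Hom.perm f (position x) = position y) :
    Hom.perm f' (position (source x)) = position (target y)
  segment (x) : segment f' (position (source x)) = segment f (position x)

/-- A simulation transports runs. -/
theorem Simulation.run (σ : Simulation f f') {x l y m} (h : SegmentRun f x l y m) :
    SegmentRun f' (σ.source x) (l.map σ.node) (σ.target y) m := by
  obtain ⟨g, h, rfl⟩ := h
  induction h with
  | single =>
    rw [segment_splitArrow, ← σ.segment]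
    exact SegmentRun.single (σ.perm _ _ (splitPerm_eq_iff.1 rfl))
  | @step l c g h ih =>
    rw [List.map_append]
    rw [σ.target_inr] at ih
    have e : position (σ.source (Sum.inr c)) = inR A' U' (σ.node c) := by
      rw [σ.source_inr]; rfl
    refine ih.concat (q := splitArrow f (Sum.inr c)) ?_ ?_
    · rw [← e]; exact σ.perm _ _ (splitPerm_eq_iff.1 rfl)
    · rw [← e, σ.segment]; exact (segment_splitArrow f _).symm

/-- A run of `f'` from a simulated node that visits only simulated feedback nodes is the image of a
run of `f`. -/
theorem Simulation.exists_run (σ : Simulation f f') {x l' y' m}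
    (h : SegmentRun f' (σ.source x) l' y' m)
    (hl : ∀ d ∈ l', d ∈ Set.range σ.node) :
    ∃ l y m', l' = l.map σ.node ∧ y' = σ.target y ∧ SegmentRun f x l y m' := by
  obtain ⟨g, h, rfl⟩ := h
  induction h with
  | single =>
    exact ⟨[], _, _, rfl, splitPerm_eq_iff.2 (σ.perm _ _ (splitPerm_eq_iff.1 rfl)), .single
      (splitPerm_eq_iff.1 rfl)⟩
  | @step l' c' g h ih =>
    obtain ⟨l, y, m', rfl, e, g', h', -⟩ := ih fun d hd => hl d (by simp [hd])
    obtain ⟨c, rfl⟩ := hl c' (by simp)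
    rw [← σ.target_inr] at e
    obtain rfl := σ.target_injective e
    refine ⟨l ++ [c], _, _, by simp, ?_, h'.step.segmentRun⟩
    rw [splitPerm_eq_iff, ← σ.source_inr]
    exact σ.perm _ _ (splitPerm_eq_iff.1 rfl)

/-- Corresponding nodes carry the same loop if all feedback nodes of higher rank are simulated: a
cycle with the given node of least rank then lies within the simulated nodes. -/
theorem Simulation.loopAt (σ : Simulation f f') (hσ : StrictMono σ.node) (c : Fin U.len)
    (hr : ∀ d, σ.node c < d → d ∈ Set.range σ.node) :
    loopAt (splitPerm f) (splitArrow f) Fin.val c =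
      FreeTraced.loopAt (splitPerm f') (splitArrow f') Fin.val (σ.node c) := by
  refine loopAt_eq_of_segmentRun (fun l m h hl => ⟨l.map σ.node, ?_, ?_⟩) fun l' m h hl => ?_
  · have := σ.run h
    rwa [σ.source_inr, σ.target_inr] at this
  · intro d hd
    obtain ⟨d, hd', rfl⟩ := List.mem_map.1 hd
    exact hσ (hl d hd')
  · rw [← σ.source_inr] at h
    obtain ⟨l, y, m', rfl, e, h⟩ := σ.exists_run h fun d hd => hr d (hl d hd)
    rw [← σ.target_inr] at e
    obtain rfl := σ.target_injective e
    exact ⟨l, m', h, fun d hd => hσ.lt_iff_lt.1 (hl _ (List.mem_map_of_mem hd))⟩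

end Simulation

end FreeTraced

/-! ### Superposing, the unit and yanking -/

namespace FreeTraced
variable {C : Type u} [Category.{v} C]

theorem isRelabel_associator_hom (A B D : FreeTraced C) : IsRelabel (α_ A B D).hom :=
  isRelabel_eqToHom (append_assoc A B D)

theorem isRelabel_associator_inv (A B D : FreeTraced C) : IsRelabel (α_ A B D).inv :=
  isRelabel_eqToHom (append_assoc A B D).symm

theorem perm_inv_hom {A B : FreeTraced C} (e : A ≅ B) (i) :
    Hom.perm e.hom (Hom.perm e.inv i) = i := by
  have := congrArg (fun f => Hom.perm f i) e.inv_hom_id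
  exact this

theorem perm_hom_inv {A B : FreeTraced C} (e : A ≅ B) (i) :
    Hom.perm e.inv (Hom.perm e.hom i) = i := by
  have := congrArg (fun f => Hom.perm f i) e.hom_inv_id
  exact this

/-- The feedback system of `f` inside that of `g ⊗ f`. -/
def superposingSimulation {A B U W Z : FreeTraced C} (f : A ⊗ U ⟶ B ⊗ U) (g : W ⟶ Z) :
    Simulation f ((α_ W A U).hom ≫ (g ⊗ₘ f) ≫ (α_ Z B U).inv) where
  node := id
  source := Sum.map (inR W A) id
  target := Sum.map (inR Z B) id
  source_inr _ := rfl
  target_inr _ := rfl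
  target_injective := Sum.map_injective.2 ⟨Fin.natAdd_injective _ _, Function.injective_id⟩
  perm x y h := by
    have e₁ : Hom.perm (α_ W A U).hom (position (Sum.map (inR W A) id x)) =
        inR W (A ⊗ U) (position x) := by
      cases x with
      | inl i => exact assoc_perm_LR W A U i
      | inr i => exact assoc_perm_R W A U i
    have e₂ : Hom.perm (α_ Z B U).inv (inR Z (B ⊗ U) (position y)) =
        position (Sum.map (inR Z B) id y) := by
      cases y with
      | inl i => exact assoc_symm_perm_RL Z B U i
      | inr i => exact assoc_symm_perm_RR Z B U i
    refine Eq.trans ?_ e₂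
    change Hom.perm (α_ Z B U).inv (Hom.perm (g ⊗ₘ f) (Hom.perm (α_ W A U).hom _)) = _
    rw [e₁, ← h]
    exact congrArg _ (tensor_perm_inR g f _)
  segment x := by
    have e₁ : Hom.perm (α_ W A U).hom (position (Sum.map (inR W A) id x)) =
        inR W (A ⊗ U) (position x) := by
      cases x with
      | inl i => exact assoc_perm_LR W A U i
      | inr i => exact assoc_perm_R W A U i
    rw [segment_pre (isRelabel_associator_hom W A U), e₁,
      segment_post (isRelabel_associator_inv Z B U), segment_tensor_inR]

theorem isTraceOf_superposing {A B U W Z : FreeTraced C} (f : A ⊗ U ⟶ B ⊗ U) (g : W ⟶ Z) :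
    IsTraceOf ((α_ W A U).hom ≫ (g ⊗ₘ f) ≫ (α_ Z B U).inv) (g ⊗ₘ traceHom U f) := by
  have h := isTraceOf_traceHom f
  refine isTraceOf_of_segmentRun ?_ fun i => ?_
  · have : feedbackLoops ((α_ W A U).hom ≫ (g ⊗ₘ f) ≫ (α_ Z B U).inv) = feedbackLoops f := by
      rw [feedbackLoops_eq_sum, feedbackLoops_eq_sum]
      exact Finset.sum_congr rfl fun c _ =>
        ((superposingSimulation f g).loopAt strictMono_id c fun d _ => ⟨d, rfl⟩).symm
    rw [this, comp_loops, comp_loops, (isRelabel_associator_hom W A U).loops,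
      (isRelabel_associator_inv Z B U).loops]
    change Hom.loops g + Hom.loops (traceHom U f) = 0 + (Hom.loops g + Hom.loops f + 0) + _
    rw [h.loops]
    abel
  · induction i using append_cases with
    | hl i =>
      refine ⟨[], ?_⟩
      have e₁ : Hom.perm (α_ W A U).hom (inL (W ⊗ A) U (inL W A i)) = inL W (A ⊗ U) i :=
        assoc_perm_LL W A U i
      have e₂ : segment (g ⊗ₘ traceHom U f) (inL W A i) =
          segment ((α_ W A U).hom ≫ (g ⊗ₘ f) ≫ (α_ Z B U).inv) (inL (W ⊗ A) U (inL W A i)) := by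
        rw [segment_pre (isRelabel_associator_hom W A U), e₁,
          segment_post (isRelabel_associator_inv Z B U), segment_tensor_inL, segment_tensor_inL]
      rw [e₂]
      refine SegmentRun.single (x := Sum.inl (inL W A i)) ?_
      have e₃ : Hom.perm (g ⊗ₘ traceHom U f) (inL W A i) = inL Z B (Hom.perm g i) :=
        tensor_perm_inL _ _ _
      rw [e₃]
      change Hom.perm (α_ Z B U).inv (Hom.perm (g ⊗ₘ f) (Hom.perm (α_ W A U).hom
        (inL (W ⊗ A) U (inL W A i)))) = inL (Z ⊗ B) U (inL Z B (Hom.perm g i))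
      rw [e₁]
      exact (congrArg _ (tensor_perm_inL g f i)).trans (assoc_symm_perm_L Z B U _)
    | hr i =>
      obtain ⟨l, hl⟩ := h.segmentRun i
      refine ⟨l, ?_⟩
      have := (superposingSimulation f g).run hl
      rw [segment_tensor_inR]
      have e₃ : Hom.perm (g ⊗ₘ traceHom U f) (inR W A i) = inR Z B (Hom.perm (traceHom U f) i) :=
        tensor_perm_inR _ _ _
      rw [e₃, ← List.map_id l]
      exact this

theorem isTraceOf_unit {A B : FreeTraced C} (f : A ⊗ 𝟙_ (FreeTraced C) ⟶ B ⊗ 𝟙_ (FreeTraced C)) :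
    IsTraceOf f ((ρ_ A).inv ≫ f ≫ (ρ_ B).hom) := by
  have hA : IsRelabel (ρ_ A).inv := isRelabel_eqToHom (append_empty A).symm
  have hB : IsRelabel (ρ_ B).hom := isRelabel_eqToHom (append_empty B)
  have e (i) : Hom.perm (ρ_ A).inv i = inL A empty i :=
    eqToHom_perm (append_empty A).symm i
  refine isTraceOf_of_segmentRun ?_ fun i => ⟨[], ?_⟩
  · rw [comp_loops, comp_loops, hA.loops, hB.loops, zero_add, add_zero]
    exact (add_zero _).symm
  · rw [segment_pre hA, e, segment_post hB]
    refine SegmentRun.single (x := Sum.inl i) ?_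
    have e' : Hom.perm ((ρ_ A).inv ≫ f ≫ (ρ_ B).hom) i =
        Hom.perm (ρ_ B).hom (Hom.perm f (inL A empty i)) := by
      rw [← e]; rfl
    rw [e']
    generalize hj : Hom.perm f (inL A empty i) = j
    refine Eq.trans hj ?_
    clear hj e'
    induction j using append_cases with
    | hl j => exact (congrArg (inL B empty) (empty_perm_L B j)).symm
    | hr j => exact j.elim0

/-- Each path of the symmetry goes from an input through one feedback node to the output of the
same index, and there are no cycles. -/
theorem isTraceOf_braiding (U : FreeTraced C) : IsTraceOf (β_ U U).hom (𝟙 U) := by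
  have hβ : IsRelabel (β_ U U).hom := isRelabel_swap U U
  refine isTraceOf_of_segmentRun ?_ fun i => ⟨[i], ?_⟩
  · rw [hβ.loops, feedbackLoops_eq_sum, Finset.sum_eq_zero]
    · rfl
    rintro c -
    refine loopAt_of_not fun s hs => ?_
    obtain ⟨l, h, -⟩ := hs
    have hc : splitPerm (β_ U U).hom (Sum.inr c) = Sum.inl c :=
      splitPerm_eq_iff.2 (swap_perm_inR U U c)
    rcases l with _ | ⟨d, l⟩
    · have := (h.eq_of_length_eq .single rfl).2
      have := congrArg Sigma.fst this
      cases this.trans hc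
    · obtain ⟨l₁, c', l₂, g', h₁, h₂, h₃⟩ := h.exists_prefix (k := 0) (by simp)
      have := congrArg Sigma.fst (h₃.eq_of_length_eq .single h₂).2
      cases this.trans hc
  · have e₁ : segment (β_ U U).hom (inL U U i) = ⟨U.obj i, U.obj i, 𝟙 _⟩ := by
      rw [segment_relabel hβ]
      exact segment_eq (obj_inL _ _ _) (obj_inL _ _ _) (congr_arg_heq (fun X : C => 𝟙 X)
        (obj_inL U U i))
    have e₂ : segment (β_ U U).hom (inR U U i) = ⟨U.obj i, U.obj i, 𝟙 _⟩ := by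
      rw [segment_relabel hβ]
      exact segment_eq (obj_inR _ _ _) (obj_inR _ _ _) (congr_arg_heq (fun X : C => 𝟙 X)
        (obj_inR U U i))
    have h₁ : SegmentRun (β_ U U).hom (Sum.inl i) [] (Sum.inr i) ⟨U.obj i, U.obj i, 𝟙 _⟩ :=
      e₁ ▸ SegmentRun.single (x := Sum.inl i) (swap_perm_inL U U i)
    have h₂ := h₁.concat (y := Sum.inl i) (swap_perm_inR U U i) e₂
    rw [Category.comp_id] at h₂
    exact h₂

end FreeTraced

/-! ### Feedback along a tensor product -/

namespace FreeTraced
variable {C : Type u} [Category.{v} C]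

section Vanishing
variable {A B U V : FreeTraced C} (f : A ⊗ (U ⊗ V) ⟶ B ⊗ (U ⊗ V))

/-- A morphism with feedback along `U ⊗ V`, seen as a morphism with feedback along `V`. -/
abbrev reassoc : (A ⊗ U) ⊗ V ⟶ (B ⊗ U) ⊗ V := (α_ A U V).hom ≫ f ≫ (α_ B U V).inv

/-- The inclusion of the nodes of `A ⊗ U` in those of `A ⊗ (U ⊗ V)`. -/
def extend (V : FreeTraced C) {A U : FreeTraced C} :
    Fin A.len ⊕ Fin U.len → Fin A.len ⊕ Fin (U ⊗ V).len :=
  Sum.map id (inL U V)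

theorem perm_associator_extend (x : Fin A.len ⊕ Fin U.len) :
    Hom.perm (α_ A U V).hom (position (Sum.inl (position x))) = position (extend V x) := by
  cases x with
  | inl i => exact assoc_perm_LL A U V i
  | inr i => exact assoc_perm_LR A U V i

/-- The feedback along `V` inside the feedback along `U ⊗ V`. -/
def vanishingSimulation : Simulation (reassoc f) f where
  node := inR U V
  source x := position.symm (Hom.perm (α_ A U V).hom (position x))
  target x := position.symm (Hom.perm (α_ B U V).hom (position x))
  source_inr c := by
    rw [Equiv.symm_apply_eq]; exact assoc_perm_R A U V c
  target_inr c := by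
    rw [Equiv.symm_apply_eq]; exact assoc_perm_R B U V c
  target_injective := position.symm.injective.comp
    ((Hom.perm (α_ B U V).hom).injective.comp position.injective)
  perm x y h := by
    rw [Equiv.apply_symm_apply, Equiv.apply_symm_apply, ← h]
    exact (perm_inv_hom (α_ B U V) _).symm
  segment x := by
    rw [Equiv.apply_symm_apply, segment_pre (isRelabel_associator_hom A U V),
      segment_post (isRelabel_associator_inv B U V)]

theorem vanishingSimulation_source (x : Fin A.len ⊕ Fin U.len) :
    (vanishingSimulation f).source (Sum.inl (position x)) = extend V x :=
  (Equiv.symm_apply_eq _).2 (perm_associator_extend x)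

theorem vanishingSimulation_target (x : Fin B.len ⊕ Fin U.len) :
    (vanishingSimulation f).target (Sum.inl (position x)) = extend V x :=
  (Equiv.symm_apply_eq _).2 (perm_associator_extend x)

variable {f} {g : A ⊗ U ⟶ B ⊗ U}

/-- A step of the partial trace is a run of the whole system through nodes of `V`. -/
theorem exists_segmentRun_of_step (hg : IsTraceOf (reassoc f) g) {x y}
    (h : Hom.perm g (position x) = position y) :
    ∃ l : List (Fin V.len),
      SegmentRun f (extend V x) (l.map (inR U V)) (extend V y) (segment g (position x)) := by
  obtain ⟨l, hl⟩ := hg.segmentRun (position x)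
  have := (vanishingSimulation f).run hl
  rw [vanishingSimulation_source, h, vanishingSimulation_target] at this
  exact ⟨l, this⟩

/-- A run of the partial trace refines to a run of the whole system. -/
theorem exists_segmentRun_of_partial (hg : IsTraceOf (reassoc f) g) {x l y m}
    (h : SegmentRun g x l y m) :
    ∃ l', SegmentRun f (extend V x) l' (extend V y) m ∧
      ∀ d ∈ l', (∃ c ∈ l, d = inL U V c) ∨ d ∈ Set.range (inR U V) := by
  obtain ⟨k, h, rfl⟩ := h
  induction h with
  | single =>
    obtain ⟨l, hl⟩ := exists_segmentRun_of_step hg (splitPerm_eq_iff.1 (Eq.refl (splitPerm g x)))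
    rw [segment_splitArrow]
    refine ⟨_, hl, fun d hd => Or.inr ?_⟩
    obtain ⟨d, -, rfl⟩ := List.mem_map.1 hd
    exact ⟨d, rfl⟩
  | @step l c k h ih =>
    obtain ⟨l', h', hl'⟩ := ih
    obtain ⟨l₂, h₂⟩ := exists_segmentRun_of_step hg
      (splitPerm_eq_iff.1 (Eq.refl (splitPerm g (Sum.inr c))))
    rw [← segment_splitArrow] at h₂
    refine ⟨_, h'.append (c := inL U V c) h₂, fun d hd => ?_⟩
    rcases List.mem_append.1 hd with hd | hd
    · rcases hl' d hd with ⟨c', hc', e⟩ | e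
      · exact Or.inl ⟨c', by simp [hc'], e⟩
      · exact Or.inr e
    · rcases List.mem_cons.1 hd with rfl | hd
      · exact Or.inl ⟨c, by simp, rfl⟩
      · obtain ⟨d, -, rfl⟩ := List.mem_map.1 hd
        exact Or.inr ⟨d, rfl⟩

/-- A run of the whole system that starts outside `V` decomposes at the last node `z` outside `V`
before its end: up to `z` it is a run of the partial trace `g`, and from `z` on a run through nodes
of `V`, that is, a run of `reassoc f`. -/
theorem exists_partial_prefix (hg : IsTraceOf (reassoc f) g) {x l' y' k}
    (h : Run (splitPerm f) (splitArrow f) (extend V x) l' y' k) :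
    ∃ z, (z = x ∨ ∃ c l m, z = Sum.inr c ∧ inL U V c ∈ l' ∧ SegmentRun g x l (Sum.inr c) m ∧
        ∀ d ∈ l, inL U V d ∈ l') ∧
      ∃ l₀ y₀ m₀, SegmentRun (reassoc f) (Sum.inl (position z)) l₀ y₀ m₀ ∧
        y' = (vanishingSimulation f).target y₀ := by
  have hsingle (z : Fin A.len ⊕ Fin U.len) : ∃ l₀ y₀ m₀,
      SegmentRun (reassoc f) (Sum.inl (position z)) l₀ y₀ m₀ ∧
        splitPerm f (extend V z) = (vanishingSimulation f).target y₀ := by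
    refine ⟨[], _, _, .single (splitPerm_eq_iff.1 rfl), splitPerm_eq_iff.2 ?_⟩
    rw [← vanishingSimulation_source]
    exact (vanishingSimulation f).perm _ _ (splitPerm_eq_iff.1 rfl)
  induction h with
  | single => exact ⟨x, Or.inl rfl, hsingle x⟩
  | @step l' c' k h ih =>
    obtain ⟨z, hz, l₀, y₀, m₀, h₀, e⟩ := ih
    have hz' : z = x ∨ ∃ c l m, z = Sum.inr c ∧ inL U V c ∈ l' ++ [c'] ∧
        SegmentRun g x l (Sum.inr c) m ∧ ∀ d ∈ l, inL U V d ∈ l' ++ [c'] := by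
      refine hz.imp_right ?_
      rintro ⟨c, l, m, rfl, hc, h, hl⟩
      exact ⟨c, l, m, rfl, by simp [hc], h, fun d hd => by simp [hl d hd]⟩
    induction c' using append_cases with
    | hl u =>
      obtain rfl : y₀ = Sum.inl (position (Sum.inr u)) :=
        (vanishingSimulation f).target_injective
          (e.symm.trans (vanishingSimulation_target f (Sum.inr u)).symm)
      obtain ⟨l₁, h₁⟩ := hg.segmentRun (position z)
      have e' : Hom.perm g (position z) = position (Sum.inr u) := by
        obtain ⟨k₀, h₀, -⟩ := h₀
        obtain ⟨k₁, h₁, -⟩ := h₁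
        exact (congrArg Sigma.fst (h₀.unique h₁).2).symm
      refine ⟨Sum.inr u, Or.inr ?_, hsingle (Sum.inr u)⟩
      rcases hz' with rfl | ⟨c, l, ⟨X, Y, p⟩, rfl, hc, h, hl⟩
      · exact ⟨u, [], _, rfl, by simp, .single e', by simp⟩
      · obtain ⟨p', h, -⟩ := h
        obtain ⟨q', h', -⟩ := SegmentRun.single e'
        refine ⟨u, _, _, rfl, by simp, (h.append h').segmentRun, fun d hd => ?_⟩
        rcases List.mem_append.1 hd with hd | hd
        · exact hl d hd
        · obtain rfl : d = c := by simpa using hd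
          exact hc
    | hr v =>
      obtain rfl : y₀ = Sum.inr v :=
        (vanishingSimulation f).target_injective
          (e.symm.trans ((vanishingSimulation f).target_inr v).symm)
      obtain ⟨k₀, h₀, -⟩ := h₀
      refine ⟨z, hz', l₀ ++ [v], _, _, h₀.step.segmentRun, splitPerm_eq_iff.2 ?_⟩
      have := (vanishingSimulation f).perm (Sum.inr v) _ (splitPerm_eq_iff.1 rfl)
      rw [(vanishingSimulation f).source_inr] at this
      exact this

/-- A cycle of the whole system through a node of `U` is a cycle of the partial trace. -/
theorem exists_partial_of_segmentRun (hg : IsTraceOf (reassoc f) g) {c : Fin U.len} {l' m}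
    (h : SegmentRun f (Sum.inr (inL U V c)) l' (Sum.inr (inL U V c)) m) :
    ∃ l m', SegmentRun g (Sum.inr c) l (Sum.inr c) m' ∧ ∀ d ∈ l, inL U V d ∈ l' := by
  obtain ⟨k, h, -⟩ := h
  obtain ⟨z, hz, l₀, y₀, m₀, h₀, e⟩ := exists_partial_prefix hg (x := Sum.inr c) h
  obtain rfl : y₀ = Sum.inl (position (Sum.inr c)) :=
    (vanishingSimulation f).target_injective
      (e.symm.trans (vanishingSimulation_target f (Sum.inr c)).symm)
  obtain ⟨l₁, h₁⟩ := hg.segmentRun (position z)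
  have e' : Hom.perm g (position z) = position (Sum.inr c) := by
    obtain ⟨k₀, h₀, -⟩ := h₀
    obtain ⟨k₁, h₁, -⟩ := h₁
    exact (congrArg Sigma.fst (h₀.unique h₁).2).symm
  rcases hz with rfl | ⟨c', l, m, rfl, hc, h, hl⟩
  · exact ⟨[], _, .single e', by simp⟩
  · obtain ⟨p', h, -⟩ := h
    obtain ⟨q', h', -⟩ := SegmentRun.single e'
    refine ⟨_, _, (h.append h').segmentRun, fun d hd => ?_⟩
    rcases List.mem_append.1 hd with hd | hd
    · exact hl d hd
    · obtain rfl : d = c' := by simpa using hd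
      exact hc

/-- The cycles of the whole system are those within `V` and those that meet `U`; the latter are
the cycles of the partial trace. Nodes of `U` precede those of `V`, so the least node of a cycle
lies in `U` as soon as the cycle meets `U`. -/
theorem feedbackLoops_partial (hg : IsTraceOf (reassoc f) g) :
    feedbackLoops f = feedbackLoops (reassoc f) + feedbackLoops g := by
  rw [feedbackLoops_eq_sum, feedbackLoops_eq_sum, feedbackLoops_eq_sum, add_comm]
  refine (Fin.sum_univ_add (a := U.len) (b := V.len) _).trans (congrArg₂ _ ?_ ?_)
  · refine Finset.sum_congr rfl fun c _ => (loopAt_eq_of_segmentRun ?_ ?_).symm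
    · intro l m h hl
      obtain ⟨l', h', hl'⟩ := exists_segmentRun_of_partial hg h
      refine ⟨l', h', fun d hd => ?_⟩
      rcases hl' d hd with ⟨c', hc', rfl⟩ | ⟨v, rfl⟩
      · exact hl c' hc'
      · exact Fin.lt_def.2 (Nat.lt_of_lt_of_le (Fin.isLt c) (Nat.le_add_right U.len v))
    · intro l' m h hl
      obtain ⟨l, m', h', hl'⟩ := exists_partial_of_segmentRun hg h
      exact ⟨l, m', h', fun d hd => hl _ (hl' d hd)⟩
  · refine Finset.sum_congr rfl fun c _ => ?_
    refine ((vanishingSimulation f).loopAt (Fin.strictMono_natAdd _) c fun d hd => ?_).symm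
    induction d using append_cases with
    | hl u =>
      have h₁ : U.len + (c : ℕ) < u := hd
      have := u.isLt
      omega
    | hr v => exact ⟨v, rfl⟩

/-- Tracing out `V` and then `U` is tracing out `U ⊗ V`. -/
theorem IsTraceOf.vanishing (hg : IsTraceOf (reassoc f) g) {h : A ⟶ B}
    (hh : IsTraceOf g h) : IsTraceOf f h := by
  refine isTraceOf_of_segmentRun ?_ fun i => ?_
  · rw [hh.loops, hg.loops, feedbackLoops_partial hg, comp_loops, comp_loops,
      (isRelabel_associator_hom A U V).loops, (isRelabel_associator_inv B U V).loops]
    abel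
  · obtain ⟨l, hl⟩ := hh.segmentRun i
    obtain ⟨l', hl', -⟩ := exists_segmentRun_of_partial hg hl
    exact ⟨l', hl'⟩

end Vanishing

/-- The traced structure given by following paths and collecting loops. -/
noncomputable instance : TracedCategory (FreeTraced C) where
  trace := traceHom
  input_naturality {A A' B U} f g := by
    have := traceHom_slide g (𝟙 U) f (𝟙 B)
    rw [id_tensorHom_id, Category.comp_id, Category.comp_id, tensorHom_id] at this
    exact this
  output_naturality {A B B' U} f g := by
    have := traceHom_slide (𝟙 A) (𝟙 U) f g
    rw [id_tensorHom_id, Category.id_comp, Category.id_comp, tensorHom_id] at this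
    exact this.symm
  feedback_dinaturality {A B U U'} f g := by
    have := traceHom_slide (𝟙 A) g f (𝟙 B)
    rw [id_tensorHom, id_tensorHom, Category.id_comp, Category.comp_id] at this
    exact this
  vanishing_unit f := traceHom_eq_iff.2 (isTraceOf_unit f)
  vanishing_tensor g := traceHom_eq_iff.2
    ((isTraceOf_traceHom (reassoc g)).vanishing (isTraceOf_traceHom _))
  superposing f g := (traceHom_eq_iff.2 (isTraceOf_superposing f g)).symm
  yanking U := traceHom_eq_iff.2 (isTraceOf_braiding U)

end FreeTraced

/-! ### Matchings of lists and their interpretation -/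

/-- `Insertion b bs cs`: the list `cs` arises from `bs` by inserting `b` at one position. -/
inductive Insertion {C : Type u} (b : C) : List C → List C → Type u
  | here (bs : List C) : Insertion b bs (b :: bs)
  | there (c : C) {bs cs : List C} (i : Insertion b bs cs) : Insertion b (c :: bs) (c :: cs)

/-- A matching of two lists of objects: a bijection of their positions together with a morphism
for each matched pair. The head of the first list is matched with the inserted element. -/
inductive Matching {C : Type u} [Category.{v} C] : List C → List C → Type (max u v)
  | nil : Matching [] []
  | cons {a b : C} {as bs cs : List C} (f : a ⟶ b) (m : Matching as bs) (i : Insertion b bs cs) :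
      Matching (a :: as) cs

namespace Insertion
variable {C : Type u}

/-- Two insertions, in the other order. -/
def exchange {b c : C} : ∀ {bs cs ds : List C}, Insertion b bs cs → Insertion c cs ds →
    Σ bs' : List C, Insertion c bs bs' × Insertion b bs' ds
  | _, _, _, i, here _ => ⟨_, here _, there c i⟩
  | _, _, _, here _, there _ j => ⟨_, j, here _⟩
  | _, _, _, there e i, there _ j =>
    ⟨_, there e (exchange i j).2.1, there e (exchange i j).2.2⟩

/-- Insertion in front of a final segment. -/
def append {b : C} (ds : List C) : ∀ {bs cs : List C}, Insertion b bs cs →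
    Insertion b (bs ++ ds) (cs ++ ds)
  | _, _, here bs => here (bs ++ ds)
  | _, _, there c i => there c (append ds i)

/-- Insertion after an initial segment. -/
def after (b : C) (as : List C) : ∀ bs : List C, Insertion b (bs ++ as) (bs ++ b :: as)
  | [] => here as
  | c :: bs => there c (after b as bs)

end Insertion

namespace Matching
variable {C : Type u} [Category.{v} C]

/-- The identity matching. -/
protected def id : ∀ as : List C, Matching as as
  | [] => nil
  | a :: as => cons (𝟙 a) (Matching.id as) (.here as)

/-- An insertion followed by a matching, as a matching whose first position is the inserted one:
the matched partner of the inserted position is pulled to the front. -/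
def pull {b : C} : ∀ {bs cs ds : List C}, Insertion b bs cs → Matching cs ds →
    Matching (b :: bs) ds
  | _, _, _, .here _, m => m
  | _, _, _, .there _ i, cons f m j =>
    match pull i m with
    | cons g m' k => cons g (cons f m' (k.exchange j).2.1) (k.exchange j).2.2

/-- Composition of matchings. -/
def comp : ∀ {as bs cs : List C}, Matching as bs → Matching bs cs → Matching as cs
  | _, _, _, nil, n => n
  | _, _, _, cons f m i, n =>
    match pull i n with
    | cons g n' k => cons (f ≫ g) (comp m n') k

/-- A matching, extended by the identity on an initial segment. -/
def whiskerLeft {bs cs : List C} (m : Matching bs cs) :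
    ∀ as : List C, Matching (as ++ bs) (as ++ cs)
  | [] => m
  | a :: as => cons (𝟙 a) (whiskerLeft m as) (.here _)

/-- A matching, extended by the identity on a final segment. -/
def whiskerRight (cs : List C) : ∀ {as bs : List C}, Matching as bs →
    Matching (as ++ cs) (bs ++ cs)
  | _, _, nil => Matching.id cs
  | _, _, cons f m i => cons f (whiskerRight cs m) (i.append cs)

/-- The identity matching, for the list with the empty list appended. -/
def appendNil : ∀ as : List C, Matching as (as ++ [])
  | [] => nil
  | a :: as => cons (𝟙 a) (appendNil as) (.here _)

/-- The exchange of two blocks. -/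
def swap : ∀ as bs : List C, Matching (as ++ bs) (bs ++ as)
  | [], bs => appendNil bs
  | a :: as, bs => cons (𝟙 a) (swap as bs) (.after a as bs)

end Matching

section Interpretation
variable {C : Type u} [Category.{v} C] {D : Type u₁} [Category.{v₁} D] [MonoidalCategory D]

/-- The tensor product of the images of a list of objects. -/
def listTensor (F : C ⥤ D) : List C → D
  | [] => 𝟙_ D
  | a :: as => F.obj a ⊗ listTensor F as

/-- Concatenation of lists is interpreted as tensor product. -/
def listTensorAppend (F : C ⥤ D) : ∀ as bs : List C,
    listTensor F as ⊗ listTensor F bs ≅ listTensor F (as ++ bs)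
  | [], bs => λ_ (listTensor F bs)
  | a :: as, bs => α_ _ _ _ ≪≫ whiskerLeftIso (F.obj a) (listTensorAppend F as bs)

variable [SymmetricCategory D]

/-- Exchange of the first two factors. -/
def exchangeFactors (X Y Z : D) : X ⊗ Y ⊗ Z ⟶ Y ⊗ X ⊗ Z :=
  (α_ X Y Z).inv ≫ (β_ X Y).hom ▷ Z ≫ (α_ Y X Z).hom

theorem exchangeFactors_exchangeFactors (X Y Z : D) :
    exchangeFactors X Y Z ≫ exchangeFactors Y X Z = 𝟙 _ := by
  simp [exchangeFactors, ← comp_whiskerRight_assoc]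

theorem exchangeFactors_naturality {X X' Y Y' Z Z' : D} (f : X ⟶ X') (g : Y ⟶ Y') (h : Z ⟶ Z') :
    (f ⊗ₘ g ⊗ₘ h) ≫ exchangeFactors X' Y' Z' = exchangeFactors X Y Z ≫ (g ⊗ₘ f ⊗ₘ h) := by
  simp only [exchangeFactors, ← tensorHom_id, associator_inv_naturality_assoc, Category.assoc,
    tensorHom_comp_tensorHom_assoc, BraidedCategory.braiding_naturality, Category.comp_id,
    ← associator_naturality]
  simp

theorem exchangeFactors_whisker (X Y : D) {Z Z' : D} (h : Z ⟶ Z') :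
    X ◁ Y ◁ h ≫ exchangeFactors X Y Z' = exchangeFactors X Y Z ≫ Y ◁ X ◁ h := by
  simpa using exchangeFactors_naturality (𝟙 X) (𝟙 Y) h

/-- The braid relation, with a further factor on the right. -/
theorem exchangeFactors_braid (X Y Z W : D) :
    X ◁ exchangeFactors Y Z W ≫ exchangeFactors X Z (Y ⊗ W) ≫ Z ◁ exchangeFactors X Y W =
      exchangeFactors X Y (Z ⊗ W) ≫ Y ◁ exchangeFactors X Z W ≫ exchangeFactors Y Z (X ⊗ W) := by
  calc _ = (α_ X Y (Z ⊗ W)).inv ⊗≫ (𝟙 ((X ⊗ Y) ⊗ Z) ⊗≫ (X ◁ (β_ Y Z).hom ⊗≫ (β_ X Z).hom ▷ Y ⊗≫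
        Z ◁ (β_ X Y).hom) ⊗≫ 𝟙 ((Z ⊗ Y) ⊗ X)) ▷ W ⊗≫ (α_ Z Y (X ⊗ W)).hom := by
        simp only [exchangeFactors]; monoidal
    _ = (α_ X Y (Z ⊗ W)).inv ⊗≫ ((β_ X Y).hom ▷ Z ⊗≫ Y ◁ (β_ X Z).hom ⊗≫
        (β_ Y Z).hom ▷ X) ▷ W ⊗≫ (α_ Z Y (X ⊗ W)).hom := by
        rw [← BraidedCategory.yang_baxter' X Y Z]
    _ = _ := by simp only [exchangeFactors]; monoidal

/-- Interpretation of an insertion by symmetries. -/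
def Insertion.eval (F : C ⥤ D) {b : C} : ∀ {bs cs : List C}, Insertion b bs cs →
    (F.obj b ⊗ listTensor F bs ⟶ listTensor F cs)
  | _, _, .here _ => 𝟙 _
  | _, _, .there c i => exchangeFactors (F.obj b) (F.obj c) _ ≫ F.obj c ◁ i.eval F

/-- Interpretation of a matching. -/
def Matching.eval (F : C ⥤ D) : ∀ {as bs : List C}, Matching as bs →
    (listTensor F as ⟶ listTensor F bs)
  | _, _, .nil => 𝟙 _
  | _, _, .cons f m i => (F.map f ⊗ₘ m.eval F) ≫ i.eval F

/-- The inductive step of `Insertion.eval_exchange`, for arbitrary morphisms. The object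
`listTensor F (a :: as)` is a tensor product only by definition, so identities between
interpretations are proved for variable objects and then instantiated. -/
theorem exchangeFactors_step {X Y E B₀ B₁ B₂ B₃ : D} {i : X ⊗ B₀ ⟶ B₁} {j : Y ⊗ B₁ ⟶ B₃}
    {j' : Y ⊗ B₀ ⟶ B₂} {i' : X ⊗ B₂ ⟶ B₃}
    (h : Y ◁ i ≫ j = exchangeFactors Y X B₀ ≫ X ◁ j' ≫ i') :
    Y ◁ (exchangeFactors X E B₀ ≫ E ◁ i) ≫ exchangeFactors Y E B₁ ≫ E ◁ j =
      exchangeFactors Y X (E ⊗ B₀) ≫ X ◁ (exchangeFactors Y E B₀ ≫ E ◁ j') ≫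
        exchangeFactors X E B₂ ≫ E ◁ i' := by
  rw [MonoidalCategory.whiskerLeft_comp, Category.assoc,
    reassoc_of% exchangeFactors_whisker Y E i, ← MonoidalCategory.whiskerLeft_comp, h,
    MonoidalCategory.whiskerLeft_comp, MonoidalCategory.whiskerLeft_comp,
    reassoc_of% exchangeFactors_braid Y X E, MonoidalCategory.whiskerLeft_comp, Category.assoc,
    reassoc_of% exchangeFactors_whisker X E j']

theorem Insertion.eval_exchange (F : C ⥤ D) {b c : C} : ∀ {bs cs ds : List C}
    (i : Insertion b bs cs) (j : Insertion c cs ds),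
    F.obj c ◁ i.eval F ≫ j.eval F = exchangeFactors (F.obj c) (F.obj b) _ ≫
      F.obj b ◁ (i.exchange j).2.1.eval F ≫ (i.exchange j).2.2.eval F := by
  intro bs cs ds i j
  induction j generalizing bs with
  | here =>
    have key {X Y B₀ B₁ : D} (i : X ⊗ B₀ ⟶ B₁) : Y ◁ i ≫ 𝟙 (Y ⊗ B₁) =
        exchangeFactors Y X B₀ ≫ X ◁ 𝟙 (Y ⊗ B₀) ≫ exchangeFactors X Y B₀ ≫ Y ◁ i := by
      simp [reassoc_of% exchangeFactors_exchangeFactors]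
    cases i <;> exact key _
  | there e j ih =>
    cases i with
    | here =>
      have key {X Y B₀ B₁ : D} (j : Y ⊗ B₀ ⟶ B₁) :
          Y ◁ 𝟙 (X ⊗ B₀) ≫ exchangeFactors Y X B₀ ≫ X ◁ j =
            exchangeFactors Y X B₀ ≫ X ◁ j ≫ 𝟙 _ := by simp
      exact key _
    | there _ i => exact exchangeFactors_step (ih i)

theorem Matching.eval_id (F : C ⥤ D) (as : List C) : (Matching.id as).eval F = 𝟙 _ := by
  induction as with
  | nil => rfl
  | cons a as ih =>
    have key {X X' Y : D} {f : X ⟶ X} {g : Y ⟶ Y} (hf : f = 𝟙 X) (hg : g = 𝟙 Y) :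
        (f ⊗ₘ g) ≫ 𝟙 (X ⊗ Y) = 𝟙 (X ⊗ Y) := by simp [hf, hg]
    exact key (X' := 𝟙_ D) (F.map_id a) ih

/-- The inductive step of `Matching.eval_pull`, for arbitrary morphisms. -/
theorem exchangeFactors_pull {X Y X' Y' B₀ B₁ B₂ B₃ B₄ B₅ : D} {f : Y ⟶ Y'} {g : X ⟶ X'}
    {i : X ⊗ B₀ ⟶ B₁} {m : B₁ ⟶ B₂} {j : Y' ⊗ B₂ ⟶ B₃} {m' : B₀ ⟶ B₄} {k : X' ⊗ B₄ ⟶ B₂}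
    {j' : Y' ⊗ B₄ ⟶ B₅} {k' : X' ⊗ B₅ ⟶ B₃} (h : (g ⊗ₘ m') ≫ k = i ≫ m)
    (h' : Y' ◁ k ≫ j = exchangeFactors Y' X' B₄ ≫ X' ◁ j' ≫ k') :
    (g ⊗ₘ (f ⊗ₘ m') ≫ j') ≫ k' = (exchangeFactors X Y B₀ ≫ Y ◁ i) ≫ (f ⊗ₘ m) ≫ j := by
  have h₁ : Y ◁ i ≫ (f ⊗ₘ m) = (f ⊗ₘ g ⊗ₘ m') ≫ Y' ◁ k := by
    simp only [← id_tensorHom, tensorHom_comp_tensorHom, Category.id_comp, Category.comp_id, h]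
  have h₂ : (g ⊗ₘ (f ⊗ₘ m') ≫ j') = (g ⊗ₘ f ⊗ₘ m') ≫ X' ◁ j' := by
    simp only [← id_tensorHom, tensorHom_comp_tensorHom, Category.comp_id]
  rw [Category.assoc, h₂, reassoc_of% h₁, h', Category.assoc,
    ← reassoc_of% exchangeFactors_naturality g f m',
    reassoc_of% exchangeFactors_exchangeFactors X' Y' B₄]

theorem Matching.eval_pull (F : C ⥤ D) {b : C} {bs cs ds : List C} (i : Insertion b bs cs)
    (m : Matching cs ds) : (pull i m).eval F = i.eval F ≫ m.eval F := by
  induction i generalizing ds with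
  | here => exact (Category.id_comp _).symm
  | there c i ih =>
    cases m with
    | cons f m j =>
      have ih := ih m
      rw [pull]
      generalize pull i m = p at ih ⊢
      cases p with
      | cons g m' k => exact exchangeFactors_pull ih (Insertion.eval_exchange F k j)

theorem Matching.eval_comp (F : C ⥤ D) {as bs cs : List C} (m : Matching as bs)
    (n : Matching bs cs) : (comp m n).eval F = m.eval F ≫ n.eval F := by
  induction m generalizing cs with
  | nil => exact (Category.id_comp _).symm
  | cons f m i ih =>
    have h := eval_pull F i n
    rw [comp]
    generalize pull i n = p at h ⊢
    cases p with
    | cons g n' k =>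
      have key {X X' X'' A A' A'' B B' : D} {f : X ⟶ X'} {g : X' ⟶ X''} {fg : X ⟶ X''}
          {m : A ⟶ A'} {n' : A' ⟶ A''} {mn : A ⟶ A''} {i : X' ⊗ A' ⟶ B} {n : B ⟶ B'}
          {k : X'' ⊗ A'' ⟶ B'} (h : (g ⊗ₘ n') ≫ k = i ≫ n) (h₁ : fg = f ≫ g)
          (h₂ : mn = m ≫ n') : (fg ⊗ₘ mn) ≫ k = ((f ⊗ₘ m) ≫ i) ≫ n := by
        rw [Category.assoc, ← h, h₁, h₂, tensorHom_comp_tensorHom_assoc]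
      exact key h (F.map_comp f g) (ih n')

theorem Matching.eval_whiskerLeft (F : C ⥤ D) {bs cs : List C} (m : Matching bs cs)
    (as : List C) : (listTensorAppend F as bs).hom ≫ (m.whiskerLeft as).eval F =
      listTensor F as ◁ m.eval F ≫ (listTensorAppend F as cs).hom := by
  induction as with
  | nil => exact (leftUnitor_naturality _).symm
  | cons a as ih =>
    have key {X A B B' E E' : D} {f : X ⟶ X} {μ : A ⊗ B ⟶ E} {μ' : A ⊗ B' ⟶ E'}
        {m : B ⟶ B'} {wm : E ⟶ E'} (hf : f = 𝟙 X) (h : μ ≫ wm = A ◁ m ≫ μ') :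
        ((α_ X A B).hom ≫ X ◁ μ) ≫ (f ⊗ₘ wm) ≫ 𝟙 (X ⊗ E') =
          (X ⊗ A) ◁ m ≫ (α_ X A B').hom ≫ X ◁ μ' := by
      rw [hf, id_tensorHom, Category.comp_id, Category.assoc,
        ← MonoidalCategory.whiskerLeft_comp, h]
      simp
    exact key (F.map_id a) ih

theorem Insertion.eval_append (F : C ⥤ D) {b : C} (ds : List C) {bs cs : List C}
    (i : Insertion b bs cs) : F.obj b ◁ (listTensorAppend F bs ds).hom ≫ (i.append ds).eval F =
      (α_ _ _ _).inv ≫ i.eval F ▷ listTensor F ds ≫ (listTensorAppend F cs ds).hom := by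
  induction i with
  | here bs =>
    have key {X A B E : D} (μ : A ⊗ B ⟶ E) : X ◁ μ ≫ 𝟙 (X ⊗ E) =
        (α_ X A B).inv ≫ 𝟙 (X ⊗ A) ▷ B ≫ (α_ X A B).hom ≫ X ◁ μ := by simp
    exact key _
  | there c i ih =>
    have key {X Y A A' B E E' : D} {μ : A ⊗ B ⟶ E} {μ' : A' ⊗ B ⟶ E'} {i : X ⊗ A ⟶ A'}
        {i' : X ⊗ E ⟶ E'} (h : X ◁ μ ≫ i' = (α_ X A B).inv ≫ i ▷ B ≫ μ') :
        X ◁ ((α_ Y A B).hom ≫ Y ◁ μ) ≫ exchangeFactors X Y E ≫ Y ◁ i' =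
          (α_ X (Y ⊗ A) B).inv ≫ (exchangeFactors X Y A ≫ Y ◁ i) ▷ B ≫
            (α_ Y A' B).hom ≫ Y ◁ μ' := by
      rw [MonoidalCategory.whiskerLeft_comp, Category.assoc,
        reassoc_of% exchangeFactors_whisker X Y μ, ← MonoidalCategory.whiskerLeft_comp, h]
      simp only [exchangeFactors]
      monoidal
    exact key ih

theorem Matching.eval_whiskerRight (F : C ⥤ D) (cs : List C) {as bs : List C}
    (m : Matching as bs) : (listTensorAppend F as cs).hom ≫ (m.whiskerRight cs).eval F =
      m.eval F ▷ listTensor F cs ≫ (listTensorAppend F bs cs).hom := by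
  induction m with
  | nil =>
    have key {X : D} {f : X ⟶ X} (hf : f = 𝟙 X) :
        (λ_ X).hom ≫ f = 𝟙 (𝟙_ D) ▷ X ≫ (λ_ X).hom := by simp [hf]
    exact key (eval_id F cs)
  | cons f m i ih =>
    have key {X X' A A' A'' B E E' E'' : D} {f : X ⟶ X'} {m : A ⟶ A'} {μ : A ⊗ B ⟶ E}
        {μ' : A' ⊗ B ⟶ E'} {m' : E ⟶ E'} {i : X' ⊗ A' ⟶ A''} {i' : X' ⊗ E' ⟶ E''}
        {μ'' : A'' ⊗ B ⟶ E''} (h : μ ≫ m' = m ▷ B ≫ μ')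
        (h' : X' ◁ μ' ≫ i' = (α_ X' A' B).inv ≫ i ▷ B ≫ μ'') :
        ((α_ X A B).hom ≫ X ◁ μ) ≫ (f ⊗ₘ m') ≫ i' = ((f ⊗ₘ m) ≫ i) ▷ B ≫ μ'' := by
      have h₁ : X ◁ μ ≫ (f ⊗ₘ m') = (f ⊗ₘ m ▷ B) ≫ X' ◁ μ' := by
        simp only [← id_tensorHom, tensorHom_comp_tensorHom, Category.id_comp, Category.comp_id, h]
      rw [Category.assoc, reassoc_of% h₁, h', ← tensorHom_id, associator_inv_naturality_assoc]
      simp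
    exact key ih (Insertion.eval_append F cs i)

theorem Insertion.eval_after (F : C ⥤ D) (b : C) (as bs : List C) :
    F.obj b ◁ (listTensorAppend F bs as).hom ≫ (Insertion.after b as bs).eval F =
      exchangeFactors _ _ _ ≫ (listTensorAppend F bs (b :: as)).hom := by
  induction bs with
  | nil =>
    have key {X A : D} : X ◁ (λ_ A).hom ≫ 𝟙 (X ⊗ A) =
        exchangeFactors X (𝟙_ D) A ≫ (λ_ (X ⊗ A)).hom := by
      simp [exchangeFactors]
    exact key
  | cons c bs ih =>
    have key {X Y A B E E' : D} {μ : B ⊗ A ⟶ E} {i : X ⊗ E ⟶ E'} {μ' : B ⊗ X ⊗ A ⟶ E'}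
        (h : X ◁ μ ≫ i = exchangeFactors X B A ≫ μ') :
        X ◁ ((α_ Y B A).hom ≫ Y ◁ μ) ≫ exchangeFactors X Y E ≫ Y ◁ i =
          exchangeFactors X (Y ⊗ B) A ≫ (α_ Y B (X ⊗ A)).hom ≫ Y ◁ μ' := by
      rw [MonoidalCategory.whiskerLeft_comp, Category.assoc,
        reassoc_of% exchangeFactors_whisker X Y μ, ← MonoidalCategory.whiskerLeft_comp, h]
      simp only [exchangeFactors, BraidedCategory.braiding_tensor_right_hom]
      monoidal
    exact key ih

theorem Matching.eval_appendNil (F : C ⥤ D) (as : List C) :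
    (appendNil as).eval F = (ρ_ _).inv ≫ (listTensorAppend F as []).hom := by
  induction as with
  | nil => exact (by rw [unitors_equal, Iso.inv_hom_id] :
      𝟙 (𝟙_ D) = (ρ_ (𝟙_ D)).inv ≫ (λ_ (𝟙_ D)).hom)
  | cons a as ih =>
    have key {X A E : D} {f : X ⟶ X} {μ : A ⊗ 𝟙_ D ⟶ E} {m : A ⟶ E} (hf : f = 𝟙 X)
        (h : m = (ρ_ A).inv ≫ μ) :
        (f ⊗ₘ m) ≫ 𝟙 (X ⊗ E) = (ρ_ (X ⊗ A)).inv ≫ (α_ X A (𝟙_ D)).hom ≫ X ◁ μ := by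
      simp [hf, h]
    exact key (F.map_id a) ih

theorem Matching.eval_swap (F : C ⥤ D) (as bs : List C) :
    (listTensorAppend F as bs).hom ≫ (swap as bs).eval F =
      (β_ _ _).hom ≫ (listTensorAppend F bs as).hom := by
  induction as with
  | nil =>
    refine (congrArg _ (eval_appendNil F bs)).trans ?_
    have key {X E : D} (μ : X ⊗ 𝟙_ D ⟶ E) :
        (λ_ X).hom ≫ (ρ_ X).inv ≫ μ = (β_ (𝟙_ D) X).hom ≫ μ := by
      rw [braiding_tensorUnit_left, Category.assoc]
    exact key _
  | cons a as ih =>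
    have key {X A B E E' E'' : D} {f : X ⟶ X} {μ : A ⊗ B ⟶ E} {μ' : B ⊗ A ⟶ E'} {s : E ⟶ E'}
        {i : X ⊗ E' ⟶ E''} {μ'' : B ⊗ (X ⊗ A) ⟶ E''} (hf : f = 𝟙 X)
        (h : μ ≫ s = (β_ A B).hom ≫ μ') (h' : X ◁ μ' ≫ i = exchangeFactors X B A ≫ μ'') :
        ((α_ X A B).hom ≫ X ◁ μ) ≫ (f ⊗ₘ s) ≫ i = (β_ (X ⊗ A) B).hom ≫ μ'' := by
      rw [hf, id_tensorHom, Category.assoc, ← MonoidalCategory.whiskerLeft_comp_assoc, h,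
        MonoidalCategory.whiskerLeft_comp, Category.assoc, h',
        BraidedCategory.braiding_tensor_left_hom]
      simp [exchangeFactors]
    exact key (F.map_id a) ih (Insertion.eval_after F a as bs)

end Interpretation

/-! ### Matchings and loop-free morphisms -/

section
variable {C : Type u} [Category.{v} C] {D : Type u₁} [Category.{v₁} D] [MonoidalCategory D]
  [SymmetricCategory D]

instance (X Y Z : D) : IsIso (exchangeFactors X Y Z) :=
  ⟨exchangeFactors Y X Z, exchangeFactors_exchangeFactors X Y Z,
    exchangeFactors_exchangeFactors Y X Z⟩

instance Insertion.isIso_eval (F : C ⥤ D) {b : C} {bs cs : List C} (i : Insertion b bs cs) :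
    IsIso (i.eval F) := by
  induction i with
  | here => exact inferInstanceAs (IsIso (𝟙 _))
  | there c i ih => exact inferInstanceAs (IsIso (exchangeFactors _ _ _ ≫ F.obj c ◁ i.eval F))

end

namespace FreeTraced
variable {C : Type u} [Category.{v} C]

/-- A list of objects, as an object of the free traced category. -/
abbrev ofList (as : List C) : FreeTraced C := listTensor (of C) as

/-- An isomorphism has no loops, since a sum of multisets is empty only if both are. -/
theorem loops_of_isIso {A B : FreeTraced C} (f : A ⟶ B) [IsIso f] : Hom.loops f = 0 := by
  have := congrArg Hom.loops (IsIso.hom_inv_id f)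
  rw [comp_loops, id_loops] at this
  exact (add_eq_zero.1 this).1

theorem isRelabel_whiskerLeft (A : FreeTraced C) {B B' : FreeTraced C} {f : B ⟶ B'}
    (hf : IsRelabel f) : IsRelabel (A ◁ f) := (isRelabel_id A).tensor hf

theorem isRelabel_whiskerRight (A : FreeTraced C) {B B' : FreeTraced C} {f : B ⟶ B'}
    (hf : IsRelabel f) : IsRelabel (f ▷ A) := hf.tensor (isRelabel_id A)

theorem isRelabel_braiding (A B : FreeTraced C) : IsRelabel (β_ A B).hom := isRelabel_swap A B

theorem isRelabel_exchangeFactors (A B D : FreeTraced C) : IsRelabel (exchangeFactors A B D) :=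
  (isRelabel_associator_inv A B D).comp
    ((isRelabel_whiskerRight D (isRelabel_braiding A B)).comp (isRelabel_associator_hom B A D))

theorem isRelabel_eval {b : C} {bs cs : List C} (i : Insertion b bs cs) :
    IsRelabel (i.eval (of C)) := by
  induction i with
  | here => exact isRelabel_id _
  | there _ _ ih => exact (isRelabel_exchangeFactors _ _ _).comp (isRelabel_whiskerLeft _ ih)

theorem loops_eval {as bs : List C} (m : Matching as bs) : Hom.loops (m.eval (of C)) = 0 := by
  induction m with
  | nil => rfl
  | cons f m i ih =>
    change 0 + Hom.loops (m.eval (of C)) + Hom.loops (i.eval (of C)) = 0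
    rw [ih, (isRelabel_eval i).loops]
    rfl

/-- The only position of a list of length one. -/
def onlyPos (a : C) : Fin ((of C).obj a).len := (0 : Fin 1)

/-- The first position of a list. -/
def headPos (a : C) (A : FreeTraced C) : Fin ((of C).obj a ⊗ A).len :=
  inL ((of C).obj a) A (onlyPos a)

theorem cases_headPos {a : C} {A : FreeTraced C} {P : Fin ((of C).obj a ⊗ A).len → Prop}
    (h₀ : P (headPos a A)) (h : ∀ i, P (inR ((of C).obj a) A i)) : ∀ x, P x :=
  append_cases (fun i => by
    obtain rfl : i = onlyPos a := Subsingleton.elim (α := Fin 1) i _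
    exact h₀) h

theorem inR_ne_headPos {a : C} {A : FreeTraced C} (i : Fin A.len) :
    inR ((of C).obj a) A i ≠ headPos a A := by
  intro h
  have h' : 1 + (i : ℕ) = 0 := congrArg (fun j : Fin ((of C).obj a ⊗ A).len => (j : ℕ)) h
  omega

theorem inR_injective {C : Type u} (A B : FreeTraced C) : Function.Injective (inR A B) :=
  Fin.natAdd_injective _ _

/-- The exchange of two generators moves the first position to the second one. -/
theorem perm_exchangeFactors_headPos (a b : C) (A : FreeTraced C) :
    Hom.perm (exchangeFactors ((of C).obj a) ((of C).obj b) A) (headPos a _) =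
      inR ((of C).obj b) _ (headPos a A) := by
  set X := (of C).obj a
  set Y := (of C).obj b
  have e₁ : Hom.perm (α_ X Y A).inv (headPos a (Y ⊗ A)) = inL (X ⊗ Y) A (inL X Y (onlyPos a)) :=
    assoc_symm_perm_L X Y A (onlyPos a)
  have e₂ : Hom.perm ((β_ X Y).hom ▷ A) (inL (X ⊗ Y) A (inL X Y (onlyPos a))) =
      inL (Y ⊗ X) A (inR Y X (onlyPos a)) :=
    (tensor_perm_inL _ _ _).trans (congrArg (inL (Y ⊗ X) A) (swap_perm_inL X Y (onlyPos a)))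
  change Hom.perm (α_ Y X A).hom (Hom.perm ((β_ X Y).hom ▷ A) (Hom.perm (α_ X Y A).inv _)) = _
  rw [e₁, e₂]
  exact assoc_perm_LR Y X A (onlyPos a)

theorem perm_eval_there (c : C) {b : C} {bs cs : List C} (i : Insertion b bs cs) :
    Hom.perm ((Insertion.there c i).eval (of C)) (headPos b _) =
      inR ((of C).obj c) (ofList cs) (Hom.perm (i.eval (of C)) (headPos b _)) := by
  change Hom.perm ((of C).obj c ◁ i.eval (of C)) (Hom.perm
    (exchangeFactors ((of C).obj b) ((of C).obj c) (ofList bs)) (headPos b _)) = _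
  rw [perm_exchangeFactors_headPos]
  exact tensor_perm_inR _ _ _

/-- Every position of a list is that of an insertion. -/
theorem exists_insertion (cs : List C) (j : Fin (ofList cs).len) :
    ∃ (b : C) (bs : List C) (i : Insertion b bs cs),
      Hom.perm (i.eval (of C)) (headPos b _) = j := by
  induction cs with
  | nil => exact j.elim0
  | cons c cs ih =>
    revert j
    refine cases_headPos ⟨c, cs, .here cs, rfl⟩ fun j => ?_
    obtain ⟨b, bs, i, rfl⟩ := ih j
    exact ⟨b, c :: bs, .there c i, perm_eval_there c i⟩

/-- An insertion is determined by the position that it inserts. -/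
theorem insertion_ext {cs : List C} {b b' : C} {bs bs' : List C} (i : Insertion b bs cs)
    (i' : Insertion b' bs' cs) (h : Hom.perm (i.eval (of C)) (headPos b _) =
      Hom.perm (i'.eval (of C)) (headPos b' _)) :
    (⟨b, bs, i⟩ : Σ (b : C) (bs : List C), Insertion b bs cs) = ⟨b', bs', i'⟩ := by
  induction i generalizing b' bs' with
  | here bs =>
    cases i' with
    | here => rfl
    | there _ i' => exact absurd (h.trans (perm_eval_there _ i')).symm (inR_ne_headPos _)
  | there c i ih =>
    cases i' with
    | here => exact absurd ((perm_eval_there c i).symm.trans h) (inR_ne_headPos _)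
    | there c i' =>
      have := ih i' (inR_injective _ _
        ((perm_eval_there c i).symm.trans (h.trans (perm_eval_there c i'))))
      cases this
      rfl

/-- A morphism that preserves the first position splits off the label of that position. -/
theorem exists_eq_tensor {a b : C} {A B : FreeTraced C}
    (h : (of C).obj a ⊗ A ⟶ (of C).obj b ⊗ B) (h₀ : Hom.perm h (headPos a A) = headPos b B) :
    ∃ (g : a ⟶ b) (k : A ⟶ B), h = (of C).map g ⊗ₘ k ∧ Hom.loops k = Hom.loops h := by
  have hex (i : Fin A.len) : ∃ j, Hom.perm h (inR _ A i) = inR ((of C).obj b) B j := by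
    generalize hy : Hom.perm h (inR _ A i) = y
    revert hy
    revert y
    refine cases_headPos (fun hy => ?_) fun j _ => ⟨j, rfl⟩
    exact absurd ((Hom.perm h).injective (hy.trans h₀.symm)) (inR_ne_headPos i)
  choose p hp using hex
  have hinj : Function.Injective p := fun i j e => inR_injective _ _
    ((Hom.perm h).injective ((hp i).trans (e ▸ (hp j).symm)))
  have hcard : Fintype.card (Fin A.len) = Fintype.card (Fin B.len) := by
    have : Fintype.card (Fin (1 + A.len)) = Fintype.card (Fin (1 + B.len)) :=
      Fintype.card_congr (Hom.perm h)
    simpa using this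
  let k : A ⟶ B := ⟨Hom.loops h,
    Equiv.ofBijective p ((Fintype.bijective_iff_injective_and_card p).2 ⟨hinj, hcard⟩),
    fun i => eqToHom (obj_inR ((of C).obj a) A i).symm ≫ Hom.arrow h (inR _ A i) ≫
      eqToHom ((congrArg (append ((of C).obj b) B).obj (hp i)).trans (obj_inR _ B _))⟩
  have h₁ : ((of C).obj b ⊗ B).obj (Hom.perm h (headPos a A)) = b :=
    (congrArg (append ((of C).obj b) B).obj h₀).trans (obj_inL _ _ _)
  obtain ⟨g, hg⟩ : ∃ g : a ⟶ b, HEq (Hom.arrow h (headPos a A)) g :=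
    ⟨eqToHom (obj_inL ((of C).obj a) A (onlyPos a)).symm ≫ Hom.arrow h (headPos a A) ≫ eqToHom h₁,
      ((eqToHom_comp_heq' _ _).trans (comp_eqToHom_heq' _ _)).symm⟩
  refine ⟨g, k, hom_ext (zero_add _).symm (cases_headPos ?_ fun i => ?_)
    (cases_headPos ?_ fun i => ?_), rfl⟩
  · exact h₀.trans (tensor_perm_inL ((of C).map g) k (onlyPos a)).symm
  · exact (hp i).trans (tensor_perm_inR ((of C).map g) k i).symm
  · exact hg.trans (tensor_arrow_inL ((of C).map g) k (onlyPos a)).symm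
  · refine HEq.trans ?_ (tensor_arrow_inR ((of C).map g) k i).symm
    exact ((eqToHom_comp_heq' _ _).trans (comp_eqToHom_heq' _ _)).symm

theorem heq_of_segment_eq {X Y X' Y' : C} {f : X ⟶ Y} {f' : X' ⟶ Y'}
    (h : (⟨X, Y, f⟩ : Segment C) = ⟨X', Y', f'⟩) : HEq f f' := by
  cases h; rfl

theorem tensor_injective {a b : C} {A B : FreeTraced C} {g g' : a ⟶ b} {k k' : A ⟶ B}
    (h : (of C).map g ⊗ₘ k = (of C).map g' ⊗ₘ k') : g = g' ∧ k = k' := by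
  have h₀ := (segment_tensor_inL ((of C).map g) k (onlyPos a)).symm.trans
    ((congrArg (segment · _) h).trans (segment_tensor_inL ((of C).map g') k' (onlyPos a)))
  have hR (i) := (segment_tensor_inR ((of C).map g) k i).symm.trans
    ((congrArg (segment · _) h).trans (segment_tensor_inR ((of C).map g') k' i))
  refine ⟨?_, hom_ext ?_ (fun i => ?_) fun i => ?_⟩
  · change (⟨a, b, g⟩ : Segment C) = ⟨a, b, g'⟩ at h₀
    simpa using h₀
  · have : 0 + Hom.loops k = 0 + Hom.loops k' := congrArg Hom.loops h
    simpa using this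
  · refine inR_injective ((of C).obj b) B ?_
    exact (tensor_perm_inR ((of C).map g) k i).symm.trans
      ((congrArg (fun f => Hom.perm f (inR _ A i)) h).trans (tensor_perm_inR ((of C).map g') k' i))
  · exact heq_of_segment_eq (hR i)

/-- A matching is determined by its interpretation in the free traced category. -/
theorem eval_injective {as bs : List C} {m m' : Matching as bs}
    (h : m.eval (of C) = m'.eval (of C)) : m = m' := by
  induction m with
  | nil => cases m'; rfl
  | @cons a b as bs cs f m i ih =>
    cases m' with
    | @cons _ b' _ bs' _ f' m' i' =>
      have h : ((of C).map f ⊗ₘ m.eval (of C)) ≫ i.eval (of C) =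
        ((of C).map f' ⊗ₘ m'.eval (of C)) ≫ i'.eval (of C) := h
      have e : Hom.perm (i.eval (of C)) (headPos b _) =
          Hom.perm (i'.eval (of C)) (headPos b' _) := by
        have e₁ : Hom.perm ((of C).map f ⊗ₘ m.eval (of C)) (headPos a _) = headPos b _ :=
          tensor_perm_inL _ _ _
        have e₂ : Hom.perm ((of C).map f' ⊗ₘ m'.eval (of C)) (headPos a _) = headPos b' _ :=
          tensor_perm_inL _ _ _
        rw [← e₁, ← e₂]
        exact congrArg (fun k => Hom.perm k (headPos a _)) h
      cases insertion_ext i i' e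
      obtain ⟨rfl, h'⟩ := tensor_injective ((cancel_mono _).1 h)
      rw [ih h']

/-- Every loop-free morphism between lists is the interpretation of a matching: removing the first
position and the position matched with it reduces the claim to shorter lists. -/
theorem exists_eval_eq {as bs : List C} (f : ofList as ⟶ ofList bs) (hf : Hom.loops f = 0) :
    ∃ m : Matching as bs, m.eval (of C) = f := by
  induction as generalizing bs with
  | nil =>
    cases bs with
    | nil => exact ⟨.nil, hom_ext hf.symm (fun i => i.elim0) fun i => i.elim0⟩
    | cons b bs => exact ((Hom.perm f).symm (headPos b _)).elim0
  | cons a as ih =>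
    obtain ⟨b, cs, i, hi⟩ := exists_insertion bs (Hom.perm f (headPos a _))
    obtain ⟨g, k, hk, hl⟩ := exists_eq_tensor (A := ofList as)
      ((f : (of C).obj a ⊗ ofList as ⟶ ofList bs) ≫ inv (i.eval (of C))) (by
      change Hom.perm (inv (i.eval (of C))) (Hom.perm f (headPos a _)) = _
      rw [← hi]
      exact perm_hom_inv (asIso (i.eval (of C))) _)
    replace hl : Hom.loops k = Hom.loops f + Hom.loops (inv (i.eval (of C))) := hl
    rw [hf, loops_of_isIso (inv (i.eval (of C))), add_zero] at hl
    obtain ⟨m, rfl⟩ := ih k hl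
    exact ⟨.cons g m i, ((IsIso.eq_comp_inv _).1 hk.symm)⟩

end FreeTraced

/-! ### Scalars -/

section Scalars
variable {D : Type u} [Category.{v} D] [MonoidalCategory D]

theorem scalarMul_eq (s : End (𝟙_ D)) {X Y : D} (f : X ⟶ Y) :
    scalarMul s f = scalarMul s (𝟙 X) ≫ f := by
  simp [scalarMul]

theorem scalarMul_comp (s : End (𝟙_ D)) {X Y Z : D} (f : X ⟶ Y) (g : Y ⟶ Z) :
    scalarMul s f ≫ g = scalarMul s (f ≫ g) := by
  simp [scalarMul]

theorem comp_scalarMul (s : End (𝟙_ D)) {X Y Z : D} (f : X ⟶ Y) (g : Y ⟶ Z) :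
    f ≫ scalarMul s g = scalarMul s (f ≫ g) := by
  simp only [scalarMul]
  rw [leftUnitor_inv_naturality_assoc, whisker_exchange_assoc, leftUnitor_naturality_assoc]

theorem one_scalarMul {X Y : D} (f : X ⟶ Y) : scalarMul (1 : End (𝟙_ D)) f = f := by
  have : (1 : End (𝟙_ D)) = 𝟙 (𝟙_ D) := rfl
  simp [scalarMul, this]

theorem mul_scalarMul (s t : End (𝟙_ D)) {X Y : D} (f : X ⟶ Y) :
    scalarMul (s * t) f = scalarMul t (scalarMul s f) := by
  rw [End.mul_def]
  simp [scalarMul]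

theorem scalarMul_one (s : End (𝟙_ D)) : scalarMul s (𝟙 (𝟙_ D)) = (s : 𝟙_ D ⟶ 𝟙_ D) := by
  simp only [scalarMul, Category.comp_id]
  rw [unitors_equal, rightUnitor_naturality, ← unitors_equal, Iso.inv_hom_id_assoc]

theorem scalar_mul_comm (s t : End (𝟙_ D)) : s * t = t * s := by
  have h := comp_scalarMul s t (𝟙 (𝟙_ D))
  have h' := scalarMul_comp s (𝟙 (𝟙_ D)) t
  rw [scalarMul_one, Category.comp_id] at h
  rw [scalarMul_one, Category.id_comp] at h'
  exact h.trans h'.symm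

/-- The scalars of a monoidal category commute. This is not a global instance: products of scalars
are formed in the monoid of endomorphisms. -/
abbrev scalarCommMonoid : CommMonoid (End (𝟙_ D)) where
  mul_comm := scalar_mul_comm

theorem scalarMul_tensor (s : End (𝟙_ D)) {X Y X' Y' : D} (f : X ⟶ Y) (g : X' ⟶ Y') :
    scalarMul s f ⊗ₘ g = scalarMul s (f ⊗ₘ g) := by
  have h : scalarMul s (𝟙 X) ▷ X' = scalarMul s (𝟙 (X ⊗ X')) := by
    simp [scalarMul]
  rw [scalarMul_eq s f, ← Category.id_comp g, ← tensorHom_comp_tensorHom, tensorHom_id, h,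
    Category.id_comp, ← scalarMul_eq]

variable [SymmetricCategory D]

theorem tensor_scalarMul (s : End (𝟙_ D)) {X Y X' Y' : D} (f : X ⟶ Y) (g : X' ⟶ Y') :
    f ⊗ₘ scalarMul s g = scalarMul s (f ⊗ₘ g) := by
  have h : (f ⊗ₘ scalarMul s g) ≫ (β_ Y Y').hom = scalarMul s (f ⊗ₘ g) ≫ (β_ Y Y').hom := by
    rw [BraidedCategory.braiding_naturality, scalarMul_tensor, comp_scalarMul, scalarMul_comp,
      BraidedCategory.braiding_naturality]
  exact (cancel_mono _).1 h

/-- Tensoring with a scalar on the right is the same as multiplication by it. -/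
theorem rightUnitor_conj_scalar (s : End (𝟙_ D)) {X Y : D} (f : X ⟶ Y) :
    (ρ_ X).inv ≫ (f ⊗ₘ (s : 𝟙_ D ⟶ 𝟙_ D)) ≫ (ρ_ Y).hom = scalarMul s f := by
  have h := tensor_scalarMul s f (𝟙 (𝟙_ D))
  rw [scalarMul_one] at h
  rw [h, scalarMul_comp, comp_scalarMul]
  simp

variable [TracedCategory D]

theorem trace_scalarMul (s : End (𝟙_ D)) {A B : D} (U : D) (f : A ⊗ U ⟶ B ⊗ U) :
    TracedCategory.trace U (scalarMul s f) = scalarMul s (TracedCategory.trace U f) := by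
  rw [scalarMul_eq s (TracedCategory.trace U f), TracedCategory.input_naturality, ← tensorHom_id,
    scalarMul_tensor, scalarMul_comp, id_tensorHom_id, Category.id_comp]

/-- A scalar of the form `traceOut s` depends only on the loop of `s`, by dinaturality. -/
theorem traceOut_comp_comm {X Y : D} (f : X ⟶ Y) (g : Y ⟶ X) :
    traceOut (f ≫ g) = traceOut (g ≫ f) := by
  have h := TracedCategory.feedback_dinaturality (A := 𝟙_ D) (B := 𝟙_ D)
    ((λ_ Y).hom ≫ g ≫ (λ_ X).inv) f
  simp only [traceOut]
  rw [leftUnitor_naturality_assoc] at h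
  simp only [Category.assoc] at h ⊢
  rw [← leftUnitor_inv_naturality] at h
  exact h.symm

/-- By superposing, a factor that is only fed back to itself becomes a scalar. -/
theorem trace_tensor_endo {A B X : D} (h : A ⟶ B) (s : X ⟶ X) :
    TracedCategory.trace X (h ⊗ₘ s) = scalarMul (traceOut s) h := by
  have e := TracedCategory.superposing (A := 𝟙_ D) (B := 𝟙_ D) ((λ_ X).hom ≫ s ≫ (λ_ X).inv) h
  rw [← rightUnitor_conj_scalar]
  change _ = _ ≫ (h ⊗ₘ TracedCategory.trace X _) ≫ _
  rw [e, TracedCategory.output_naturality, TracedCategory.input_naturality]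
  congr 1
  have h₁ : h ⊗ₘ s = A ◁ (λ_ X).inv ≫ (h ⊗ₘ (λ_ X).hom ≫ s ≫ (λ_ X).inv) ≫ B ◁ (λ_ X).hom := by
    simp only [← id_tensorHom, tensorHom_comp_tensorHom, Category.id_comp, Category.comp_id,
      Category.assoc, Iso.inv_hom_id, Iso.inv_hom_id_assoc]
  simp [h₁]

/-- The trace along the first factor. -/
def leftTrace {A B : D} (X : D) (h : X ⊗ A ⟶ X ⊗ B) : A ⟶ B :=
  TracedCategory.trace X ((β_ A X).hom ≫ h ≫ (β_ X B).hom)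

theorem leftTrace_scalarMul (s : End (𝟙_ D)) {A B X : D} (h : X ⊗ A ⟶ X ⊗ B) :
    leftTrace X (scalarMul s h) = scalarMul s (leftTrace X h) := by
  rw [leftTrace, scalarMul_comp, comp_scalarMul, trace_scalarMul]; rfl

theorem leftTrace_tensor {A B X : D} (s : X ⟶ X) (h : A ⟶ B) :
    leftTrace X (s ⊗ₘ h) = scalarMul (traceOut s) h := by
  rw [leftTrace, BraidedCategory.braiding_naturality, ← trace_tensor_endo]
  simp

theorem leftTrace_naturality {A A' B B' X : D} (f : A' ⟶ A) (h : X ⊗ A ⟶ X ⊗ B) (g : B ⟶ B') :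
    leftTrace X (X ◁ f ≫ h ≫ X ◁ g) = f ≫ leftTrace X h ≫ g := by
  rw [leftTrace, leftTrace, TracedCategory.output_naturality, TracedCategory.input_naturality]
  congr 1
  simp

/-- Yanking, with a further factor. -/
theorem leftTrace_exchangeFactors (X E : D) :
    leftTrace X (exchangeFactors X X E) = 𝟙 (X ⊗ E) := by
  have h := TracedCategory.superposing (β_ X X).hom (𝟙 E)
  rw [TracedCategory.yanking, id_tensorHom_id] at h
  have h' : (β_ X E).hom ≫ 𝟙 (E ⊗ X) ≫ (β_ E X).hom = 𝟙 (X ⊗ E) := by simp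
  rw [← h', h, TracedCategory.output_naturality, TracedCategory.input_naturality, leftTrace]
  congr 1
  have hyb := BraidedCategory.yang_baxter X E X
  rw [Iso.inv_comp_eq] at hyb
  simp only [BraidedCategory.braiding_tensor_left_hom, BraidedCategory.braiding_tensor_right_hom,
    exchangeFactors, id_tensorHom, Category.assoc]
  rw [← cancel_mono (α_ X E X).hom]
  simp only [Category.assoc, hyb, Iso.inv_hom_id, Category.comp_id, Iso.hom_inv_id_assoc]
  rw [← comp_whiskerRight_assoc, SymmetricCategory.symmetry, id_whiskerRight, Category.id_comp]

end Scalars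

/-! ### Normal forms and their interpretation -/

section NormalForms
variable {C : Type u} [Category.{v} C] {D : Type u₁} [Category.{v₁} D] [MonoidalCategory D]
  [SymmetricCategory D] [TracedCategory D]

/-- The scalar of a loop: the trace of a representing endomorphism. -/
def loopScalar (F : C ⥤ D) : CatLoop C → End (𝟙_ D) :=
  Quot.lift (fun s => traceOut (F.map s.2)) (by
    rintro _ _ ⟨f, g⟩
    simp only [F.map_comp]
    exact traceOut_comp_comm _ _)

attribute [local instance] scalarCommMonoid in
/-- The product of the scalars of a multiset of loops. -/
def loopProd (F : C ⥤ D) (S : Multiset (CatLoop C)) : End (𝟙_ D) := (S.map (loopScalar F)).prod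

theorem loopProd_zero (F : C ⥤ D) : loopProd F 0 = 1 := rfl

theorem loopProd_add (F : C ⥤ D) (S T : Multiset (CatLoop C)) :
    loopProd F (S + T) = loopProd F S * loopProd F T := by
  let _ : CommMonoid (End (𝟙_ D)) := scalarCommMonoid
  rw [loopProd, Multiset.map_add, Multiset.prod_add]; rfl

theorem loopProd_singleton (F : C ⥤ D) {X : C} (s : X ⟶ X) :
    loopProd F {CatLoop.mk s} = traceOut (F.map s) := by
  let _ : CommMonoid (End (𝟙_ D)) := scalarCommMonoid
  rw [loopProd, Multiset.map_singleton, Multiset.prod_singleton]; rfl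

theorem loopProd_coe (F : C ⥤ D) (L : List (Σ X : C, X ⟶ X)) :
    loopProd F (L.map fun s => CatLoop.mk s.2 : List (CatLoop C)) =
      (L.map fun s => traceOut (F.map s.2)).prod := by
  let _ : CommMonoid (End (𝟙_ D)) := scalarCommMonoid
  rw [loopProd, Multiset.map_coe, Multiset.prod_coe, List.map_map]; rfl

/-- A normal form of a morphism between lists of objects: a multiset of loops and a matching. -/
structure NormalForm (as bs : List C) where
  loops : Multiset (CatLoop C)
  matching : Matching as bs

namespace NormalForm

/-- Interpretation of a normal form. -/
def eval (F : C ⥤ D) {as bs : List C} (x : NormalForm as bs) :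
    listTensor F as ⟶ listTensor F bs :=
  scalarMul (loopProd F x.loops) (x.matching.eval F)

/-- The normal form of an identity. -/
protected def id (as : List C) : NormalForm as as := ⟨0, .id as⟩

/-- The normal form of a composite. -/
def comp {as bs cs : List C} (x : NormalForm as bs) (y : NormalForm bs cs) : NormalForm as cs :=
  ⟨x.loops + y.loops, x.matching.comp y.matching⟩

/-- The normal form of a tensor product: first the left factor, then the right one. -/
def tensor {as bs as' bs' : List C} (x : NormalForm as bs) (y : NormalForm as' bs') :
    NormalForm (as ++ as') (bs ++ bs') :=
  ⟨x.loops + y.loops, (x.matching.whiskerRight as').comp (y.matching.whiskerLeft bs)⟩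

/-- The normal form of a symmetry. -/
def swap (as bs : List C) : NormalForm (as ++ bs) (bs ++ as) := ⟨0, .swap as bs⟩

/-- The trace along the first object: if the first position is matched with itself, it becomes a
loop, and otherwise the two labels at this position are composed. -/
def traceHead {a : C} {as bs : List C} : NormalForm (a :: as) (a :: bs) → NormalForm as bs
  | ⟨S, .cons g m (.here _)⟩ => ⟨S + {CatLoop.mk g}, m⟩
  | ⟨S, .cons g m (.there _ i)⟩ => ⟨S, m.comp (.cons g (.id _) i)⟩

variable (F : C ⥤ D)

theorem eval_id (as : List C) : (NormalForm.id as).eval F = 𝟙 _ := by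
  rw [eval, NormalForm.id, Matching.eval_id, loopProd_zero, one_scalarMul]

theorem eval_comp {as bs cs : List C} (x : NormalForm as bs) (y : NormalForm bs cs) :
    (x.comp y).eval F = x.eval F ≫ y.eval F := by
  simp only [eval, comp, Matching.eval_comp, loopProd_add]
  rw [scalarMul_comp, comp_scalarMul, scalar_mul_comm, mul_scalarMul]

theorem eval_tensor {as bs as' bs' : List C} (x : NormalForm as bs) (y : NormalForm as' bs') :
    (listTensorAppend F as as').hom ≫ (x.tensor y).eval F =
      (x.eval F ⊗ₘ y.eval F) ≫ (listTensorAppend F bs bs').hom := by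
  simp only [eval, tensor, Matching.eval_comp, loopProd_add]
  rw [scalarMul_tensor, tensor_scalarMul, ← mul_scalarMul, scalarMul_comp, comp_scalarMul,
    ← Category.assoc, Matching.eval_whiskerRight, Category.assoc, Matching.eval_whiskerLeft,
    scalar_mul_comm, MonoidalCategory.tensorHom_def, Category.assoc]

theorem eval_swap (as bs : List C) :
    (listTensorAppend F as bs).hom ≫ (swap as bs).eval F =
      (β_ _ _).hom ≫ (listTensorAppend F bs as).hom := by
  rw [eval, swap, loopProd_zero, one_scalarMul, Matching.eval_swap]

/-- The trace along one object is computed on normal forms alike in every traced category: a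
self-match of the object becomes a scalar by superposing, and any other match is undone by
yanking. -/
theorem eval_traceHead {a : C} {as bs : List C} (x : NormalForm (a :: as) (a :: bs)) :
    x.traceHead.eval F = leftTrace (F.obj a) (x.eval F) := by
  obtain ⟨S, m⟩ := x
  refine Eq.trans ?_ (leftTrace_scalarMul (loopProd F S) (m.eval F)).symm
  cases m with
  | cons g m i =>
    cases i with
    | here =>
      -- The head is matched with itself.
      have e : leftTrace (F.obj a) ((F.map g ⊗ₘ m.eval F) ≫ 𝟙 _) =
          scalarMul (loopProd F {CatLoop.mk g}) (m.eval F) := by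
        rw [Category.comp_id, leftTrace_tensor, loopProd_singleton]
      refine Eq.trans ?_ (congrArg _ e.symm)
      rw [← mul_scalarMul, scalar_mul_comm, ← loopProd_add]
      rfl
    | there _ i =>
      -- The head is matched with an element further on.
      refine congrArg (scalarMul (loopProd F S)) ?_
      refine (Matching.eval_comp F _ _).trans ?_
      have key {X Y A E B : D} (g : X ⟶ Y) (m : A ⟶ X ⊗ E) (i : Y ⊗ E ⟶ B) {e : E ⟶ E}
          (he : e = 𝟙 E) : m ≫ (g ⊗ₘ e) ≫ i =
            leftTrace X ((g ⊗ₘ m) ≫ exchangeFactors Y X E ≫ X ◁ i) := by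
        have h : (g ⊗ₘ m) ≫ exchangeFactors Y X E ≫ X ◁ i =
            X ◁ m ≫ exchangeFactors X X E ≫ X ◁ ((g ⊗ₘ 𝟙 E) ≫ i) := by
          have h₁ := exchangeFactors_naturality g (𝟙 X) (𝟙 E)
          have h₂ : g ⊗ₘ m = X ◁ m ≫ (g ⊗ₘ 𝟙 X ⊗ₘ 𝟙 E) := by
            rw [id_tensorHom_id, ← id_tensorHom, tensorHom_comp_tensorHom, Category.id_comp,
              Category.comp_id]
          rw [h₂, Category.assoc, reassoc_of% h₁, MonoidalCategory.whiskerLeft_comp,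
            id_tensorHom X (g ⊗ₘ 𝟙 E)]
        rw [h, leftTrace_naturality, leftTrace_exchangeFactors, Category.id_comp, he]
      exact key (F.map g) (m.eval F) (i.eval F) (Matching.eval_id F _)

end NormalForm
end NormalForms

namespace FreeTraced
variable {C : Type u} [Category.{v} C]

/-! ### Normal forms of the morphisms of the free traced category -/

/-- Multiplication by a scalar adds its loops. -/
theorem scalarMul_eq_homMk {A B : FreeTraced C} (s : End (𝟙_ (FreeTraced C))) (f : A ⟶ B) :
    scalarMul s f = homMk (Hom.loops (s : 𝟙_ (FreeTraced C) ⟶ 𝟙_ (FreeTraced C)) + Hom.loops f)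
      (Hom.perm f) (Hom.arrow f) := by
  have key : (s : 𝟙_ (FreeTraced C) ⟶ 𝟙_ (FreeTraced C)) ▷ A ≫ (λ_ A).hom = (λ_ A).hom ≫
      homMk (Hom.loops (s : 𝟙_ (FreeTraced C) ⟶ 𝟙_ (FreeTraced C))) (Equiv.refl _)
        (fun i => 𝟙 (A.obj i)) := by
    refine square (isRelabel_eqToHom (empty_append A)) (isRelabel_eqToHom (empty_append A))
      (add_zero _) (fun i => ?_) fun i => ?_
    · induction i using append_cases with
      | hl i => exact i.elim0
      | hr i => exact congrArg _ (tensor_perm_inR s (𝟙 A) i)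
    · induction i using append_cases with
      | hl i => exact i.elim0
      | hr i =>
        refine (tensor_arrow_inR s (𝟙 A) i).trans ?_
        exact congr_arg_heq (fun j => 𝟙 (A.obj j)) (empty_perm_R A i).symm
  rw [scalarMul_eq, scalarMul, Category.comp_id, key, Iso.inv_hom_id_assoc]
  refine hom_ext rfl (fun _ => rfl) fun i => ?_
  rw [comp_arrow]
  exact heq_of_eq (Category.id_comp _)

/-- Tracing out an endomorphism of `C` yields exactly its loop. -/
theorem loops_traceOut {X : C} (s : X ⟶ X) :
    Hom.loops (traceOut ((of C).map s) : 𝟙_ (FreeTraced C) ⟶ 𝟙_ (FreeTraced C)) =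
      {CatLoop.mk s} := by
  set f : 𝟙_ (FreeTraced C) ⊗ (of C).obj X ⟶ 𝟙_ (FreeTraced C) ⊗ (of C).obj X :=
    (λ_ _).hom ≫ (of C).map s ≫ (λ_ _).inv with hf
  have h := isTraceOf_traceHom f
  change Hom.loops (traceHom _ f) = _
  have e : f = 𝟙 (𝟙_ (FreeTraced C)) ⊗ₘ (of C).map s := by
    rw [hf, id_tensorHom, id_whiskerLeft]
  have h₀ : Hom.loops f = 0 := by
    rw [e]; exact add_zero _
  have hp : Hom.perm f (inR _ _ (onlyPos X)) = position (Sum.inr (onlyPos X)) := by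
    rw [e]; exact tensor_perm_inR _ _ _
  have hs : segment f (inR _ _ (onlyPos X)) = ⟨X, X, s⟩ := by
    rw [e]; exact segment_tensor_inR _ _ _
  obtain ⟨s', hs', e'⟩ := hs ▸ SegmentRun.single (x := Sum.inr (onlyPos X)) hp
  rw [h.loops, h₀, zero_add, feedbackLoops_eq_sum]
  refine (Fin.sum_univ_one _).trans ?_
  have hl : IsRankedLoop (splitPerm f) (splitArrow f) Fin.val (onlyPos X) s' :=
    ⟨[], hs', fun _ h => absurd h List.not_mem_nil⟩
  exact hl.loopAt.trans (congrArg _ (loopMk_segment e').symm)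

theorem loops_loopProd (S : Multiset (CatLoop C)) :
    Hom.loops (loopProd (of C) S : 𝟙_ (FreeTraced C) ⟶ 𝟙_ (FreeTraced C)) = S := by
  induction S using Multiset.induction with
  | empty => rfl
  | cons a S ih =>
    obtain ⟨X, s, rfl⟩ : ∃ (X : C) (s : X ⟶ X), a = CatLoop.mk s := by
      obtain ⟨⟨X, s⟩, rfl⟩ := Quot.exists_rep a
      exact ⟨X, s, rfl⟩
    rw [← Multiset.singleton_add, loopProd_add]
    change Hom.loops (loopProd (of C) S : 𝟙_ (FreeTraced C) ⟶ 𝟙_ (FreeTraced C)) +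
      Hom.loops (loopProd (of C) {CatLoop.mk s} : 𝟙_ (FreeTraced C) ⟶ 𝟙_ (FreeTraced C)) = _
    rw [ih, loopProd_singleton, loops_traceOut, add_comm]

theorem normalForm_eval_eq {as bs : List C} (x : NormalForm as bs) :
    x.eval (of C) = homMk x.loops (Hom.perm (x.matching.eval (of C)))
      (Hom.arrow (x.matching.eval (of C))) := by
  rw [NormalForm.eval, scalarMul_eq_homMk, loops_loopProd, loops_eval, add_zero]

/-- Normal forms are unique and exist: the loops and the loop-free part of a morphism determine the
two components. -/
theorem normalForm_bijective (as bs : List C) :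
    Function.Bijective fun x : NormalForm as bs => x.eval (of C) := by
  constructor
  · rintro ⟨S, m⟩ ⟨S', m'⟩ h
    simp only [normalForm_eval_eq] at h
    obtain ⟨rfl, h₁, h₂⟩ := Hom.mk.inj h
    rw [eval_injective (m := m) (m' := m')
      (Hom.ext ((loops_eval _).trans (loops_eval _).symm) h₁ h₂)]
  · intro f
    obtain ⟨m, hm⟩ := exists_eval_eq (homMk 0 (Hom.perm f) (Hom.arrow f)) rfl
    refine ⟨⟨Hom.loops f, m⟩, ?_⟩
    refine (normalForm_eval_eq _).trans ?_
    change homMk (Hom.loops f) (Hom.perm (m.eval (of C))) (Hom.arrow (m.eval (of C))) = f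
    rw [hm]
    rfl

/-- The normal form of a morphism between lists of generators. -/
noncomputable def normalForm {as bs : List C} (f : ofList as ⟶ ofList bs) : NormalForm as bs :=
  (Equiv.ofBijective _ (normalForm_bijective as bs)).symm f

theorem eval_normalForm {as bs : List C} (f : ofList as ⟶ ofList bs) :
    (normalForm f).eval (of C) = f :=
  (Equiv.ofBijective _ (normalForm_bijective as bs)).apply_symm_apply f

theorem normalForm_eq {as bs : List C} {f : ofList as ⟶ ofList bs} {x : NormalForm as bs}
    (h : x.eval (of C) = f) : normalForm f = x :=
  (normalForm_bijective as bs).1 ((eval_normalForm f).trans h.symm)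

/-- The list of objects underlying an object. -/
def toList (A : FreeTraced C) : List C := List.ofFn A.obj

theorem toList_append (A B : FreeTraced C) : toList (A ⊗ B) = toList A ++ toList B := by
  rw [toList, toList, toList, ← List.ofFn_fin_append]
  refine congrArg List.ofFn (funext fun i => ?_)
  induction i using append_cases with
  | hl i => exact (obj_inL A B i).trans (Fin.append_left _ _ i).symm
  | hr i => exact (obj_inR A B i).trans (Fin.append_right _ _ i).symm

theorem toList_ofList (as : List C) : toList (ofList as) = as := by
  induction as with
  | nil => rfl
  | cons a as ih =>
    refine (toList_append _ _).trans ?_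
    rw [ih]
    rfl

theorem toList_injective {C : Type u} {A B : FreeTraced C} (h : toList A = toList B) : A = B := by
  obtain ⟨n, A⟩ := A
  obtain ⟨m, B⟩ := B
  have h' := List.ofFn_inj'.1 h
  cases h'
  rfl

theorem ofList_toList (A : FreeTraced C) : ofList (toList A) = A :=
  toList_injective (toList_ofList _)

theorem exists_ofList (A : FreeTraced C) : ∃ as, ofList as = A := ⟨_, ofList_toList A⟩

end FreeTraced

/-! ### Heterogeneous equality of morphisms in strict monoidal categories -/

section Transport
variable {D : Type u} [Category.{v} D]

theorem comp_heq_comp {X Y Z X' Y' Z' : D} {f : X ⟶ Y} {g : Y ⟶ Z} {f' : X' ⟶ Y'} {g' : Y' ⟶ Z'}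
    (hX : X = X') (hY : Y = Y') (hZ : Z = Z') (hf : HEq f f') (hg : HEq g g') :
    HEq (f ≫ g) (f' ≫ g') := by
  subst hX hY hZ hf hg; rfl

theorem id_heq_id {X Y : D} (h : X = Y) : HEq (𝟙 X) (𝟙 Y) := by subst h; rfl

/-- A commutative square with equalities on two opposite sides identifies the other two sides. -/
theorem heq_of_eqToHom_square {X X' Y Y' : D} {f : X ⟶ Y} {f' : X' ⟶ Y'} (hX : X' = X)
    (hY : Y' = Y) (h : eqToHom hX ≫ f = f' ≫ eqToHom hY) : HEq f f' := by
  subst hX hY; simpa using h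

theorem eqToHom_conj_heq {X X' Y Y' : D} (f : X ⟶ Y) (hX : X' = X) (hY : Y = Y') :
    HEq (eqToHom hX ≫ f ≫ eqToHom hY) f := by
  subst hX hY; simp

theorem map_heq_map {E : Type u₁} [Category.{v₁} E] (G : D ⥤ E) {X Y X' Y' : D} {f : X ⟶ Y}
    {f' : X' ⟶ Y'} (hX : X = X') (hY : Y = Y') (h : HEq f f') : HEq (G.map f) (G.map f') := by
  subst hX hY h; rfl

theorem exists_heq {X Y X' Y' : D} (f : X ⟶ Y) (hX : X' = X) (hY : Y' = Y) :
    ∃ f' : X' ⟶ Y', HEq f' f := by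
  subst hX hY; exact ⟨f, HEq.rfl⟩

theorem map_eqToHom_heq {E : Type u₁} [Category.{v₁} E] (G : D ⥤ E) {X Y : D} (h : X = Y)
    {X' Y' : E} (h' : X' = Y') (e : G.obj X = X') : HEq (G.map (eqToHom h)) (eqToHom h') := by
  subst h h' e; simp

variable [MonoidalCategory D]

theorem tensorHom_heq {X Y Z W X' Y' Z' W' : D} {f : X ⟶ Y} {g : Z ⟶ W} {f' : X' ⟶ Y'}
    {g' : Z' ⟶ W'} (hX : X = X') (hY : Y = Y') (hZ : Z = Z') (hW : W = W') (hf : HEq f f')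
    (hg : HEq g g') : HEq (f ⊗ₘ g) (f' ⊗ₘ g') := by
  subst hX hY hZ hW hf hg; rfl

theorem whiskerLeft_eqToHom' {X Y : D} (h : X = Y) (Z : D) :
    Z ◁ eqToHom h = eqToHom (congrArg (Z ⊗ ·) h) := by subst h; simp

variable [SymmetricCategory D]

theorem braiding_heq {X Y X' Y' : D} (hX : X = X') (hY : Y = Y') :
    HEq (β_ X Y).hom (β_ X' Y').hom := by subst hX hY; rfl

theorem trace_heq [TracedCategory D] {A B U A' B' U' : D} {f : A ⊗ U ⟶ B ⊗ U}
    {f' : A' ⊗ U' ⟶ B' ⊗ U'} (hA : A = A') (hB : B = B') (hU : U = U') (h : HEq f f') :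
    HEq (TracedCategory.trace U f) (TracedCategory.trace U' f') := by
  subst hA hB hU h; rfl

end Transport

section Strict
variable {C : Type u} [Category.{v} C] {D : Type u₁} [Category.{v₁} D] [MonoidalCategory D]
  [IsStrictMonoidal D]
open IsStrictMonoidal

theorem associator_inv_eq (X Y Z : D) : (α_ X Y Z).inv = eqToHom (assoc_obj X Y Z).symm := by
  rw [← cancel_epi (α_ X Y Z).hom, Iso.hom_inv_id, IsStrictMonoidal.associator_hom, eqToHom_trans,
    eqToHom_refl]

theorem leftUnitor_inv_eq (X : D) : (λ_ X).inv = eqToHom (unit_tensor_obj X).symm := by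
  rw [← cancel_epi (λ_ X).hom, Iso.hom_inv_id, leftUnitor_hom, eqToHom_trans, eqToHom_refl]

theorem rightUnitor_inv_eq (X : D) : (ρ_ X).inv = eqToHom (tensor_unit_obj X).symm := by
  rw [← cancel_epi (ρ_ X).hom, Iso.hom_inv_id, rightUnitor_hom, eqToHom_trans, eqToHom_refl]

theorem associator_conj_heq {A U V B X Y : D} {f : A ⊗ U ⊗ V ⟶ B ⊗ X ⊗ Y} :
    HEq ((α_ A U V).hom ≫ f ≫ (α_ B X Y).inv) f := by
  rw [IsStrictMonoidal.associator_hom, associator_inv_eq]; exact eqToHom_conj_heq _ _ _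

theorem leftUnitor_conj_heq {A B : D} {f : A ⟶ B} : HEq ((λ_ A).hom ≫ f ≫ (λ_ B).inv) f := by
  rw [leftUnitor_hom, leftUnitor_inv_eq]; exact eqToHom_conj_heq _ _ _

theorem rightUnitor_conj_heq {A B : D} {f : A ⊗ 𝟙_ D ⟶ B ⊗ 𝟙_ D} :
    HEq ((ρ_ A).inv ≫ f ≫ (ρ_ B).hom) f := by
  rw [rightUnitor_hom, rightUnitor_inv_eq]; exact eqToHom_conj_heq _ _ _

theorem tensor_id_unit_heq {X Y : D} (f : X ⟶ Y) : HEq (f ⊗ₘ 𝟙 (𝟙_ D)) f := by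
  rw [tensorHom_id]
  refine heq_of_eqToHom_square (tensor_unit_obj X).symm (tensor_unit_obj Y).symm ?_
  rw [← rightUnitor_inv_eq, ← rightUnitor_inv_eq, rightUnitor_inv_naturality]

/-- In a strict monoidal category, multiplication by a scalar is the tensor product with it. -/
theorem scalarMul_heq_tensor {X Y : D} (s : End (𝟙_ D)) (f : X ⟶ Y) :
    HEq (scalarMul s f) ((s : 𝟙_ D ⟶ 𝟙_ D) ⊗ₘ f) := by
  rw [scalarMul, MonoidalCategory.tensorHom_def, leftUnitor_inv_eq, ← leftUnitor_naturality,
    leftUnitor_hom]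
  simpa only [Category.assoc] using eqToHom_conj_heq ((s : 𝟙_ D ⟶ 𝟙_ D) ▷ X ≫ 𝟙_ D ◁ f) _ _

theorem listTensor_append (F : C ⥤ D) : ∀ as bs : List C,
    listTensor F (as ++ bs) = listTensor F as ⊗ listTensor F bs
  | [], _ => (unit_tensor_obj _).symm
  | a :: as, bs =>
    (congrArg (F.obj a ⊗ ·) (listTensor_append F as bs)).trans (assoc_obj _ _ _).symm

theorem listTensorAppend_hom (F : C ⥤ D) : ∀ as bs : List C,
    (listTensorAppend F as bs).hom = eqToHom (listTensor_append F as bs).symm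
  | [], _ => leftUnitor_hom _
  | a :: as, bs => by
    refine (congrArg₂ (· ≫ ·) (associator_hom _ _ _) ((congrArg (F.obj a ◁ ·)
      (listTensorAppend_hom F as bs)).trans (whiskerLeft_eqToHom' _ _))).trans ?_
    exact eqToHom_trans _ _

end Strict

namespace NormalForm
variable {C : Type u} [Category.{v} C] {D : Type u₁} [Category.{v₁} D] [MonoidalCategory D]
  [SymmetricCategory D] [TracedCategory D]

/-- The normal form of a morphism between lists of length one. -/
def single {X Y : C} (f : X ⟶ Y) : NormalForm [X] [Y] := ⟨0, .cons f .nil (.here _)⟩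

theorem eval_single (F : C ⥤ D) {X Y : C} (f : X ⟶ Y) :
    (single f).eval F = F.map f ⊗ₘ 𝟙 (𝟙_ D) :=
  (congrArg (scalarMul · _) (loopProd_zero F)).trans
    ((one_scalarMul _).trans (Category.comp_id _))

end NormalForm

/-! ### The extension of a functor to the free traced category -/

namespace FreeTraced

section Extension
variable {C : Type u} [Category.{v} C] {D : Type u₁} [Category.{v₁} D] [MonoidalCategory D]
  [SymmetricCategory D] [TracedCategory D] (F : C ⥤ D)

/-- A morphism between lists, interpreted in `D` through its normal form. -/
noncomputable def normalMap {as bs : List C} (f : ofList as ⟶ ofList bs) :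
    listTensor F as ⟶ listTensor F bs :=
  (normalForm f).eval F

theorem normalMap_eval {as bs : List C} (x : NormalForm as bs) :
    normalMap F (x.eval (of C)) = x.eval F :=
  congrArg (NormalForm.eval F) (normalForm_eq rfl)

theorem normalMap_id (as : List C) : normalMap F (𝟙 (ofList as)) = 𝟙 (listTensor F as) := by
  rw [← NormalForm.eval_id (of C), normalMap_eval, NormalForm.eval_id]

theorem normalMap_comp {as bs cs : List C} (f : ofList as ⟶ ofList bs)
    (g : ofList bs ⟶ ofList cs) : normalMap F (f ≫ g) = normalMap F f ≫ normalMap F g := by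
  rw [← eval_normalForm f, ← eval_normalForm g, ← NormalForm.eval_comp, normalMap_eval,
    NormalForm.eval_comp, normalMap_eval, normalMap_eval]

/-- The functor on the free traced category that extends `F`. Every object is the list of its
entries, up to the equality `ofList_toList`, and morphisms are interpreted through their normal
forms. -/
noncomputable def extension : FreeTraced C ⥤ D where
  obj A := listTensor F (toList A)
  map {A B} f := normalMap F (eqToHom (ofList_toList A) ≫ f ≫ eqToHom (ofList_toList B).symm)
  map_id A := by rw [Category.id_comp, eqToHom_trans, eqToHom_refl, normalMap_id]
  map_comp f g := by rw [← normalMap_comp]; simp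

theorem extension_obj (as : List C) : (extension F).obj (ofList as) = listTensor F as :=
  congrArg (listTensor F) (toList_ofList as)

/-- On the objects `ofList as` the transports in the definition of the extension disappear. -/
theorem extension_map {as bs : List C} (f : ofList as ⟶ ofList bs) :
    HEq ((extension F).map f) (normalMap F f) := by
  have key : ∀ {as' bs' : List C} (ha : as' = as) (hb : bs' = bs) (p : ofList as' = ofList as)
      (q : ofList bs = ofList bs'), HEq (normalMap F (eqToHom p ≫ f ≫ eqToHom q))
        (normalMap F f) := by
    rintro _ _ rfl rfl p q
    simp
  exact key (toList_ofList as) (toList_ofList bs) _ _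

theorem extension_map_eval {as bs : List C} (x : NormalForm as bs) :
    HEq ((extension F).map (x.eval (of C))) (x.eval F) :=
  (extension_map F _).trans (heq_of_eq (normalMap_eval F x))

variable [IsStrictMonoidal D]

theorem extension_obj_tensor (A B : FreeTraced C) :
    (extension F).obj (A ⊗ B) = (extension F).obj A ⊗ (extension F).obj B :=
  (congrArg (listTensor F) (toList_append A B)).trans (listTensor_append F _ _)

theorem extension_map_tensor {A B A' B' : FreeTraced C} (f : A ⟶ B) (g : A' ⟶ B') :
    HEq ((extension F).map (f ⊗ₘ g)) ((extension F).map f ⊗ₘ (extension F).map g) := by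
  obtain ⟨as, rfl⟩ := exists_ofList A
  obtain ⟨bs, rfl⟩ := exists_ofList B
  obtain ⟨as', rfl⟩ := exists_ofList A'
  obtain ⟨bs', rfl⟩ := exists_ofList B'
  have h₁ := NormalForm.eval_tensor (of C) (normalForm f) (normalForm g)
  have h₂ := NormalForm.eval_tensor F (normalForm f) (normalForm g)
  rw [listTensorAppend_hom, listTensorAppend_hom] at h₁ h₂
  have h₁ := heq_of_eqToHom_square _ _ h₁
  have h₂ := heq_of_eqToHom_square _ _ h₂
  rw [eval_normalForm, eval_normalForm] at h₁
  refine (map_heq_map _ (listTensor_append (of C) _ _).symm (listTensor_append (of C) _ _).symm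
    h₁.symm).trans ((extension_map_eval F _).trans (h₂.trans ?_))
  exact tensorHom_heq (extension_obj F _).symm (extension_obj F _).symm (extension_obj F _).symm
    (extension_obj F _).symm (extension_map F f).symm (extension_map F g).symm

theorem extension_map_braiding (A B : FreeTraced C) :
    HEq ((extension F).map (β_ A B).hom)
      (β_ ((extension F).obj A) ((extension F).obj B)).hom := by
  obtain ⟨as, rfl⟩ := exists_ofList A
  obtain ⟨bs, rfl⟩ := exists_ofList B
  have h₁ := NormalForm.eval_swap (of C) as bs
  have h₂ := NormalForm.eval_swap F as bs
  rw [listTensorAppend_hom, listTensorAppend_hom] at h₁ h₂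
  have h₁ := heq_of_eqToHom_square _ _ h₁
  have h₂ := heq_of_eqToHom_square _ _ h₂
  refine (map_heq_map _ (listTensor_append (of C) _ _).symm (listTensor_append (of C) _ _).symm
    h₁.symm).trans ((extension_map_eval F _).trans (h₂.trans ?_))
  exact braiding_heq (extension_obj F _).symm (extension_obj F _).symm

end Extension
end FreeTraced

/-! ### The extension preserves the trace -/

namespace FreeTraced

variable {C : Type u} [Category.{v} C] {D : Type u₁} [Category.{v₁} D] [MonoidalCategory D]
  [SymmetricCategory D] [TracedCategory D] [IsStrictMonoidal D] (F : C ⥤ D)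

/-- The extension of `F` preserves traces along `U`, where the image of a morphism `f` with feedback
along `U` is replaced by a morphism `f'` of the required type that equals it up to transport. -/
def PreservesTraceAlong (U : FreeTraced C) : Prop :=
  ∀ {A B : FreeTraced C} (f : A ⊗ U ⟶ B ⊗ U)
    (f' : (extension F).obj A ⊗ (extension F).obj U ⟶ (extension F).obj B ⊗ (extension F).obj U),
    HEq f' ((extension F).map f) →
      (extension F).map (TracedCategory.trace U f) = TracedCategory.trace _ f'

theorem preservesTraceAlong_unit : PreservesTraceAlong F (𝟙_ (FreeTraced C)) := by
  intro A B f f' h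
  rw [TracedCategory.vanishing_unit f]
  refine eq_of_heq ?_
  refine HEq.trans ?_ (heq_of_eq (TracedCategory.vanishing_unit (D := D) f').symm)
  refine HEq.trans ?_ (rightUnitor_conj_heq (f := f')).symm
  refine HEq.trans ?_ h.symm
  exact map_heq_map _ (IsStrictMonoidal.tensor_unit_obj A).symm
    (IsStrictMonoidal.tensor_unit_obj B).symm rightUnitor_conj_heq

variable {F} in
theorem PreservesTraceAlong.tensor {U V : FreeTraced C} (hU : PreservesTraceAlong F U)
    (hV : PreservesTraceAlong F V) : PreservesTraceAlong F (U ⊗ V) := by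
  intro A B f f' h
  have tU := extension_obj_tensor F
  rw [TracedCategory.vanishing_tensor f]
  obtain ⟨f₁, h₁⟩ := exists_heq f'
    (X' := (extension F).obj A ⊗ (extension F).obj U ⊗ (extension F).obj V)
    (Y' := (extension F).obj B ⊗ (extension F).obj U ⊗ (extension F).obj V)
    (by rw [tU]) (by rw [tU])
  have h₂ : HEq (TracedCategory.trace ((extension F).obj (U ⊗ V)) f')
      (TracedCategory.trace ((extension F).obj U ⊗ (extension F).obj V) f₁) :=
    trace_heq rfl rfl (tU _ _) h₁.symm
  refine Eq.trans ?_ (eq_of_heq h₂).symm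
  rw [TracedCategory.vanishing_tensor f₁]
  refine hU _ _ ?_
  obtain ⟨f₂, h₃⟩ := exists_heq ((α_ _ _ _).hom ≫ f₁ ≫ (α_ _ _ _).inv)
    (X' := (extension F).obj (A ⊗ U) ⊗ (extension F).obj V)
    (Y' := (extension F).obj (B ⊗ U) ⊗ (extension F).obj V)
    (by rw [tU]) (by rw [tU])
  rw [hV _ f₂]
  · exact trace_heq (tU _ _).symm (tU _ _).symm rfl h₃.symm
  · refine h₃.trans (associator_conj_heq.trans (h₁.trans (h.trans ?_)))
    exact map_heq_map _ (IsStrictMonoidal.assoc_obj _ _ _).symm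
      (IsStrictMonoidal.assoc_obj _ _ _).symm associator_conj_heq.symm

theorem extension_obj_of (X : C) : (extension F).obj ((of C).obj X) = F.obj X :=
  IsStrictMonoidal.tensor_unit_obj (F.obj X)

theorem trace_eq_leftTrace {E : Type u₂} [Category.{v₂} E] [MonoidalCategory E]
    [SymmetricCategory E] [TracedCategory E] {A B X : E} (f : A ⊗ X ⟶ B ⊗ X) :
    TracedCategory.trace X f = leftTrace X ((β_ X A).hom ≫ f ≫ (β_ B X).hom) := by
  simp [leftTrace]

/-- Along a generator, the trace is given on normal forms by `NormalForm.traceHead`, in the free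
traced category as well as in `D`. -/
theorem preservesTraceAlong_of (X : C) : PreservesTraceAlong F ((of C).obj X) := by
  intro A B f f' h
  obtain ⟨as, rfl⟩ := exists_ofList A
  obtain ⟨bs, rfl⟩ := exists_ofList B
  -- The feedback is moved to the front, where normal forms trace it out.
  let g : ofList (X :: as) ⟶ ofList (X :: bs) := (β_ _ _).hom ≫ f ≫ (β_ _ _).hom
  have h₁ : TracedCategory.trace _ f = leftTrace _ g := trace_eq_leftTrace f
  rw [h₁, ← eval_normalForm g, ← NormalForm.eval_traceHead]
  refine eq_of_heq ((extension_map_eval F _).trans ?_)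
  rw [NormalForm.eval_traceHead]
  have h₂ := trace_eq_leftTrace f'
  rw [h₂]
  refine trace_heq (extension_obj F _).symm (extension_obj F _).symm (extension_obj_of F X).symm ?_
  have eA := extension_obj F as
  have eB := extension_obj F bs
  have eX := extension_obj_of F X
  refine comp_heq_comp ?_ ?_ ?_ (braiding_heq eA.symm eX.symm) <|
    comp_heq_comp ?_ ?_ ?_ ?_ (braiding_heq eX.symm eB.symm)
  all_goals try (rw [eA, eX])
  all_goals try (rw [eB, eX])
  refine (extension_map F g).symm.trans ?_
  change HEq ((extension F).map ((β_ _ _).hom ≫ f ≫ (β_ _ _).hom)) _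
  rw [Functor.map_comp, Functor.map_comp]
  exact comp_heq_comp (extension_obj_tensor F _ _) (extension_obj_tensor F _ _)
    (extension_obj_tensor F _ _) (extension_map_braiding F _ _) <|
    comp_heq_comp (extension_obj_tensor F _ _) (extension_obj_tensor F _ _)
    (extension_obj_tensor F _ _) h.symm (extension_map_braiding F _ _)

/-- Since every object is a tensor product of generators, vanishing reduces the trace along it to
traces along generators. -/
theorem preservesTraceAlong (U : FreeTraced C) : PreservesTraceAlong F U := by
  obtain ⟨us, rfl⟩ := exists_ofList U
  induction us with
  | nil => exact preservesTraceAlong_unit F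
  | cons a us ih => exact PreservesTraceAlong.tensor (preservesTraceAlong_of F a) ih

theorem extension_isStrictTracedFunctor : IsStrictTracedFunctor (extension F) where
  obj_unit := rfl
  obj_tensor := extension_obj_tensor F
  map_tensor f g := (conj_eqToHom_iff_heq _ _ _ (extension_obj_tensor F _ _)).2
    (extension_map_tensor F f g)
  map_braiding A B := (conj_eqToHom_iff_heq _ _ _ (extension_obj_tensor F _ _)).2
    (extension_map_braiding F A B)
  map_trace U f := preservesTraceAlong F U f _ (eqToHom_conj_heq _ _ _)

theorem of_comp_extension : of C ⋙ extension F = F := by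
  refine Functor.hext (fun X => extension_obj_of F X) fun X Y f => ?_
  let x := NormalForm.single f
  have h₁ : HEq (x.eval (of C)) ((of C).map f) :=
    (heq_of_eq (NormalForm.eval_single _ f)).trans (tensor_id_unit_heq _)
  have h₂ : HEq (x.eval F) (F.map f) :=
    (heq_of_eq (NormalForm.eval_single _ f)).trans (tensor_id_unit_heq _)
  exact (map_heq_map _ (IsStrictMonoidal.tensor_unit_obj _).symm
    (IsStrictMonoidal.tensor_unit_obj _).symm h₁.symm).trans ((extension_map_eval F x).trans h₂)

end FreeTraced

/-! ### Uniqueness of the extension -/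

namespace IsStrictTracedFunctor

variable {C : Type u} [Category.{v} C] {E : Type u₂} [Category.{v₂} E] [MonoidalCategory E]
  [SymmetricCategory E] [TracedCategory E] [IsStrictMonoidal E]
  {D : Type u₁} [Category.{v₁} D] [MonoidalCategory D]
  [SymmetricCategory D] [TracedCategory D] [IsStrictMonoidal D] {G : E ⥤ D}

theorem map_tensor_heq (hG : IsStrictTracedFunctor G) {X Y X' Y' : E} (f : X ⟶ Y)
    (g : X' ⟶ Y') : HEq (G.map (f ⊗ₘ g)) (G.map f ⊗ₘ G.map g) := by
  rw [hG.map_tensor]; exact eqToHom_conj_heq _ _ _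

theorem map_braiding_heq (hG : IsStrictTracedFunctor G) (X Y : E) :
    HEq (G.map (β_ X Y).hom) (β_ (G.obj X) (G.obj Y)).hom := by
  rw [hG.map_braiding]; exact eqToHom_conj_heq _ _ _

theorem map_whiskerLeft_heq (hG : IsStrictTracedFunctor G) (X : E) {Y Z : E} (f : Y ⟶ Z) :
    HEq (G.map (X ◁ f)) (G.obj X ◁ G.map f) := by
  rw [← id_tensorHom, ← id_tensorHom, ← G.map_id]; exact hG.map_tensor_heq _ _

theorem map_whiskerRight_heq (hG : IsStrictTracedFunctor G) {Y Z : E} (f : Y ⟶ Z) (X : E) :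
    HEq (G.map (f ▷ X)) (G.map f ▷ G.obj X) := by
  rw [← tensorHom_id, ← tensorHom_id, ← G.map_id]; exact hG.map_tensor_heq _ _

theorem map_exchangeFactors_heq (hG : IsStrictTracedFunctor G) (X Y Z : E) :
    HEq (G.map (exchangeFactors X Y Z)) (exchangeFactors (G.obj X) (G.obj Y) (G.obj Z)) := by
  have t := hG.obj_tensor
  rw [exchangeFactors, exchangeFactors, G.map_comp, G.map_comp]
  refine comp_heq_comp (by simp only [t]) (by simp only [t]) (by simp only [t]) ?_ <|
    comp_heq_comp (by simp only [t]) (by simp only [t]) (by simp only [t]) ?_ ?_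
  · rw [associator_inv_eq, associator_inv_eq]
    exact map_eqToHom_heq _ _ _ (by simp only [t])
  · refine (hG.map_whiskerRight_heq _ _).trans ?_
    rw [← tensorHom_id, ← tensorHom_id]
    exact tensorHom_heq (t _ _) (t _ _) rfl rfl (hG.map_braiding_heq _ _) HEq.rfl
  · rw [IsStrictMonoidal.associator_hom, IsStrictMonoidal.associator_hom]
    exact map_eqToHom_heq _ _ _ (by simp only [t])

theorem obj_listTensor (hG : IsStrictTracedFunctor G) (F : C ⥤ E) : ∀ as : List C,
    G.obj (listTensor F as) = listTensor (F ⋙ G) as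
  | [] => hG.obj_unit
  | a :: as => (hG.obj_tensor _ _).trans (congrArg (G.obj (F.obj a) ⊗ ·) (hG.obj_listTensor F as))

theorem map_insertion (hG : IsStrictTracedFunctor G) (F : C ⥤ E) {b : C} :
    ∀ {bs cs : List C} (i : Insertion b bs cs), HEq (G.map (i.eval F)) (i.eval (F ⋙ G))
  | bs, _, .here _ => by
    refine (heq_of_eq (G.map_id _)).trans (id_heq_id ?_)
    exact hG.obj_listTensor F (b :: bs)
  | _, _, .there (bs := bs) (cs := cs) c i => by
    have t := hG.obj_tensor
    have ebs := hG.obj_listTensor F bs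
    have ecs := hG.obj_listTensor F cs
    refine (heq_of_eq (G.map_comp _ _)).trans ?_
    refine comp_heq_comp (hG.obj_listTensor F (b :: c :: bs)) ?_ (hG.obj_listTensor F (c :: cs))
      ?_ ?_
    · refine (t _ _).trans ?_
      exact congrArg (G.obj (F.obj c) ⊗ ·) (hG.obj_listTensor F (b :: bs))
    · refine (hG.map_exchangeFactors_heq _ _ _).trans ?_
      rw [ebs]; rfl
    · refine (hG.map_whiskerLeft_heq _ _).trans ?_
      rw [← id_tensorHom, ← id_tensorHom]
      exact tensorHom_heq rfl rfl (hG.obj_listTensor F (b :: bs)) ecs HEq.rfl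
        (hG.map_insertion F i)

theorem map_matching (hG : IsStrictTracedFunctor G) (F : C ⥤ E) :
    ∀ {as bs : List C} (m : Matching as bs), HEq (G.map (m.eval F)) (m.eval (F ⋙ G))
  | _, _, .nil => (heq_of_eq (G.map_id _)).trans (id_heq_id hG.obj_unit)
  | _, _, .cons (a := a) (b := b) (as := as) (bs := bs) (cs := cs) f m i => by
    refine (heq_of_eq (G.map_comp _ _)).trans ?_
    refine comp_heq_comp (hG.obj_listTensor F (a :: as)) (hG.obj_listTensor F (b :: bs))
      (hG.obj_listTensor F cs) ?_ (hG.map_insertion F i)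
    refine (hG.map_tensor_heq _ _).trans ?_
    exact tensorHom_heq rfl rfl (hG.obj_listTensor F as) (hG.obj_listTensor F bs) HEq.rfl
      (hG.map_matching F m)

theorem map_traceOut (hG : IsStrictTracedFunctor G) {X : E} (s : X ⟶ X) :
    HEq (G.map (traceOut s : 𝟙_ E ⟶ 𝟙_ E)) (traceOut (G.map s) : 𝟙_ D ⟶ 𝟙_ D) := by
  rw [traceOut, traceOut, hG.map_trace]
  refine trace_heq hG.obj_unit hG.obj_unit rfl ((eqToHom_conj_heq _ _ _).trans ?_)
  refine HEq.trans ?_ leftUnitor_conj_heq.symm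
  exact map_heq_map _ (IsStrictMonoidal.unit_tensor_obj X) (IsStrictMonoidal.unit_tensor_obj X)
    leftUnitor_conj_heq

theorem map_loopProd (hG : IsStrictTracedFunctor G) (F : C ⥤ E) (S : Multiset (CatLoop C)) :
    HEq (G.map (loopProd F S : 𝟙_ E ⟶ 𝟙_ E)) (loopProd (F ⋙ G) S : 𝟙_ D ⟶ 𝟙_ D) := by
  induction S using Multiset.induction with
  | empty => exact (heq_of_eq (G.map_id _)).trans (id_heq_id hG.obj_unit)
  | cons a S ih =>
    obtain ⟨X, s, rfl⟩ : ∃ (X : C) (s : X ⟶ X), a = CatLoop.mk s := by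
      obtain ⟨⟨X, s⟩, rfl⟩ := Quot.exists_rep a
      exact ⟨X, s, rfl⟩
    rw [← Multiset.singleton_add, loopProd_add, loopProd_add]
    refine (heq_of_eq (G.map_comp _ _)).trans ?_
    refine comp_heq_comp hG.obj_unit hG.obj_unit hG.obj_unit ih ?_
    rw [loopProd_singleton, loopProd_singleton]
    exact hG.map_traceOut _

theorem map_normalForm (hG : IsStrictTracedFunctor G) (F : C ⥤ E) {as bs : List C}
    (x : NormalForm as bs) : HEq (G.map (x.eval F)) (x.eval (F ⋙ G)) := by
  refine HEq.trans ?_ (scalarMul_heq_tensor _ _).symm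
  refine (map_heq_map G (IsStrictMonoidal.unit_tensor_obj _).symm
    (IsStrictMonoidal.unit_tensor_obj _).symm (scalarMul_heq_tensor _ _)).trans ?_
  refine (hG.map_tensor_heq _ _).trans ?_
  exact tensorHom_heq hG.obj_unit hG.obj_unit (hG.obj_listTensor F as) (hG.obj_listTensor F bs)
    (hG.map_loopProd F _) (hG.map_matching F _)

/-- A strict traced functor is determined on generators, since every morphism is the interpretation
of its normal form and strict traced functors commute with the interpretation. -/
theorem eq_extension {G : FreeTraced C ⥤ D} (hG : IsStrictTracedFunctor G) :
    G = FreeTraced.extension (FreeTraced.of C ⋙ G) := by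
  refine Functor.hext (fun A => ?_) fun A B f => ?_
  · obtain ⟨as, rfl⟩ := FreeTraced.exists_ofList A
    exact (hG.obj_listTensor _ as).trans (FreeTraced.extension_obj _ as).symm
  · obtain ⟨as, rfl⟩ := FreeTraced.exists_ofList A
    obtain ⟨bs, rfl⟩ := FreeTraced.exists_ofList B
    have h := hG.map_normalForm (FreeTraced.of C) (FreeTraced.normalForm f)
    rw [FreeTraced.eval_normalForm] at h
    exact h.trans (FreeTraced.extension_map _ f).symm

end IsStrictTracedFunctor

/-! ### The closed form of a morphism -/

namespace FreeTraced
variable {C : Type u} [Category.{v} C]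

theorem isRelabel_of_segment {A B : FreeTraced C} {f : A ⟶ B} (h : Hom.loops f = 0)
    (hs : ∀ i, segment f i = ⟨A.obj i, A.obj i, 𝟙 _⟩) : IsRelabel f :=
  isRelabel_of_heq h (fun i => (congrArg (fun s : Segment C => s.2.1) (hs i)).symm)
    fun i => heq_of_segment_eq (hs i)

theorem isSymmetryComposite_whiskerLeft {D : Type u₁} [Category.{v₁} D] [MonoidalCategory D]
    [SymmetricCategory D] (X : D) {Y Z : D} {f : Y ⟶ Z} (hf : IsSymmetryComposite f) :
    IsSymmetryComposite (X ◁ f) := by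
  rw [← id_tensorHom]; exact .tensor (.id X) hf

theorem isSymmetryComposite_insertion {D : Type u₁} [Category.{v₁} D] [MonoidalCategory D]
    [SymmetricCategory D] (F : C ⥤ D) {b : C} {bs cs : List C} (i : Insertion b bs cs) :
    IsSymmetryComposite (i.eval F) := by
  induction i with
  | here => exact .id _
  | there c i ih =>
    refine .comp (.comp (.associator_inv _ _ _) (.comp ?_ (.associator _ _ _)))
      (isSymmetryComposite_whiskerLeft _ ih)
    rw [← tensorHom_id]
    exact .tensor (.braiding _ _) (.id _)

/-- If all labels of the interpretation of a matching are identities, then so are the morphisms in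
the matching, and what remains are insertions. -/
theorem isSymmetryComposite_matching {as bs : List C} (m : Matching as bs)
    (hm : IsRelabel (m.eval (of C))) : IsSymmetryComposite (m.eval (of C)) := by
  induction m with
  | nil => exact .id _
  | @cons a b as bs cs f m i ih =>
    have hs (j) : segment ((of C).map f ⊗ₘ m.eval (of C)) j = ⟨_, _, 𝟙 _⟩ :=
      (segment_post (isRelabel_eval i) _ j).symm.trans (segment_relabel hm j)
    have h₀ : (⟨a, b, f⟩ : Segment C) = ⟨a, a, 𝟙 a⟩ :=
      (segment_tensor_inL ((of C).map f) (m.eval (of C)) (onlyPos a)).symm.trans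
        ((hs _).trans (segment_eq (obj_inL _ _ _) (obj_inL _ _ _) (id_heq_id (obj_inL _ _ _))))
    have hm' : IsRelabel (m.eval (of C)) := isRelabel_of_segment (loops_eval m) fun j =>
      (segment_tensor_inR ((of C).map f) (m.eval (of C)) j).symm.trans
        ((hs _).trans (segment_eq (obj_inR _ _ _) (obj_inR _ _ _) (id_heq_id (obj_inR _ _ _))))
    cases h₀
    refine .comp (.tensor ?_ (ih hm')) (isSymmetryComposite_insertion _ i)
    rw [(of C).map_id]
    exact .id _

/-- A permutation with identity labels is built from symmetries. -/
theorem IsRelabel.isSymmetryComposite {A B : FreeTraced C} {f : A ⟶ B} (hf : IsRelabel f) :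
    IsSymmetryComposite f := by
  obtain ⟨as, rfl⟩ := exists_ofList A
  obtain ⟨bs, rfl⟩ := exists_ofList B
  obtain ⟨m, rfl⟩ := exists_eval_eq f hf.loops
  exact isSymmetryComposite_matching m hf

theorem isRelabel_permute {n : ℕ} (B : FreeTraced C) (π : Fin n ≃ Fin B.len) :
    IsRelabel (permute B π) :=
  isRelabel_of_heq rfl (fun _ => rfl) fun _ => HEq.rfl

theorem tensorFamily_of {n : ℕ} (X : Fin n → C) :
    tensorFamily n (fun i => (of C).obj (X i)) = ⟨n, X⟩ := by
  refine toList_injective ?_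
  induction n with
  | zero => exact (List.ofFn_zero (f := X)).symm
  | succ n ih =>
    refine (toList_append _ _).trans ?_
    rw [ih]
    exact (List.ofFn_succ (f := X)).symm

/-- A tensor product of morphisms of `C` is the loop-free morphism with identity permutation and
these labels. -/
theorem tensorFamilyMap_of {n : ℕ} {X Y : Fin n → C} (f : ∀ i, X i ⟶ Y i) :
    HEq (tensorFamilyMap n fun i => (of C).map (f i))
      (homMk 0 (Equiv.refl _) f : (⟨n, X⟩ : FreeTraced C) ⟶ ⟨n, Y⟩) := by
  induction n with
  | zero =>
    obtain rfl : X = Fin.elim0 := funext fun i => i.elim0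
    obtain rfl : Y = Fin.elim0 := funext fun i => i.elim0
    exact heq_of_eq (hom_ext rfl (fun i => i.elim0) fun i => i.elim0)
  | succ n ih =>
    have key (Z : Fin (n + 1) → C) :
        (of C).obj (Z 0) ⊗ (⟨n, fun i => Z i.succ⟩ : FreeTraced C) = ⟨n + 1, Z⟩ :=
      (congrArg ((of C).obj (Z 0) ⊗ ·) (tensorFamily_of fun i => Z i.succ)).symm.trans
        (tensorFamily_of Z)
    -- The first entry and the remaining list, as positions `0` and `i + 1` of the whole list.
    have hpos₀ (Z : Fin (n + 1) → C) : Hom.perm (eqToHom (key Z)) (headPos (Z 0) _) =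
        (0 : Fin (n + 1)) := by rw [eqToHom_perm]; rfl
    have hpos (Z : Fin (n + 1) → C) (i : Fin n) :
        Hom.perm (eqToHom (key Z)) (inR ((of C).obj (Z 0)) ⟨n, fun i => Z i.succ⟩ i) = i.succ := by
      rw [eqToHom_perm]; exact Fin.ext (Nat.add_comm _ _)
    refine (tensorHom_heq rfl rfl (tensorFamily_of _) (tensorFamily_of _) HEq.rfl
      (ih fun i => f i.succ)).trans ?_
    refine (heq_of_eqToHom_square (key X) (key Y) ?_).symm
    refine (square (isRelabel_eqToHom _) (isRelabel_eqToHom _) (add_zero _)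
      (cases_headPos ?_ fun i => ?_) (cases_headPos ?_ fun i => ?_)).symm
    · exact (congrArg (Hom.perm (eqToHom (key Y))) (tensor_perm_inL _ _ _)).trans
        ((hpos₀ Y).trans (hpos₀ X).symm)
    · exact (congrArg (Hom.perm (eqToHom (key Y))) (tensor_perm_inR _ _ _)).trans
        ((hpos Y i).trans (hpos X i).symm)
    · exact (tensor_arrow_inL _ _ _).trans (congr_arg_heq f (hpos₀ X).symm)
    · exact (tensor_arrow_inR _ _ _).trans (congr_arg_heq f (hpos X i).symm)

theorem homMk_eq_scalarMul {A B : FreeTraced C} (L : List (Σ X : C, X ⟶ X))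
    (π : Fin A.len ≃ Fin B.len) (lab : ∀ i, A.obj i ⟶ B.obj (π i))
    (hA : A = tensorFamily A.len fun i => (of C).obj (A.obj i))
    (hB : tensorFamily A.len (fun i => (of C).obj (B.obj (π i))) = reindex B π) :
    homMk (L.map fun s => CatLoop.mk s.2 : List (CatLoop C)) π lab =
      scalarMul (L.map fun s => traceOut ((of C).map s.2)).prod
        (eqToHom hA ≫ tensorFamilyMap A.len (fun i => (of C).map (lab i)) ≫
          eqToHom hB ≫ permute B π) := by
  have h : eqToHom hA ≫ tensorFamilyMap A.len (fun i => (of C).map (lab i)) ≫ eqToHom hB =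
      homMk (A := A) (B := reindex B π) 0 (Equiv.refl (Fin A.len)) lab := by
    have h₀ : HEq (tensorFamilyMap A.len fun i => (of C).map (lab i))
      (homMk (A := A) (B := reindex B π) 0 (Equiv.refl (Fin A.len)) lab) := tensorFamilyMap_of lab
    exact eq_of_heq ((eqToHom_conj_heq _ _ _).trans h₀)
  rw [← loopProd_coe, scalarMul_eq_homMk, loops_loopProd, ← Category.assoc, ← Category.assoc,
    Category.assoc (eqToHom hA), h]
  refine hom_ext (add_zero _).symm (fun _ => rfl) fun i => ?_
  exact heq_of_eq (Category.comp_id _).symm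

/-! ### The scalars -/

/-- A scalar is a multiset of loops. -/
def scalarEquiv : End (𝟙_ (FreeTraced C)) ≃* Multiplicative (Multiset (CatLoop C)) where
  toFun s := Multiplicative.ofAdd (Hom.loops s)
  invFun S := homMk (A := empty) (B := empty) S.toAdd (Equiv.refl _) fun i => i.elim0
  left_inv _ := hom_ext rfl (fun i => i.elim0) fun i => i.elim0
  right_inv _ := rfl
  -- The product `s * t` of endomorphisms is the composite `t ≫ s`.
  map_mul' s t := congrArg Multiplicative.ofAdd (add_comm (Hom.loops t) (Hom.loops s))

end FreeTraced

/-! ### One generator -/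

/-- A fully faithful functor that is bijective on objects is an isomorphism of categories. -/
theorem exists_inverse_of_bijective_obj {X : Type u₁} [Category.{v₁} X] {Y : Type u₂}
    [Category.{v₂} Y] (H : X ⥤ Y) [H.Full] [H.Faithful] (h : Function.Bijective H.obj) :
    ∃ K : Y ⥤ X, H ⋙ K = 𝟭 X ∧ K ⋙ H = 𝟭 Y := by
  let e := Equiv.ofBijective H.obj h
  have he (y : Y) : H.obj (e.symm y) = y := e.apply_symm_apply y
  let K : Y ⥤ X :=
    { obj := e.symm
      map := fun {y z} f => H.preimage (eqToHom (he y) ≫ f ≫ eqToHom (he z).symm)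
      map_id := fun y => H.map_injective (by simp)
      map_comp := fun f g => H.map_injective (by simp) }
  refine ⟨K, CategoryTheory.Functor.ext (fun x => e.symm_apply_apply x) fun x y f =>
    H.map_injective ?_,
    CategoryTheory.Functor.ext he fun y z f => H.map_preimage _⟩
  have key {a b a' b' : X} (g : a ⟶ b) (p : a' = a) (q : b = b') (p' : H.obj a' = H.obj a)
      (q' : H.obj b = H.obj b') :
      eqToHom p' ≫ H.map g ≫ eqToHom q' = H.map (eqToHom p ≫ g ≫ eqToHom q) := by
    subst p q; simp
  exact (H.map_preimage _).trans (key f _ _ _ _)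

namespace FreeTraced

/-- The category with one morphism has only one loop. -/
theorem catLoop_one (l : CatLoop (Discrete PUnit.{1})) :
    l = CatLoop.mk (𝟙 (Discrete.mk PUnit.unit)) := by
  obtain ⟨⟨⟨⟨⟩⟩, s⟩, rfl⟩ := Quot.exists_rep l
  exact congrArg CatLoop.mk (Subsingleton.elim s (𝟙 _))

theorem perm_symmetricGroups_injective : ∀ {X Y : SymmetricGroups} (f g : X ⟶ Y),
    SymmetricGroups.perm f = SymmetricGroups.perm g → f = g
  | _, _, Sigma.SigmaHom.mk _, Sigma.SigmaHom.mk _, h => congrArg Sigma.SigmaHom.mk h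

instance : freeTracedOfOne.Faithful where
  map_injective {X Y} f g h := by
    obtain ⟨f, k⟩ := f
    obtain ⟨g, l⟩ := g
    obtain ⟨h₁, h₂, -⟩ := Hom.mk.inj h
    refine Prod.ext ?_ ?_
    · exact perm_symmetricGroups_injective _ _ h₂
    · have := congrArg Multiset.card h₁
      rw [Multiset.card_replicate, Multiset.card_replicate] at this
      exact Multiplicative.toAdd.injective this

instance : freeTracedOfOne.Full where
  map_surjective {X Y} f := by
    obtain ⟨⟨n, x⟩, y⟩ := X
    obtain ⟨⟨m, x'⟩, y'⟩ := Y
    obtain rfl : n = m := Fin.equiv_iff_eq.1 ⟨Hom.perm f⟩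
    refine ⟨(Sigma.SigmaHom.mk (Hom.perm f), Multiplicative.ofAdd (Multiset.card (Hom.loops f))),
      hom_ext ?_ (fun _ => rfl) fun _ => heq_of_eq (Subsingleton.elim _ _)⟩
    exact (Multiset.eq_replicate_card.2 fun l _ => catLoop_one l).symm

theorem freeTracedOfOne_obj_bijective : Function.Bijective freeTracedOfOne.obj := by
  constructor
  · rintro ⟨⟨n, ⟨⟩⟩, ⟨⟩⟩ ⟨⟨m, ⟨⟩⟩, ⟨⟩⟩ h
    obtain rfl : n = m := congrArg FreeTraced.len h
    rfl
  · rintro ⟨n, A⟩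
    exact ⟨(⟨n, PUnit.unit⟩, PUnit.unit), congrArg (FreeTraced.mk n) (funext fun i => rfl)⟩

end FreeTraced

theorem mainTheorem1 :
    (∀ (C : Type u) [Category.{v} C],
      IsStrictMonoidal (FreeTraced C) ∧
      ∃ _ : TracedCategory (FreeTraced C),
        -- the trace is computed by following paths and collecting loops
        (∀ (A B U : FreeTraced C) (f : A ⊗ U ⟶ B ⊗ U) (g : A ⟶ B),
          TracedCategory.trace U f = g ↔ FreeTraced.IsTraceOf f g) ∧
        -- freeness
        (∀ (D : Type u₁) [Category.{v₁} D] [MonoidalCategory D] [SymmetricCategory D]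
          [TracedCategory D] [IsStrictMonoidal D] (F : C ⥤ D),
          ∃! G : FreeTraced C ⥤ D, IsStrictTracedFunctor G ∧ FreeTraced.of C ⋙ G = F) ∧
        -- every morphism is a scalar multiple of a tensor product followed by a permutation
        (∀ (A B : FreeTraced C) (L : List (Σ X : C, X ⟶ X)) (π : Fin A.len ≃ Fin B.len)
          (lab : ∀ i, A.obj i ⟶ B.obj (π i)),
          IsSymmetryComposite (FreeTraced.permute B π) ∧
          ∃ (hA : A = tensorFamily A.len fun i => (FreeTraced.of C).obj (A.obj i))
            (hB : tensorFamily A.len (fun i => (FreeTraced.of C).obj (B.obj (π i))) =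
              FreeTraced.reindex B π),
            FreeTraced.homMk (L.map fun s => CatLoop.mk s.2 : List (CatLoop C)) π lab =
              scalarMul (L.map fun s => traceOut ((FreeTraced.of C).map s.2)).prod
                (eqToHom hA ≫
                  tensorFamilyMap A.len (fun i => (FreeTraced.of C).map (lab i)) ≫
                  eqToHom hB ≫ FreeTraced.permute B π)) ∧
        -- the monoid of scalars is the free commutative monoid on the loops
        (∃ φ : End (𝟙_ (FreeTraced C)) ≃* Multiplicative (Multiset (CatLoop C)),
          ∀ s : End (𝟙_ (FreeTraced C)),
            φ s = Multiplicative.ofAdd (FreeTraced.Hom.loops s))) ∧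
    -- the case of one generator
    (∃ Φ : FreeTraced (Discrete PUnit.{1}) ⥤ SymmetricGroups × SingleObj (Multiplicative ℕ),
      freeTracedOfOne ⋙ Φ = 𝟭 _ ∧ Φ ⋙ freeTracedOfOne = 𝟭 _) := by
  refine ⟨fun C _ => ⟨inferInstance, inferInstance, fun A B U f g =>
    FreeTraced.traceHom_eq_iff, fun D _ _ _ _ _ F => ⟨FreeTraced.extension F,
      ⟨FreeTraced.extension_isStrictTracedFunctor F, FreeTraced.of_comp_extension F⟩, ?_⟩,
    fun A B L π lab => ⟨(FreeTraced.isRelabel_permute B π).isSymmetryComposite,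
      (FreeTraced.tensorFamily_of A.obj).symm, FreeTraced.tensorFamily_of fun i => B.obj (π i),
      FreeTraced.homMk_eq_scalarMul L π lab _ _⟩,
    FreeTraced.scalarEquiv, fun _ => rfl⟩,
    exists_inverse_of_bijective_obj _ FreeTraced.freeTracedOfOne_obj_bijective⟩
  rintro G ⟨hG, rfl⟩
  exact hG.eq_extension
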